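/- Let $\Sigma$ be a finite alphabet and $\Omega=\{\ell_1,\dots,\ell_{|\Omega|}\}$ a finite set of labels. A labelled quantitative control improvisation (LQCI) instance consists of length bounds $m\le n$ in $\mathbb N$, a hard specification (a language $\mathcal H\subseteq\Sigma^*$), a cost function $\mathcal K:\Sigma^*\to\mathbb Q$, a label function $L:\Sigma^*\to\Omega$, and rationals $c\ge 0$, $0\le\lambda\le\rho\le1$ and $0\le\hat\alpha_i\le\hat\beta_i\le1$ for each label $\ell_i$. Put $I=\{w\in\mathcal H : m\le|w|\le n\}$ and $I_i=\{w\in I : L(w)=\ell_i\}$. A probability distribution $D$ on $\Sigma^*$ is improvising if (1) $\Pr_{w\leftarrow D}[w\in I]=1$; (2) $E_{w\leftarrow D}[\mathcal K(w)]\le c$; (3) $\lambda\le\Pr_{w\leftarrow D}[w\in I_i]\le\rho$ for all $i$; (4) $\hat\alpha_i\le\Pr_{w\leftarrow D}[w=y\mid w\in I_i]\le\hat\beta_i$ for all $i$ with $\Pr_{w\leftarrow D}[w\in I_i]>0$ and all $y\in I_i$. The instance is feasible if an improvising distribution exists. An improviser for it is a probabilistic algorithm (using fair coin flips) without input, with finite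 expected running time, whose output distribution is improvising. Consider the class of LQCI instances in which $\mathcal H$ is the language of a deterministic finite automaton (DFA); $L(w)$ is the label attached to the state in which a given complete DFA ends on $w$; and $\mathcal K$ is given by a weighted DFA, that is, by a complete DFA with an integer cost attached to each state, $\mathcal K(w)$ being the sum, with multiplicity, of the costs of all states on the run on $w$ (the start state and the last state included). The alphabet, the label set and the three automata are part of the instance; instances are written with the automata as explicit tables, the length bounds $m,n$ in unary and all other numbers in binary. This class has a pseudopolynomial improvisation scheme: there are a (probabilistic) algorithm $S$ and polynomials $p,q$ such that for every instance $\mathcal C$ of the class, with $N$ the length of its encoding plus the largest absolute value $M$ of a state cost of its weighted DFA, $S$ on input $\mathcal C$ always halts within $p(N)$ steps and - if $\mathcal C$ is feasible, $S$ outputs (the text of) an improviser for $\mathcal C$ whose expected running time is at most $q(N)$; - if $\mathcal C$ is infeasible, $S$ reports that it is infeasible. Running times are counted in a standard machine model, polynomially equivalent to probabilistic Turing machines. -/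

import Mathlib

open scoped ENNReal

namespace LQCI

/-! ## A probabilistic programming language with a step count

Data are binary trees with integer leaves; integers are held in binary. Programs are finite
syntactic objects, built from primitive operations, fair coin flips, pairing, composition,
branching and while-loops. Every primitive operation is charged the size (number of tree nodes
and of bits) of its argument and of its result, so running times agree up to a polynomial with
those of (probabilistic) Turing machines. -/

/-- Data values: binary trees with integers at the leaves. -/
inductive Val : Type
  | num : ℤ → Val
  | pair : Val → Val → Val

namespace Val

/-- The size of a value: its number of nodes plus the number of binary digits in it. -/
def size : Val → ℕ
  | num z => 1 + Nat.size z.natAbs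
  | pair a b => 1 + a.size + b.size

/-- Lists as values: nested pairs that end in `num 0`. -/
def list : List Val → Val
  | [] => num 0
  | a :: l => pair a (list l)

/-- A natural number in binary. -/
def nat (n : ℕ) : Val := num (n : ℤ)

/-- A natural number in unary: a list of `n` zeros. -/
def unary (n : ℕ) : Val := list (List.replicate n (num 0))

/-- A rational number: numerator and denominator in binary. -/
def rat (r : ℚ) : Val := pair (num r.num) (nat r.den)

/-- A family indexed by `Fin n`, written as a list. -/
def family {n : ℕ} (f : Fin n → Val) : Val := list (List.ofFn f)

/-- A word over the alphabet `Fin a`: the list of its letters. -/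
def word {a : ℕ} (w : List (Fin a)) : Val := list (w.map fun x => nat x)

end Val

/-- The primitive operations. -/
inductive Op : Type
  | skip | first | second | isNum | add | sub | mul | div | le

/-- The effect of a primitive operation. Arithmetic acts on a pair of integers; an operation whose
argument has the wrong shape returns `num 0`. Truth values are the numbers `1` and `0`. -/
def Op.eval : Op → Val → Val
  | .skip, x => x
  | .first, .pair a _ => a
  | .second, .pair _ b => b
  | .isNum, .num _ => .num 1
  | .add, .pair (.num a) (.num b) => .num (a + b)
  | .sub, .pair (.num a) (.num b) => .num (a - b)
  | .mul, .pair (.num a) (.num b) => .num (a * b)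
  | .div, .pair (.num a) (.num b) => .num (a / b)
  | .le, .pair (.num a) (.num b) => .num (if a ≤ b then 1 else 0)
  | _, _ => .num 0

/-- Programs; each one maps a value to a value, and may flip coins. -/
inductive Prog : Type
  /-- apply a primitive operation -/
  | op : Op → Prog
  /-- return a fixed value -/
  | const : Val → Prog
  /-- flip a fair coin -/
  | flip : Prog
  /-- run both programs on the input and return the pair of the results -/
  | both : Prog → Prog → Prog
  /-- run the first program, then the second one on its result -/
  | comp : Prog → Prog → Prog
  /-- run the first program as a test, then on the same input the second program if the test
  returned something else than `num 0`, the third otherwise -/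
  | ite : Prog → Prog → Prog → Prog
  /-- as long as the first program returns something else than `num 0` on the current value,
  replace that value by the result of the second program on it -/
  | loop : Prog → Prog → Prog

/-- `Eval p x r y t`: started on the input `x`, the program `p` halts with the result `y` after
`t` steps, having flipped exactly `r.length` coins, whose successive outcomes were `r`. -/
inductive Eval : Prog → Val → List Bool → Val → ℕ → Prop
  | op (o : Op) (x : Val) :
      Eval (.op o) x [] (o.eval x) (1 + x.size + (o.eval x).size)
  | const (v x : Val) :
      Eval (.const v) x [] v (1 + x.size + v.size)
  | flip (b : Bool) (x : Val) :
      Eval .flip x [b] (.num (if b then 1 else 0)) (3 + x.size)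
  | both {f g : Prog} {x a b : Val} {r r' : List Bool} {s t : ℕ} :
      Eval f x r a s → Eval g x r' b t →
      Eval (.both f g) x (r ++ r') (.pair a b) (1 + s + t)
  | comp {f g : Prog} {x y z : Val} {r r' : List Bool} {s t : ℕ} :
      Eval f x r y s → Eval g y r' z t →
      Eval (.comp f g) x (r ++ r') z (1 + s + t)
  | iteTrue {c f g : Prog} {x v y : Val} {r r' : List Bool} {s t : ℕ} :
      Eval c x r v s → v ≠ .num 0 → Eval f x r' y t →
      Eval (.ite c f g) x (r ++ r') y (1 + s + t)
  | iteFalse {c f g : Prog} {x y : Val} {r r' : List Bool} {s t : ℕ} :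
      Eval c x r (.num 0) s → Eval g x r' y t →
      Eval (.ite c f g) x (r ++ r') y (1 + s + t)
  | loopDone {c f : Prog} {x : Val} {r : List Bool} {s : ℕ} :
      Eval c x r (.num 0) s →
      Eval (.loop c f) x r x (1 + s)
  | loopStep {c f : Prog} {x v y z : Val} {r r' r'' : List Bool} {s t u : ℕ} :
      Eval c x r v s → v ≠ .num 0 → Eval f x r' y t → Eval (.loop c f) y r'' z u →
      Eval (.loop c f) x (r ++ r' ++ r'') z (1 + s + t + u)

/-- Operation symbols as numbers. -/
def Op.code : Op → ℕ
  | .skip => 0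
  | .first => 1
  | .second => 2
  | .isNum => 3
  | .add => 4
  | .sub => 5
  | .mul => 6
  | .div => 7
  | .le => 8

/-- The text of a program, as a value; it lets one program output another one. -/
def Prog.encode : Prog → Val
  | .op o => .pair (.num 0) (.nat o.code)
  | .const v => .pair (.num 1) v
  | .flip => .pair (.num 2) (.num 0)
  | .both f g => .pair (.num 3) (.pair f.encode g.encode)
  | .comp f g => .pair (.num 4) (.pair f.encode g.encode)
  | .ite c f g => .pair (.num 5) (.pair c.encode (.pair f.encode g.encode))
  | .loop c f => .pair (.num 6) (.pair c.encode f.encode)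

open Classical in
/-- The probability that `p` halts on input `x` with the result `y`: each halting run that flips
`k` coins has probability `2⁻ᵏ`. -/
noncomputable def Prog.outProb (p : Prog) (x y : Val) : ℝ≥0∞ :=
  ∑' r : List Bool, ∑' t : ℕ, if Eval p x r y t then (2⁻¹ : ℝ≥0∞) ^ r.length else 0

/-- The probability that `p` halts on input `x`. -/
noncomputable def Prog.haltProb (p : Prog) (x : Val) : ℝ≥0∞ := ∑' y : Val, p.outProb x y

open Classical in
/-- The expected running time of `p` on input `x`; it is infinite if `p` runs forever with
positive probability. -/
noncomputable def Prog.expTime (p : Prog) (x : Val) : ℝ≥0∞ :=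
  if p.haltProb x = 1 then
    ∑' r : List Bool, ∑' y : Val, ∑' t : ℕ,
      if Eval p x r y t then (2⁻¹ : ℝ≥0∞) ^ r.length * (t : ℝ≥0∞) else 0
  else ⊤

/-! ## Labelled quantitative control improvisation -/

/-- The numerical parameters of an instance with label set `Ω`. -/
structure Params (Ω : Type) where
  /-- lower bound on word length -/
  m : ℕ
  /-- upper bound on word length -/
  n : ℕ
  /-- upper bound on expected cost -/
  c : ℚ
  /-- lower bound on label probabilities -/
  lam : ℚ
  /-- upper bound on label probabilities -/
  rho : ℚ
  /-- lower bounds on conditional word probabilities -/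
  alpha : Ω → ℚ
  /-- upper bounds on conditional word probabilities -/
  beta : Ω → ℚ
  m_le_n : m ≤ n
  c_nonneg : 0 ≤ c
  lam_nonneg : 0 ≤ lam
  lam_le_rho : lam ≤ rho
  rho_le_one : rho ≤ 1
  alpha_nonneg : ∀ i, 0 ≤ alpha i
  alpha_le_beta : ∀ i, alpha i ≤ beta i
  beta_le_one : ∀ i, beta i ≤ 1

/-- An LQCI instance over the alphabet `σ` with label set `Ω`. -/
structure Instance (σ Ω : Type) extends Params Ω where
  /-- hard specification -/
  H : Language σ
  /-- cost function -/
  K : List σ → ℚ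
  /-- label function -/
  L : List σ → Ω

/-- The probability of a set of words. -/
noncomputable def prob {σ : Type} (D : PMF (List σ)) (A : Set (List σ)) : ℝ :=
  (D.toOuterMeasure A).toReal

namespace Instance

variable {σ Ω : Type}

/-- The set of improvisations. -/
def impr (C : Instance σ Ω) : Set (List σ) :=
  {w | C.m ≤ w.length ∧ w.length ≤ C.n ∧ w ∈ C.H}

/-- The label class of `i`. -/
def labelClass (C : Instance σ Ω) (i : Ω) : Set (List σ) := {w | w ∈ C.impr ∧ C.L w = i}

/-- Improvising distributions. The series for the expected cost is a finite sum in the presence of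
the hard constraint, as there are only finitely many improvisations over a finite alphabet. The
condition on conditional probabilities is imposed on label classes of positive probability. -/
structure IsImprovising (C : Instance σ Ω) (D : PMF (List σ)) : Prop where
  hard : prob D C.impr = 1
  cost : ∑' w, (D w).toReal * (C.K w : ℝ) ≤ (C.c : ℝ)
  labels : ∀ i, (C.lam : ℝ) ≤ prob D (C.labelClass i) ∧ prob D (C.labelClass i) ≤ (C.rho : ℝ)
  words : ∀ i, 0 < prob D (C.labelClass i) → ∀ y ∈ C.labelClass i,
    (C.alpha i : ℝ) ≤ prob D {y} / prob D (C.labelClass i) ∧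
      prob D {y} / prob D (C.labelClass i) ≤ (C.beta i : ℝ)

/-- Feasibility: there is an improvising distribution. -/
def Feasible (C : Instance σ Ω) : Prop := ∃ D, C.IsImprovising D

/-- Improvisers: programs without input (they are started on a dummy value) whose expected running
time is finite and whose output distribution, on words over `Fin a`, is improvising. -/
def IsImproviser {a : ℕ} (C : Instance (Fin a) Ω) (G : Prog) : Prop :=
  G.expTime (.num 0) < ⊤ ∧
    ∃ D, C.IsImprovising D ∧ ∀ w, G.outProb (.num 0) (.word w) = D w

end Instance

/-! ## Instances given by automata -/

/-- A finite automaton over the alphabet `Fin a` with an output attached to every state. -/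
structure OutDFA (a : ℕ) (β : Type) where
  /-- number of states -/
  states : ℕ
  /-- transition function -/
  step : Fin states → Fin a → Fin states
  /-- start state -/
  start : Fin states
  /-- output of a state -/
  out : Fin states → β

namespace OutDFA

variable {a : ℕ} {β : Type}

/-- The output of the state in which the run on `w` ends. -/
def final (A : OutDFA a β) (w : List (Fin a)) : β := A.out (w.foldl A.step A.start)

/-- The sum of the outputs of all states on the run on `w`, from the start state to the last one,
with multiplicity. -/
def acc (A : OutDFA a ℤ) (w : List (Fin a)) : ℤ := ((w.scanl A.step A.start).map A.out).sum

/-- The text of an automaton: the start state, and for each state its output together with the list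
of its successors. -/
def encode (A : OutDFA a β) (e : β → Val) : Val :=
  .pair (.nat A.start) (.family fun q => .pair (e (A.out q)) (.family fun x => .nat (A.step q x)))

end OutDFA

/-- An LQCI instance whose hard specification is a DFA, whose label function is given by the final
states of an automaton, and whose cost function is given by accumulating integer state costs. -/
structure AccInstance where
  /-- number of letters; the alphabet is `Fin letters` -/
  letters : ℕ
  /-- number of labels; the label set is `Fin labels` -/
  labels : ℕ
  /-- number of states of the DFA for the hard specification -/
  hardStates : ℕ
  /-- DFA for the hard specification -/
  hard : DFA (Fin letters) (Fin hardStates)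
  /-- automaton for the label function -/
  label : OutDFA letters (Fin labels)
  /-- weighted automaton for the cost function -/
  cost : OutDFA letters ℤ
  /-- numerical parameters -/
  params : Params (Fin labels)

namespace AccInstance

/-- The LQCI instance that the automata describe. -/
def toInstance (C : AccInstance) : Instance (Fin C.letters) (Fin C.labels) where
  toParams := C.params
  H := C.hard.accepts
  K := fun w => (C.cost.acc w : ℚ)
  L := C.label.final

open Classical in
/-- The text of an instance: length bounds in unary, all other numbers in binary. -/
noncomputable def encode (C : AccInstance) : Val :=
  .list
    [ .nat C.letters,
      .nat C.labels,
      .unary C.params.m,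
      .unary C.params.n,
      .rat C.params.c,
      .rat C.params.lam,
      .rat C.params.rho,
      .family fun i => .rat (C.params.alpha i),
      .family fun i => .rat (C.params.beta i),
      .pair (.nat C.hard.start) (.family fun q =>
        .pair (.num (if q ∈ C.hard.accept then 1 else 0))
          (.family fun x => .nat (C.hard.step q x))),
      C.label.encode fun i => .nat i,
      C.cost.encode .num ]

/-- The largest absolute value of a state cost. -/
def maxCost (C : AccInstance) : ℕ := Finset.univ.sup fun q => (C.cost.out q).natAbs

/-- The pseudopolynomial size of an instance: the length of its text, plus the largest absolute
value of a state cost. -/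
noncomputable def pseudoSize (C : AccInstance) : ℕ := C.encode.size + C.maxCost

end AccInstance

end LQCI

/-!
The proof consists of a decision procedure for feasibility in terms of greedy distributions, an
exact sampler for the optimal distribution, and a calculus that shows both to be programs with
polynomial step counts.

*Feasibility.* All bounds on probabilities are multiples of `1 / den` for a common denominator
`den`. The cost of an improvisation lies in a pseudopolynomially large range, so dynamic programming
over the product of the three automata (`AccInstance.cnt`) counts the improvisations with a given
label and a given cost. Call a label good if some distribution on its class meets the bounds
`α ≤ p ≤ β`, that is, if `α · size ≤ 1 ≤ β · size`. The cheapest such distribution is greedy: every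
word gets `α`, and the rest goes to the cheapest words, at most `β - α` to each
(`greedy_optimal`). Its expected cost depends on the words through the counts only. The good labels
in turn are ordered by these costs, and the cheapest distribution on them is greedy again. Labels
that are not good must have probability zero, which is possible only if `λ = 0`. Thus the instance
is feasible if and only if these greedy distributions exist and have expected cost at most `c`
(`AccInstance.Criterion`, `AccInstance.feasible_iff`).

*Sampling.* All probabilities of the greedy distributions are multiples of `1 / den`. A uniformly
random number `r < den ^ 2` therefore yields a sample: the quotient `r / den` selects the label, the
remainder selects the index of a word in the class of that label, ordered by cost, and the word with
a given index is found letter by letter from the counts (`AccInstance.drawVal`,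
`AccInstance.drawVal_eq`). Uniform random numbers come from coin flips by rejection, with acceptance
probability more than one half in each round (`exists_uniform`). The improviser for an instance
first writes down the text of the instance, and then runs a sampler that does not depend on it.

*Running times.* `PolyTime N e f` says that one program computes `f x` from the environment `e x`
within a number of steps that is polynomial in `N x`; it is closed under the constructions used in
the definition of the criterion and of `AccInstance.drawVal`. For the random part, output
distributions (`Prog.mean`) and expected step counts (`Prog.time`) follow the structure of programs.
Loops need two facts: a program halts with probability at most one (`runSum_one_le_one`), so that
the fixed point equation of a rejection loop can be solved; and a potential that pays for every
round bounds the expected step count (`time_loop_le`).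
-/

namespace LQCI

/-! ### Runs of programs and weighted sums over them -/

/-- A halting run is recorded as its coin string, its result, and its step count. -/
abbrev Run : Type := List Bool × Val × ℕ

/-- The halting runs of `p` on the input `x`. -/
def runs (p : Prog) (x : Val) : Set Run := {z | Eval p x z.1 z.2.1 z.2.2}

theorem mem_runs {p : Prog} {x y : Val} {r : List Bool} {t : ℕ} :
    (r, y, t) ∈ runs p x ↔ Eval p x r y t := Iff.rfl

/-- No two different runs in the set have coin strings that are prefixes of a common string. -/
def Determinate (A : Set Run) : Prop :=
  ∀ a ∈ A, ∀ b ∈ A, ∀ s s' : List Bool, a.1 ++ s = b.1 ++ s' → a = b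

/-- The sum of `F` over a set of runs, a run with `k` coins having the weight `2⁻ᵏ`. -/
noncomputable def wsum (A : Set Run) (F : Val → ℕ → ℝ≥0∞) : ℝ≥0∞ :=
  ∑' z : A, (2⁻¹ : ℝ≥0∞) ^ z.1.1.length * F z.1.2.1 z.1.2.2

/-- Sequential composition: a run of `A` followed by a run of `B` on its result, with `k` further
steps. -/
def seq (k : ℕ) (A : Set Run) (B : Val → Set Run) : Set Run :=
  {z | ∃ a ∈ A, ∃ b ∈ B a.2.1, z = (a.1 ++ b.1, b.2.1, k + a.2.2 + b.2.2)}

/-- Summation over a sequential composition is iterated; determinacy of the first stage makes the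
decomposition of a composed run unique. -/
theorem wsum_seq {k : ℕ} {A : Set Run} {B : Val → Set Run} (hA : Determinate A)
    (F : Val → ℕ → ℝ≥0∞) :
    wsum (seq k A B) F = wsum A fun y s => wsum (B y) fun z t => F z (k + s + t) := by
  let φ : (Σ a : A, B a.1.2.1) → seq k A B := fun c =>
    ⟨(c.1.1.1 ++ c.2.1.1, c.2.1.2.1, k + c.1.1.2.2 + c.2.1.2.2),
      c.1.1, c.1.2, c.2.1, c.2.2, rfl⟩
  have hφ : Function.Bijective φ := by
    constructor
    · rintro ⟨⟨a, ha⟩, ⟨b, hb⟩⟩ ⟨⟨a', ha'⟩, ⟨b', hb'⟩⟩ h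
      obtain ⟨h1, h'⟩ := Prod.ext_iff.1 (Subtype.ext_iff.1 h)
      obtain ⟨h2, h3⟩ := Prod.ext_iff.1 h'
      obtain rfl : a = a' := hA a ha a' ha' _ _ h1
      replace h2 : b.2.1 = b'.2.1 := h2
      replace h3 : k + a.2.2 + b.2.2 = k + a.2.2 + b'.2.2 := h3
      have : b = b' := Prod.ext (List.append_cancel_left h1) (Prod.ext h2 (Nat.add_left_cancel h3))
      subst this
      rfl
    · rintro ⟨z, a, ha, b, hb, rfl⟩
      exact ⟨⟨⟨a, ha⟩, ⟨b, hb⟩⟩, rfl⟩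
  unfold wsum
  rw [← (Equiv.ofBijective φ hφ).tsum_eq, ENNReal.tsum_sigma']
  refine tsum_congr fun a => ?_
  rw [← ENNReal.tsum_mul_left]
  refine tsum_congr fun b => ?_
  simp only [Equiv.ofBijective_apply, φ, List.length_append, pow_add]
  ring

theorem wsum_mono {A : Set Run} {F G : Val → ℕ → ℝ≥0∞}
    (h : ∀ z ∈ A, F z.2.1 z.2.2 ≤ G z.2.1 z.2.2) : wsum A F ≤ wsum A G :=
  ENNReal.tsum_le_tsum fun z => by gcongr; exact h z.1 z.2

theorem wsum_congr {A : Set Run} {F G : Val → ℕ → ℝ≥0∞}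
    (h : ∀ z ∈ A, F z.2.1 z.2.2 = G z.2.1 z.2.2) : wsum A F = wsum A G :=
  tsum_congr fun z => by rw [h z.1 z.2]

theorem wsum_add (A : Set Run) (F G : Val → ℕ → ℝ≥0∞) :
    (wsum A fun y t => F y t + G y t) = wsum A F + wsum A G := by
  unfold wsum
  rw [← ENNReal.tsum_add]
  exact tsum_congr fun z => mul_add _ _ _

theorem wsum_mul_left (A : Set Run) (c : ℝ≥0∞) (F : Val → ℕ → ℝ≥0∞) :
    (wsum A fun y t => c * F y t) = c * wsum A F := by
  unfold wsum
  rw [← ENNReal.tsum_mul_left]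
  exact tsum_congr fun z => by ring

theorem wsum_singleton (r : List Bool) (y : Val) (t : ℕ) (F : Val → ℕ → ℝ≥0∞) :
    wsum {(r, y, t)} F = 2⁻¹ ^ r.length * F y t := by
  unfold wsum
  rw [tsum_singleton ((r, y, t) : Run) fun z => (2⁻¹ : ℝ≥0∞) ^ z.1.length * F z.2.1 z.2.2]

/-- The successive coin flips determine the run. -/
theorem Eval.unique {p : Prog} {x y : Val} {r : List Bool} {t : ℕ} (h : Eval p x r y t) :
    ∀ {r' : List Bool} {y' : Val} {t' : ℕ} {s s' : List Bool}, Eval p x r' y' t' →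
      r ++ s = r' ++ s' → r = r' ∧ y = y' ∧ t = t' := by
  induction h with
  | op o x => intro r' y' t' s s' h' e; cases h'; exact ⟨rfl, rfl, rfl⟩
  | const v x => intro r' y' t' s s' h' e; cases h'; exact ⟨rfl, rfl, rfl⟩
  | flip b x =>
    intro r' y' t' s s' h' e
    cases h' with
    | flip b' =>
      simp only [List.cons_append, List.nil_append, List.cons.injEq] at e
      obtain ⟨rfl, -⟩ := e
      exact ⟨rfl, rfl, rfl⟩
  | both _ _ ih1 ih2 =>
    intro r' y' t' s s' h' e
    cases h' with
    | both h1 h2 =>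
      rw [List.append_assoc, List.append_assoc] at e
      obtain ⟨rfl, rfl, rfl⟩ := ih1 h1 e
      obtain ⟨rfl, rfl, rfl⟩ := ih2 h2 (List.append_cancel_left e)
      exact ⟨rfl, rfl, rfl⟩
  | comp _ _ ih1 ih2 =>
    intro r' y' t' s s' h' e
    cases h' with
    | comp h1 h2 =>
      rw [List.append_assoc, List.append_assoc] at e
      obtain ⟨rfl, rfl, rfl⟩ := ih1 h1 e
      obtain ⟨rfl, rfl, rfl⟩ := ih2 h2 (List.append_cancel_left e)
      exact ⟨rfl, rfl, rfl⟩
  | iteTrue _ hv _ ih1 ih2 =>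
    intro r' y' t' s s' h' e
    cases h' with
    | iteTrue h1 hv' h2 =>
      rw [List.append_assoc, List.append_assoc] at e
      obtain ⟨rfl, rfl, rfl⟩ := ih1 h1 e
      obtain ⟨rfl, rfl, rfl⟩ := ih2 h2 (List.append_cancel_left e)
      exact ⟨rfl, rfl, rfl⟩
    | iteFalse h1 h2 =>
      rw [List.append_assoc, List.append_assoc] at e
      exact absurd (ih1 h1 e).2.1 hv
  | iteFalse _ _ ih1 ih2 =>
    intro r' y' t' s s' h' e
    cases h' with
    | iteTrue h1 hv' h2 =>
      rw [List.append_assoc, List.append_assoc] at e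
      exact absurd (ih1 h1 e).2.1.symm hv'
    | iteFalse h1 h2 =>
      rw [List.append_assoc, List.append_assoc] at e
      obtain ⟨rfl, -, rfl⟩ := ih1 h1 e
      obtain ⟨rfl, rfl, rfl⟩ := ih2 h2 (List.append_cancel_left e)
      exact ⟨rfl, rfl, rfl⟩
  | loopDone _ ih =>
    intro r' y' t' s s' h' e
    cases h' with
    | loopDone h1 =>
      obtain ⟨rfl, -, rfl⟩ := ih h1 e
      exact ⟨rfl, rfl, rfl⟩
    | loopStep h1 hv' h2 h3 =>
      rw [List.append_assoc, List.append_assoc] at e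
      exact absurd (ih h1 e).2.1.symm hv'
  | loopStep _ hv _ _ ih1 ih2 ih3 =>
    intro r' y' t' s s' h' e
    cases h' with
    | loopDone h1 =>
      rw [List.append_assoc, List.append_assoc] at e
      exact absurd (ih1 h1 e).2.1 hv
    | loopStep h1 hv' h2 h3 =>
      simp only [List.append_assoc] at e
      obtain ⟨rfl, rfl, rfl⟩ := ih1 h1 e
      have e := List.append_cancel_left e
      obtain ⟨rfl, rfl, rfl⟩ := ih2 h2 e
      obtain ⟨rfl, rfl, rfl⟩ := ih3 h3 (List.append_cancel_left e)
      exact ⟨rfl, rfl, rfl⟩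

theorem determinate_runs (p : Prog) (x : Val) : Determinate (runs p x) := by
  rintro ⟨r, y, t⟩ ha ⟨r', y', t'⟩ hb s s' e
  obtain ⟨rfl, rfl, rfl⟩ := Eval.unique (show Eval p x r y t from ha) hb e
  rfl

theorem runs_of_det {p : Prog} {x y : Val} {t : ℕ} (h : Eval p x [] y t) :
    runs p x = {([], y, t)} := by
  ext ⟨r, y', t'⟩
  constructor
  · intro h'
    obtain ⟨rfl, rfl, rfl⟩ := h.unique (s := r) (s' := []) h' (by simp)
    rfl
  · intro h'
    rw [Set.mem_singleton_iff] at h'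
    cases h'
    exact h

theorem runs_comp (f g : Prog) (x : Val) : runs (.comp f g) x = seq 1 (runs f x) (runs g) := by
  ext ⟨r, y, t⟩
  constructor
  · intro h
    rw [mem_runs] at h
    cases h with
    | comp h1 h2 => exact ⟨(_, _, _), h1, (_, _, _), h2, rfl⟩
  · rintro ⟨⟨r1, y1, t1⟩, h1, ⟨r2, y2, t2⟩, h2, h⟩
    cases h
    exact .comp h1 h2

theorem runs_both (f g : Prog) (x : Val) : runs (.both f g) x =
    seq 1 (runs f x) fun a => seq 0 (runs g x) fun b => {([], .pair a b, 0)} := by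
  ext ⟨r, y, t⟩
  constructor
  · intro h
    rw [mem_runs] at h
    cases h with
    | both h1 h2 =>
      exact ⟨(_, _, _), h1, (_, _, _), ⟨(_, _, _), h2, _, rfl, rfl⟩, by simp⟩
  · rintro ⟨⟨r1, y1, t1⟩, h1, _, ⟨⟨r2, y2, t2⟩, h2, _, rfl, rfl⟩, h⟩
    simp only [List.append_nil, zero_add, add_zero] at h
    cases h
    exact .both h1 h2

open Classical in
theorem runs_loop (c f : Prog) (x : Val) : runs (.loop c f) x =
    seq 1 (runs c x) fun v =>
      if v = .num 0 then {([], x, 0)} else seq 0 (runs f x) (runs (.loop c f)) := by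
  ext ⟨r, y, t⟩
  constructor
  · intro h
    rw [mem_runs] at h
    cases h with
    | loopDone h1 => exact ⟨(_, .num 0, _), h1, ([], x, 0), by simp, by simp⟩
    | loopStep h1 hv h2 h3 =>
      exact ⟨(_, _, _), h1, (_, _, _),
        by simp only [hv, if_false]; exact ⟨(_, _, _), h2, (_, _, _), h3, rfl⟩,
        by simp [Nat.add_assoc]⟩
  · rintro ⟨⟨r1, v, t1⟩, h1, b, hb, h⟩
    by_cases hv : v = .num 0
    · simp only [hv, if_true, Set.mem_singleton_iff] at hb
      subst hb hv
      simp only [List.append_nil, add_zero] at h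
      cases h
      exact .loopDone h1
    · simp only [hv, if_false] at hb
      obtain ⟨⟨r2, y2, t2⟩, h2, ⟨r3, y3, t3⟩, h3, rfl⟩ := hb
      have := Eval.loopStep h1 hv h2 h3
      simp only [zero_add, ← List.append_assoc] at h
      cases h
      rw [show 1 + t1 + (t2 + t3) = 1 + t1 + t2 + t3 by omega]
      exact this

open Classical in
theorem runs_ite (c f g : Prog) (x : Val) : runs (.ite c f g) x =
    seq 1 (runs c x) fun v => if v = .num 0 then runs g x else runs f x := by
  ext ⟨r, y, t⟩
  constructor
  · intro h
    rw [mem_runs] at h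
    cases h with
    | iteTrue h1 hv h2 =>
      exact ⟨(_, _, _), h1, (_, _, _), by simp only [hv, if_false]; exact h2, rfl⟩
    | iteFalse h1 h2 => exact ⟨(_, _, _), h1, (_, _, _), by simp only [if_true]; exact h2, rfl⟩
  · rintro ⟨⟨r1, v, t1⟩, h1, ⟨r2, y2, t2⟩, hb, h⟩
    cases h
    by_cases hv : v = .num 0
    · simp only [hv, if_true] at hb
      subst hv
      exact .iteFalse h1 hb
    · simp only [hv, if_false] at hb
      exact .iteTrue h1 hv hb

theorem runs_flip (x : Val) :
    runs .flip x = {([true], .num 1, 3 + x.size), ([false], .num 0, 3 + x.size)} := by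
  ext ⟨r, y, t⟩
  constructor
  · intro h
    rw [mem_runs] at h
    cases h with
    | flip b => cases b <;> simp
  · rintro (h | h) <;> cases h
    · exact Eval.flip true x
    · exact Eval.flip false x

theorem wsum_flip (x : Val) (F : Val → ℕ → ℝ≥0∞) : wsum (runs .flip x) F =
    2⁻¹ * F (.num 1) (3 + x.size) + 2⁻¹ * F (.num 0) (3 + x.size) := by
  rw [runs_flip]
  unfold wsum
  rw [Set.insert_eq,
    ENNReal.summable.tsum_union_disjoint (f := fun z : Run =>
      (2⁻¹ : ℝ≥0∞) ^ z.1.length * F z.2.1 z.2.2) (by simp) ENNReal.summable,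
    tsum_singleton (([true], .num 1, 3 + x.size) : Run)
      fun z => (2⁻¹ : ℝ≥0∞) ^ z.1.length * F z.2.1 z.2.2,
    tsum_singleton (([false], .num 0, 3 + x.size) : Run)
      fun z => (2⁻¹ : ℝ≥0∞) ^ z.1.length * F z.2.1 z.2.2]
  simp

/-- The weighted sum over all halting runs of a program. -/
noncomputable def runSum (p : Prog) (x : Val) (F : Val → ℕ → ℝ≥0∞) : ℝ≥0∞ := wsum (runs p x) F

theorem runSum_det {p : Prog} {x y : Val} {t : ℕ} (h : Eval p x [] y t) (F : Val → ℕ → ℝ≥0∞) :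
    runSum p x F = F y t := by
  rw [runSum, runs_of_det h, wsum_singleton]; simp

theorem runSum_comp (f g : Prog) (x : Val) (F : Val → ℕ → ℝ≥0∞) :
    runSum (.comp f g) x F =
      runSum f x fun y s => runSum g y fun z t => F z (1 + s + t) := by
  rw [runSum, runs_comp, wsum_seq (determinate_runs _ _)]; rfl

theorem runSum_both (f g : Prog) (x : Val) (F : Val → ℕ → ℝ≥0∞) :
    runSum (.both f g) x F =
      runSum f x fun a s => runSum g x fun b t => F (.pair a b) (1 + s + t) := by
  rw [runSum, runs_both, wsum_seq (determinate_runs _ _)]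
  refine wsum_congr fun z _ => ?_
  rw [wsum_seq (determinate_runs _ _)]
  refine wsum_congr fun z _ => ?_
  rw [wsum_singleton]; simp

open Classical in
theorem runSum_loop (c f : Prog) (x : Val) (F : Val → ℕ → ℝ≥0∞) :
    runSum (.loop c f) x F = runSum c x fun v s => if v = .num 0 then F x (1 + s) else
      runSum f x fun y t => runSum (.loop c f) y fun z u => F z (1 + s + t + u) := by
  rw [runSum, runs_loop, wsum_seq (determinate_runs _ _)]
  refine wsum_congr fun z _ => ?_
  by_cases hv : z.2.1 = .num 0
  · simp only [hv, if_true]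
    rw [wsum_singleton]; simp
  · simp only [hv, if_false]
    rw [wsum_seq (determinate_runs _ _)]
    simp only [zero_add]
    refine wsum_congr fun z' _ => wsum_congr fun z'' _ => ?_
    congr 1
    omega

open Classical in
theorem runSum_ite (c f g : Prog) (x : Val) (F : Val → ℕ → ℝ≥0∞) :
    runSum (.ite c f g) x F = runSum c x fun v s => if v = .num 0 then
      runSum g x fun y t => F y (1 + s + t) else runSum f x fun y t => F y (1 + s + t) := by
  rw [runSum, runs_ite, wsum_seq (determinate_runs _ _)]
  refine wsum_congr fun z _ => ?_
  by_cases hv : z.2.1 = .num 0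
  · simp only [hv, if_true]; rfl
  · simp only [hv, if_false]; rfl

open Classical in
/-- Runs of bounded length have total weight at most one. The bound makes the induction through
loops well-founded. -/
theorem runSum_trunc_le_one (n : ℕ) : ∀ (p : Prog) (x : Val),
    (runSum p x fun _ t => if t ≤ n then 1 else 0) ≤ 1 := by
  induction n with
  | zero =>
    intro p x
    have h0 : (runSum p x fun _ t => if t ≤ 0 then 1 else 0) ≤ runSum p x fun _ _ => 0 := by
      refine wsum_mono fun z hz => ?_
      have : 1 ≤ z.2.2 := by
        obtain ⟨r, y, t⟩ := z
        rw [mem_runs] at hz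
        cases hz <;> dsimp only <;> omega
      rw [if_neg (by omega)]
    refine h0.trans ?_
    simp [runSum, wsum]
  | succ n ih =>
    have key : ∀ (p : Prog) (x : Val) (s k : ℕ), 1 ≤ k →
        (runSum p x fun _ t => if k + s + t ≤ n + 1 then (1 : ℝ≥0∞) else 0) ≤
          if s ≤ n then 1 else 0 := by
      intro p x s k hk
      split_ifs with hs
      · refine le_trans (wsum_mono fun z _ => ?_) (ih p x)
        split_ifs <;> first | exact le_rfl | exact zero_le | omega
      · refine le_trans (wsum_mono (G := fun _ _ => 0) fun z _ => ?_) (by simp [wsum])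
        rw [if_neg (by omega)]
    intro p x
    cases p with
    | op o => rw [runSum_det (.op o x)]; split_ifs <;> simp
    | const v => rw [runSum_det (.const v x)]; split_ifs <;> simp
    | flip =>
      rw [runSum, wsum_flip]
      split_ifs
      · simp [ENNReal.inv_two_add_inv_two]
      · simp
    | both f g =>
      rw [runSum_both]
      exact (wsum_mono fun z _ => key g x z.2.2 1 le_rfl).trans (ih f x)
    | comp f g =>
      rw [runSum_comp]
      exact (wsum_mono fun z _ => key g z.2.1 z.2.2 1 le_rfl).trans (ih f x)
    | ite c f g =>
      rw [runSum_ite]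
      refine (wsum_mono fun z _ => ?_).trans (ih c x)
      split_ifs
      · exact (key g x z.2.2 1 le_rfl).trans (by simp [*])
      · exact (key g x z.2.2 1 le_rfl).trans (by simp [*])
      · exact (key f x z.2.2 1 le_rfl).trans (by simp [*])
      · exact (key f x z.2.2 1 le_rfl).trans (by simp [*])
    | loop c f =>
      rw [runSum_loop]
      refine (wsum_mono fun z _ => ?_).trans (ih c x)
      have h2 : (runSum f x fun y t => runSum (.loop c f) y fun _ u =>
          if 1 + z.2.2 + t + u ≤ n + 1 then (1 : ℝ≥0∞) else 0) ≤ if z.2.2 ≤ n then 1 else 0 := by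
        split_ifs with hs
        · refine (wsum_mono fun w _ => ?_).trans (ih f x)
          refine le_trans ?_ (key (.loop c f) w.2.1 w.2.2 (1 + z.2.2) (by omega))
          exact wsum_mono fun _ _ => le_rfl
        · refine le_trans (wsum_mono (G := fun _ _ => 0) fun w _ => ?_) (by simp [wsum])
          refine le_trans (wsum_mono (G := fun _ _ => 0) fun w _ => ?_) (by simp [wsum])
          rw [if_neg (by omega)]
      by_cases hv : z.2.1 = .num 0
      · simp only [hv, if_true]
        split_ifs <;> first | exact le_rfl | exact zero_le | omega
      · simp only [hv, if_false]
        exact h2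

/-- Truncation at a step count `n` is exhaustive. -/
theorem runSum_le_of_trunc {p : Prog} {x : Val} {F : Val → ℕ → ℝ≥0∞} {b : ℝ≥0∞}
    (h : ∀ n, (runSum p x fun y t => if t ≤ n then F y t else 0) ≤ b) : runSum p x F ≤ b := by
  unfold runSum wsum
  rw [ENNReal.tsum_eq_iSup_sum]
  refine iSup_le fun s => ?_
  refine le_trans ?_ (h (s.sup fun z => z.1.2.2))
  unfold runSum wsum
  refine le_trans (Finset.sum_le_sum fun z hz => ?_) (ENNReal.sum_le_tsum s)
  have := Finset.le_sup (f := fun z : runs p x => z.1.2.2) hz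
  simp only [this, if_true, le_refl]

/-- Kraft's inequality: a program halts with probability at most one. -/
theorem runSum_one_le_one (p : Prog) (x : Val) : (runSum p x fun _ _ => 1) ≤ 1 := by
  classical
  exact runSum_le_of_trunc fun n => (runSum_trunc_le_one n p x)

theorem runSum_const_le (p : Prog) (x : Val) (c : ℝ≥0∞) : (runSum p x fun _ _ => c) ≤ c := by
  have := wsum_mul_left (runs p x) c fun _ _ => 1
  simp only [mul_one] at this
  rw [runSum, this]
  exact mul_le_of_le_one_right' (runSum_one_le_one p x)

theorem outProb_eq (p : Prog) (x y : Val) [DecidableEq Val] :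
    p.outProb x y = runSum p x fun z _ => if z = y then 1 else 0 := by
  classical
  unfold Prog.outProb runSum wsum
  rw [tsum_subtype (runs p x) fun z => (2⁻¹ : ℝ≥0∞) ^ z.1.length * if z.2.1 = y then 1 else 0,
    ENNReal.tsum_prod']
  refine tsum_congr fun r => ?_
  rw [ENNReal.tsum_prod', tsum_eq_single y]
  · refine tsum_congr fun t => ?_
    simp [Set.indicator, runs]
  · intro z hz
    simp [Set.indicator, hz]

theorem haltProb_eq (p : Prog) (x : Val) : p.haltProb x = runSum p x fun _ _ => 1 := by
  classical
  unfold Prog.haltProb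
  simp only [outProb_eq]
  unfold runSum wsum
  rw [ENNReal.tsum_comm]
  refine tsum_congr fun z => ?_
  rw [ENNReal.tsum_mul_left]
  simp [eq_comm, tsum_ite_eq]

theorem expTime_eq {p : Prog} {x : Val} (h : p.haltProb x = 1) :
    p.expTime x = runSum p x fun _ t => t := by
  classical
  unfold Prog.expTime runSum wsum
  rw [if_pos h, tsum_subtype (runs p x) fun z => (2⁻¹ : ℝ≥0∞) ^ z.1.length * (z.2.2 : ℝ≥0∞),
    ENNReal.tsum_prod']
  refine tsum_congr fun r => ?_
  rw [ENNReal.tsum_prod']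
  refine tsum_congr fun y => tsum_congr fun t => ?_
  simp only [Set.indicator, runs, Set.mem_ofPred_eq]
  congr

/-! ### Output distributions and expected step counts -/

/-- The expectation of a function of the result. -/
noncomputable def Prog.mean (p : Prog) (x : Val) (F : Val → ℝ≥0∞) : ℝ≥0∞ :=
  runSum p x fun y _ => F y

/-- The expectation of the step count, over the halting runs. -/
noncomputable def Prog.time (p : Prog) (x : Val) : ℝ≥0∞ := runSum p x fun _ t => t

theorem mean_comp (f g : Prog) (x : Val) (F : Val → ℝ≥0∞) :
    (Prog.comp f g).mean x F = f.mean x fun y => g.mean y F := runSum_comp ..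

theorem mean_both (f g : Prog) (x : Val) (F : Val → ℝ≥0∞) :
    (Prog.both f g).mean x F = f.mean x fun a => g.mean x fun b => F (.pair a b) := runSum_both ..

open Classical in
theorem mean_loop (c f : Prog) (x : Val) (F : Val → ℝ≥0∞) :
    (Prog.loop c f).mean x F = c.mean x fun v => if v = .num 0 then F x else
      f.mean x fun y => (Prog.loop c f).mean y F := runSum_loop ..

theorem mean_det {p : Prog} {x y : Val} {t : ℕ} (h : Eval p x [] y t) (F : Val → ℝ≥0∞) :
    p.mean x F = F y := runSum_det h _

theorem time_det {p : Prog} {x y : Val} {t : ℕ} (h : Eval p x [] y t) : p.time x = t :=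
  runSum_det h _

theorem mean_flip (x : Val) (F : Val → ℝ≥0∞) :
    Prog.flip.mean x F = 2⁻¹ * F (.num 1) + 2⁻¹ * F (.num 0) := wsum_flip x fun y _ => F y

theorem mean_mono {p : Prog} {x : Val} {F G : Val → ℝ≥0∞} (h : ∀ y, F y ≤ G y) :
    p.mean x F ≤ p.mean x G :=
  wsum_mono (F := fun y _ => F y) (G := fun y _ => G y) fun z _ => h z.2.1

theorem runSum_add_time_le (p : Prog) (x : Val) (k : ℕ) :
    (runSum p x fun _ t => ((k + t : ℕ) : ℝ≥0∞)) ≤ k + p.time x := by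
  simp only [Nat.cast_add]
  rw [runSum, wsum_add]
  exact add_le_add (runSum_const_le p x k) le_rfl

theorem time_comp_le (f g : Prog) (x : Val) :
    (Prog.comp f g).time x ≤ 1 + f.time x + f.mean x g.time := by
  rw [Prog.time, runSum_comp]
  calc _ ≤ runSum f x fun y s => ((1 + s : ℕ) : ℝ≥0∞) + g.time y :=
        wsum_mono fun z _ => runSum_add_time_le g z.2.1 (1 + z.2.2)
    _ ≤ _ := by
        rw [runSum, wsum_add]
        refine add_le_add ?_ le_rfl
        exact_mod_cast runSum_add_time_le f x 1

theorem time_both_le (f g : Prog) (x : Val) :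
    (Prog.both f g).time x ≤ 1 + f.time x + g.time x := by
  rw [Prog.time, runSum_both]
  calc _ ≤ runSum f x fun y s => ((1 + s : ℕ) : ℝ≥0∞) + g.time x :=
        wsum_mono fun z _ => runSum_add_time_le g x (1 + z.2.2)
    _ ≤ _ := by
        rw [runSum, wsum_add]
        refine add_le_add ?_ (runSum_const_le f x _)
        exact_mod_cast runSum_add_time_le f x 1

theorem time_flip (x : Val) : Prog.flip.time x = 3 + x.size := by
  rw [Prog.time, runSum, wsum_flip, ← add_mul, ENNReal.inv_two_add_inv_two]; simp

open Classical in
/-- A potential that pays for the test and for the body of a loop bounds the expected step count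
of the loop. -/
theorem time_loop_le {c f : Prog} {Φ : Val → ℝ≥0∞}
    (h : ∀ x, 1 + c.time x + (c.mean x fun v => if v = .num 0 then 0 else
      f.time x + f.mean x Φ) ≤ Φ x) (x : Val) : (Prog.loop c f).time x ≤ Φ x := by
  refine runSum_le_of_trunc fun n => ?_
  induction n using Nat.strong_induction_on generalizing x with
  | _ n ih =>
    refine le_trans ?_ (h x)
    rw [runSum_loop]
    calc _ ≤ runSum c x fun v s => ((1 + s : ℕ) : ℝ≥0∞) +
          if v = .num 0 then 0 else f.time x + f.mean x Φ := by
          refine wsum_mono fun z _ => ?_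
          by_cases hv : z.2.1 = .num 0
          · simp only [hv, if_true, add_zero]
            split_ifs <;> simp
          · simp only [hv, if_false]
            have : ∀ w : Run, (runSum (.loop c f) w.2.1 fun _ u =>
                if 1 + z.2.2 + w.2.2 + u ≤ n then ((1 + z.2.2 + w.2.2 + u : ℕ) : ℝ≥0∞) else 0) ≤
                ((1 + z.2.2 + w.2.2 : ℕ) : ℝ≥0∞) + Φ w.2.1 := by
              intro w
              rcases Nat.eq_zero_or_pos n with rfl | hn
              · refine le_trans (wsum_mono (G := fun _ _ => 0) fun w _ => ?_) (by simp [wsum])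
                rw [if_neg (by omega)]
              refine le_trans ?_ (add_le_add (runSum_const_le (.loop c f) w.2.1 _)
                (ih (n - 1) (by omega) w.2.1))
              rw [runSum, runSum, runSum, ← wsum_add]
              refine wsum_mono fun q _ => ?_
              split_ifs with h1 h2
              · push_cast; exact le_rfl
              · omega
              · exact zero_le
              · exact zero_le
            calc _ ≤ runSum f x fun y t => ((1 + z.2.2 + t : ℕ) : ℝ≥0∞) + Φ y :=
                  wsum_mono fun w _ => this w
              _ ≤ _ := by
                  rw [runSum, wsum_add, ← add_assoc]
                  exact add_le_add (runSum_add_time_le f x (1 + z.2.2)) le_rfl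
      _ ≤ _ := by
          rw [runSum, wsum_add]
          refine add_le_add ?_ le_rfl
          exact_mod_cast runSum_add_time_le c x 1

theorem mean_eq_tsum (p : Prog) (x : Val) (F : Val → ℝ≥0∞) :
    p.mean x F = ∑' y, p.outProb x y * F y := by
  classical
  simp only [outProb_eq, Prog.mean, runSum, wsum, ← ENNReal.tsum_mul_right]
  rw [ENNReal.tsum_comm]
  refine tsum_congr fun z => ?_
  rw [tsum_eq_single z.1.2.1 fun y hy => by simp [hy.symm]]
  simp

theorem mean_const_le (p : Prog) (x : Val) (c : ℝ≥0∞) : (p.mean x fun _ => c) ≤ c :=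
  runSum_const_le p x c

/-- A form of `time_loop_le` for loops that are entered in certain states only. -/
theorem time_loop_le_of_states {ι : Type} {c f : Prog} {s : ι → Val} {φ : ι → ℝ≥0∞}
    (h : ∀ Φ : Val → ℝ≥0∞, (∀ i, Φ (s i) ≤ φ i) → ∀ i, 1 + c.time (s i) + (c.mean (s i) fun v =>
      open Classical in if v = .num 0 then 0 else f.time (s i) + f.mean (s i) Φ) ≤ φ i) (i : ι) :
    (Prog.loop c f).time (s i) ≤ φ i := by
  let Φ : Val → ℝ≥0∞ := fun y => ⨅ i, ⨅ _ : s i = y, φ i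
  have hΦ : ∀ i, Φ (s i) ≤ φ i := fun i =>
    iInf₂_le (f := fun j (_ : s j = s i) => φ j) i rfl
  refine (time_loop_le (Φ := Φ) (fun x => le_iInf₂ ?_) (s i)).trans (hΦ i)
  rintro i rfl
  exact h Φ hΦ i

/-- A formula for the output distribution need only be checked on bounded functions. -/
theorem mean_eq_of_le_one {p : Prog} {x : Val} {r : ℝ≥0∞} {n : ℕ} {g : ℕ → Val}
    (h : ∀ F : Val → ℝ≥0∞, (∀ y, F y ≤ 1) →
      p.mean x F = r * ∑ v ∈ Finset.range n, F (g v)) (F : Val → ℝ≥0∞) :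
    p.mean x F = r * ∑ v ∈ Finset.range n, F (g v) := by
  classical
  have h1 : ∀ y, p.outProb x y * F y =
      r * ∑ v ∈ Finset.range n, if y = g v then F y else 0 := by
    intro y
    have := h (fun z => if z = y then 1 else 0) fun z => by split_ifs <;> simp
    rw [Prog.mean] at this
    rw [outProb_eq, this, mul_assoc, Finset.sum_mul]
    simp only [ite_mul, one_mul, zero_mul, eq_comm]
  simp only [mean_eq_tsum, h1]
  rw [ENNReal.tsum_mul_left, Summable.tsum_finsetSum fun _ _ => ENNReal.summable]
  simp only [tsum_ite_eq]

/-! ### Polynomially bounded functions -/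

theorem eval_mono_nat (P : Polynomial ℕ) {a b : ℕ} (h : a ≤ b) : P.eval a ≤ P.eval b := by
  rw [Polynomial.eval_eq_sum_range, Polynomial.eval_eq_sum_range]
  gcongr

/-- `g` is bounded by a polynomial in `N`. -/
def PolyBdd {X : Type} (N g : X → ℕ) : Prop := ∃ P : Polynomial ℕ, ∀ x, g x ≤ P.eval (N x)

/-- The complexity parameter of a context that is extended by one natural number. -/
abbrev extN {X : Type} (N : X → ℕ) : X × ℕ → ℕ := fun p => N p.1 + p.2

/-- The environment of a context that is extended by one natural number. -/
abbrev extE {X : Type} (e : X → Val) : X × ℕ → Val := fun p => .pair (e p.1) (.num p.2)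

section PolyBdd

variable {X Y : Type} {N g h : X → ℕ}

theorem PolyBdd.self (N : X → ℕ) : PolyBdd N N := ⟨.X, fun x => by simp⟩

theorem PolyBdd.const (c : ℕ) : PolyBdd N fun _ => c := ⟨.C c, fun x => by simp⟩

theorem PolyBdd.add (hg : PolyBdd N g) (hh : PolyBdd N h) : PolyBdd N fun x => g x + h x := by
  obtain ⟨P, hP⟩ := hg
  obtain ⟨Q, hQ⟩ := hh
  exact ⟨P + Q, fun x => by rw [Polynomial.eval_add]; exact add_le_add (hP x) (hQ x)⟩

theorem PolyBdd.mul (hg : PolyBdd N g) (hh : PolyBdd N h) : PolyBdd N fun x => g x * h x := by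
  obtain ⟨P, hP⟩ := hg
  obtain ⟨Q, hQ⟩ := hh
  exact ⟨P * Q, fun x => by rw [Polynomial.eval_mul]; exact Nat.mul_le_mul (hP x) (hQ x)⟩

theorem PolyBdd.mono (hg : PolyBdd N g) (hh : ∀ x, h x ≤ g x) : PolyBdd N h := by
  obtain ⟨P, hP⟩ := hg
  exact ⟨P, fun x => (hh x).trans (hP x)⟩

theorem PolyBdd.trans (hh : PolyBdd g h) (hg : PolyBdd N g) : PolyBdd N h := by
  obtain ⟨P, hP⟩ := hg
  obtain ⟨Q, hQ⟩ := hh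
  exact ⟨Q.comp P, fun x => by
    rw [Polynomial.eval_comp]; exact (hQ x).trans (eval_mono_nat Q (hP x))⟩

theorem PolyBdd.reindex (hg : PolyBdd N g) (φ : Y → X) :
    PolyBdd (fun y => N (φ y)) fun y => g (φ y) := by
  obtain ⟨P, hP⟩ := hg
  exact ⟨P, fun y => hP (φ y)⟩

theorem PolyBdd.wk (hg : PolyBdd N g) : PolyBdd (extN N) fun p => g p.1 :=
  (hg.reindex Prod.fst).trans ((PolyBdd.self _).mono fun _ => Nat.le_add_right _ _)

theorem PolyBdd.var (N : X → ℕ) : PolyBdd (extN N) fun p => p.2 :=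
  (PolyBdd.self _).mono fun _ => Nat.le_add_left _ _

/-- Substitution of a bounded value for the last variable. -/
theorem PolyBdd.subst {G : X × ℕ → ℕ} {n : X → ℕ} (hG : PolyBdd (extN N) G) (hn : PolyBdd N n) :
    PolyBdd N fun x => G (x, n x) :=
  (hG.reindex fun x => (x, n x)).trans ((PolyBdd.self N).add hn)

/-- A polynomially bounded function of two arguments has a bound that is monotone in the second
one. -/
theorem PolyBdd.exists_monotone {G : X × ℕ → ℕ} (hG : PolyBdd (extN N) G) :
    ∃ H : X × ℕ → ℕ, PolyBdd (extN N) H ∧ ∀ x i j, i ≤ j → G (x, i) ≤ H (x, j) := by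
  obtain ⟨P, hP⟩ := hG
  exact ⟨fun p => P.eval (extN N p), ⟨P, fun _ => le_rfl⟩, fun x i j hij =>
    (hP _).trans (eval_mono_nat P (Nat.add_le_add_left hij _))⟩

end PolyBdd

/-! ### Sizes -/

theorem Val.one_le_size : ∀ v : Val, 1 ≤ v.size
  | .num _ => by simp [Val.size]
  | .pair _ _ => by simp [Val.size]; omega

theorem natSize_add_le (a b : ℕ) : (a + b).size ≤ a.size + b.size + 1 := by
  rw [Nat.size_le]
  have ha := Nat.lt_size_self a
  have hb := Nat.lt_size_self b
  have h1 : 2 ^ a.size ≤ 2 ^ (a.size + b.size) := Nat.pow_le_pow_right (by norm_num) (by omega)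
  have h2 : 2 ^ b.size ≤ 2 ^ (a.size + b.size) := Nat.pow_le_pow_right (by norm_num) (by omega)
  rw [pow_succ]
  omega

theorem natSize_mul_le (a b : ℕ) : (a * b).size ≤ a.size + b.size := by
  rw [Nat.size_le, pow_add]
  exact Nat.mul_lt_mul'' (Nat.lt_size_self a) (Nat.lt_size_self b)

theorem natSize_le_self (a : ℕ) : a.size ≤ a := by
  rw [Nat.size_le]
  exact Nat.lt_two_pow_self

theorem natSize_sum_le (f : ℕ → ℕ) (n : ℕ) :
    (∑ i ∈ Finset.range n, f i).size ≤ ∑ i ∈ Finset.range n, ((f i).size + 1) := by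
  induction n with
  | zero => simp
  | succ n ih =>
    rw [Finset.sum_range_succ, Finset.sum_range_succ]
    exact (natSize_add_le _ _).trans (by omega)

theorem natSize_prod_le (f : ℕ → ℕ) (n : ℕ) :
    (∏ i ∈ Finset.range n, f i).size ≤ (∑ i ∈ Finset.range n, (f i).size) + 1 := by
  induction n with
  | zero => simp
  | succ n ih =>
    rw [Finset.prod_range_succ, Finset.sum_range_succ]
    exact (natSize_mul_le _ _).trans (by omega)

/-- Each operation adds at most two to the size, as a product has no more bits than its factors
have together. -/
theorem Op.size_eval_le (o : Op) (v : Val) : (o.eval v).size ≤ v.size + 2 := by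
  have h1 := v.one_le_size
  have h0 : (Val.num 0).size = 1 := by simp [Val.size]
  have h0' : (Val.num 1).size = 2 := by simp [Val.size]
  have key : ∀ a b c : ℤ, c.natAbs ≤ a.natAbs * b.natAbs ∨ c.natAbs ≤ a.natAbs + b.natAbs ∨
      c.natAbs ≤ a.natAbs + 1 →
      (Val.num c).size ≤ (Val.pair (.num a) (.num b)).size + 2 := by
    intro a b c h
    simp only [Val.size]
    rcases h with h | h | h
    · have := Nat.size_le_size h
      have := natSize_mul_le a.natAbs b.natAbs
      omega
    · have := Nat.size_le_size h
      have := natSize_add_le a.natAbs b.natAbs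
      omega
    · have := Nat.size_le_size h
      have := natSize_add_le a.natAbs 1
      have : Nat.size 1 = 1 := by simp
      omega
  unfold Op.eval
  split
  · omega
  · simp only [Val.size]; omega
  · simp only [Val.size]; omega
  · rw [h0']; omega
  · exact key _ _ _ (Or.inr (Or.inl (Int.natAbs_add_le _ _)))
  · exact key _ _ _ (Or.inr (Or.inl (Int.natAbs_sub_le _ _)))
  · exact key _ _ _ (Or.inl (Int.natAbs_mul _ _).le)
  · refine key _ _ _ (Or.inr (Or.inr ?_))
    rw [Int.natAbs_ediv]
    refine add_le_add (Nat.div_le_self _ _) ?_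
    split_ifs <;> simp
  · refine key _ _ _ (Or.inr (Or.inr ?_))
    split_ifs <;> simp
  · rw [h0]; omega

theorem Val.size_second_le (v : Val) : (Op.second.eval v).size ≤ v.size := by
  cases v with
  | num z => simp [Op.eval, Val.size]
  | pair a b => simp only [Op.eval, Val.size]; omega

theorem Val.size_list (l : List Val) :
    (Val.list l).size = 1 + (l.map fun v => v.size + 1).sum := by
  induction l with
  | nil => simp [Val.list, Val.size]
  | cons a l ih => simp only [Val.list, Val.size, ih, List.map_cons, List.sum_cons]; omega

theorem Val.length_le_size_list (l : List Val) : l.length ≤ (Val.list l).size := by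
  induction l with
  | nil => simp
  | cons a l ih => simp only [Val.list, Val.size, List.length_cons]; omega

/-- The step count pays for reading the input and for writing the result. -/
theorem eval_time_ge {p : Prog} {x y : Val} {r : List Bool} {t : ℕ} (h : Eval p x r y t) :
    x.size ≤ t ∧ y.size ≤ t := by
  induction h with
  | op o x => omega
  | const v x => omega
  | flip b x => cases b <;> simp [Val.size] <;> omega
  | both _ _ ih1 ih2 => simp only [Val.size]; omega
  | comp _ _ ih1 ih2 => omega
  | iteTrue _ _ _ ih1 ih2 => omega
  | iteFalse _ _ ih1 ih2 => omega
  | loopDone _ ih => omega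
  | loopStep _ _ _ _ ih1 ih2 ih3 => omega

/-! ### Polynomial-time computable functions -/

/-- `f` is computed from the environment `e` by one deterministic program, in a number of steps
that is bounded by a polynomial in `N`. The index type `X` is the set of admissible inputs; it
lets running times be measured by any parameter, and facts about inputs be used in proofs. -/
def PolyTime {X : Type} (N : X → ℕ) (e f : X → Val) : Prop :=
  ∃ (p : Prog) (P : Polynomial ℕ), ∀ x, ∃ t ≤ P.eval (N x), Eval p (e x) [] (f x) t

section PolyTime

variable {X Y : Type} {N : X → ℕ} {e f g v : X → Val}

theorem PolyTime.of_bound {t : X → ℕ} (ht : PolyBdd N t) (p : Prog)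
    (h : ∀ x, ∃ s ≤ t x, Eval p (e x) [] (f x) s) : PolyTime N e f := by
  obtain ⟨P, hP⟩ := ht
  refine ⟨p, P, fun x => ?_⟩
  obtain ⟨s, hs, h⟩ := h x
  exact ⟨s, hs.trans (hP x), h⟩

/-- A form in which step bounds can be added up without naming polynomials. -/
theorem PolyTime.exists_bound (h : PolyTime N e f) : ∃ (p : Prog) (t : X → ℕ), PolyBdd N t ∧
    ∀ x, ∃ s ≤ t x, Eval p (e x) [] (f x) s := by
  obtain ⟨p, P, h⟩ := h
  exact ⟨p, fun x => P.eval (N x), ⟨P, fun _ => le_rfl⟩, h⟩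

theorem PolyTime.size_env (h : PolyTime N e f) : PolyBdd N fun x => (e x).size := by
  obtain ⟨p, P, h⟩ := h
  exact ⟨P, fun x => by obtain ⟨t, ht, h⟩ := h x; exact (eval_time_ge h).1.trans ht⟩

theorem PolyTime.size_out (h : PolyTime N e f) : PolyBdd N fun x => (f x).size := by
  obtain ⟨p, P, h⟩ := h
  exact ⟨P, fun x => by obtain ⟨t, ht, h⟩ := h x; exact (eval_time_ge h).2.trans ht⟩

theorem PolyTime.congr (h : PolyTime N e f) (hfg : ∀ x, f x = g x) : PolyTime N e g := by
  rwa [← funext hfg]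

theorem PolyTime.op (o : Op) (h : PolyTime N e f) : PolyTime N e fun x => o.eval (f x) := by
  have hs := h.size_out
  obtain ⟨p, t, ht, h⟩ := h.exists_bound
  refine .of_bound (t := fun x => 1 + t x + (1 + (f x).size + ((f x).size + 2)))
    (((PolyBdd.const 1).add ht).add (((PolyBdd.const 1).add hs).add (hs.add (.const 2))))
    (.comp p (.op o)) fun x => ?_
  obtain ⟨s, hs, h⟩ := h x
  have := o.size_eval_le (f x)
  exact ⟨_, by omega, h.comp (.op o (f x))⟩

theorem PolyTime.refl (h : PolyBdd N fun x => (e x).size) : PolyTime N e e := by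
  refine .of_bound (((PolyBdd.const 1).add h).add h) (.op .skip) fun x => ⟨_, le_rfl, .op .skip _⟩

theorem PolyTime.const (h : PolyBdd N fun x => (e x).size) (v : Val) :
    PolyTime N e fun _ => v :=
  .of_bound (((PolyBdd.const 1).add h).add (.const v.size)) (.const v) fun _ =>
    ⟨_, le_rfl, .const v _⟩

theorem PolyTime.comp (hg : PolyTime N f g) (hf : PolyTime N e f) : PolyTime N e g := by
  obtain ⟨p, t, ht, hf⟩ := hf.exists_bound
  obtain ⟨q, u, hu, hg⟩ := hg.exists_bound
  refine .of_bound (((PolyBdd.const 1).add ht).add hu) (.comp p q) fun x => ?_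
  obtain ⟨s, hs, hf⟩ := hf x
  obtain ⟨s', hs', hg⟩ := hg x
  exact ⟨_, by omega, hf.comp hg⟩

theorem PolyTime.pair (hf : PolyTime N e f) (hg : PolyTime N e g) :
    PolyTime N e fun x => .pair (f x) (g x) := by
  obtain ⟨p, t, ht, hf⟩ := hf.exists_bound
  obtain ⟨q, u, hu, hg⟩ := hg.exists_bound
  refine .of_bound (((PolyBdd.const 1).add ht).add hu) (.both p q) fun x => ?_
  obtain ⟨s, hs, hf⟩ := hf x
  obtain ⟨s', hs', hg⟩ := hg x
  exact ⟨_, by omega, hf.both hg⟩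

theorem PolyTime.fst (h : PolyTime N e fun x => .pair (f x) (g x)) : PolyTime N e f := h.op .first

theorem PolyTime.snd (h : PolyTime N e fun x => .pair (f x) (g x)) : PolyTime N e g := h.op .second

/-- Substitution in the context. -/
theorem PolyTime.reindex (h : PolyTime N e f) (φ : Y → X) :
    PolyTime (fun y => N (φ y)) (fun y => e (φ y)) fun y => f (φ y) := by
  obtain ⟨p, P, h⟩ := h
  exact ⟨p, P, fun y => h (φ y)⟩

theorem PolyTime.mono {M : X → ℕ} (h : PolyTime M e f) (hM : PolyBdd N M) : PolyTime N e f := by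
  obtain ⟨p, t, ht, h⟩ := h.exists_bound
  exact .of_bound (ht.trans hM) p h

/-- Adding a value to the environment. -/
theorem PolyTime.push (h : PolyTime N e f) (hv : PolyBdd N fun x => (v x).size) :
    PolyTime N (fun x => .pair (e x) (v x)) f :=
  h.comp (PolyTime.fst (g := v) (.refl (((PolyBdd.const 1).add h.size_env).add hv)))

theorem PolyTime.top (he : PolyBdd N fun x => (e x).size) (hv : PolyBdd N fun x => (v x).size) :
    PolyTime N (fun x => .pair (e x) (v x)) v :=
  PolyTime.snd (f := e) (.refl (((PolyBdd.const 1).add he).add hv))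

theorem size_var_polyBdd (N : X → ℕ) : PolyBdd (extN N) fun p => (Val.num (p.2 : ℤ)).size :=
  ((PolyBdd.const 1).add (PolyBdd.var N)).mono fun p => by
    simpa [Val.size] using natSize_le_self p.2

/-- Adding a variable to the context. -/
theorem PolyTime.wk (h : PolyTime N e f) : PolyTime (extN N) (extE e) fun p => f p.1 :=
  ((h.reindex Prod.fst).mono ((PolyBdd.self N).wk)).push (size_var_polyBdd N)

theorem PolyTime.ite {c : X → Prop} [DecidablePred c]
    (hc : PolyTime N e fun x => .num (if c x then 1 else 0))
    (hf : PolyTime N e f) (hg : PolyTime N e g) :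
    PolyTime N e fun x => if c x then f x else g x := by
  obtain ⟨p, t, ht, hc⟩ := hc.exists_bound
  obtain ⟨q, u, hu, hf⟩ := hf.exists_bound
  obtain ⟨r, w, hw, hg⟩ := hg.exists_bound
  refine .of_bound ((((PolyBdd.const 1).add ht).add hu).add hw) (.ite p q r) fun x => ?_
  obtain ⟨s, hs, hc⟩ := hc x
  obtain ⟨s', hs', hf⟩ := hf x
  obtain ⟨s'', hs'', hg⟩ := hg x
  by_cases h : c x
  · simp only [h, if_true] at hc ⊢
    exact ⟨_, by omega, hc.iteTrue (by simp) hf⟩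
  · simp only [h, if_false] at hc ⊢
    exact ⟨_, by omega, hc.iteFalse hg⟩

/-- While-loops with a polynomially bounded number of iterations. -/
theorem PolyTime.while {s : X → ℕ → Val} {n : X → ℕ} {c : X × ℕ → Val} (hn : PolyBdd N n)
    (hc : PolyTime (extN N) (fun p => s p.1 p.2) c)
    (hpos : ∀ x i, i < n x → c (x, i) ≠ .num 0) (hend : ∀ x, c (x, n x) = .num 0)
    (hs : PolyTime (extN N) (fun p => s p.1 p.2) fun p => s p.1 (p.2 + 1)) :
    PolyTime N (fun x => s x 0) fun x => s x (n x) := by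
  obtain ⟨p, t, ht, hc⟩ := hc.exists_bound
  obtain ⟨q, u, hu, hs⟩ := hs.exists_bound
  obtain ⟨t', ht', htt⟩ := ht.exists_monotone
  obtain ⟨u', hu', huu⟩ := hu.exists_monotone
  have hK : PolyBdd N fun x => 1 + t' (x, n x) + u' (x, n x) :=
    ((PolyBdd.const 1).add (ht'.subst hn)).add (hu'.subst hn)
  refine .of_bound ((hn.add (.const 1)).mul hK) (.loop p q) fun x => ?_
  have key : ∀ j i, i + j = n x → ∃ r ≤ (j + 1) * (1 + t' (x, n x) + u' (x, n x)),
      Eval (.loop p q) (s x i) [] (s x (n x)) r := by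
    intro j
    induction j with
    | zero =>
      rintro i rfl
      obtain ⟨r, hr, hc⟩ := hc (x, n x)
      rw [hend] at hc
      have := htt x (n x) (n x) le_rfl
      exact ⟨_, by omega, .loopDone hc⟩
    | succ j ih =>
      intro i hi
      obtain ⟨r, hr, ih⟩ := ih (i + 1) (by omega)
      obtain ⟨r1, hr1, hc⟩ := hc (x, i)
      obtain ⟨r2, hr2, hs⟩ := hs (x, i)
      have h1 := htt x i (n x) (by omega)
      have h2 := huu x i (n x) (by omega)
      refine ⟨_, ?_, Eval.loopStep hc (hpos x i (by omega)) hs ih⟩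
      rw [Nat.succ_mul]
      omega
  exact key (n x) 0 (by omega)

/-- Iteration for a number of rounds that is given in the environment. -/
theorem PolyTime.iter {s : X → ℕ → Val} {n : X → ℕ} (hn : PolyTime N e fun x => .num (n x))
    (hnb : PolyBdd N n) (h0 : PolyTime N e fun x => s x 0)
    (hb : PolyBdd (extN N) fun p => (s p.1 p.2).size)
    (hs : PolyTime (extN N) (fun p => .pair (extE e p) (s p.1 p.2)) fun p => s p.1 (p.2 + 1)) :
    PolyTime N e fun x => s x (n x) := by
  let σ : X → ℕ → Val := fun x i =>
    .pair (.pair (.pair (e x) (.num i)) (s x i)) (.num (n x))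
  have hσ : PolyBdd (extN N) fun p => (σ p.1 p.2).size :=
    ((PolyBdd.const 1).add (((PolyBdd.const 1).add (((PolyBdd.const 1).add h0.size_env.wk).add
      (size_var_polyBdd N))).add hb)).add hn.size_out.wk
  have hid : PolyTime (extN N) (fun p => σ p.1 p.2) fun p => σ p.1 p.2 := .refl hσ
  have h1 : PolyTime (extN N) (fun p => σ p.1 p.2) fun p => .pair (extE e p) (s p.1 p.2) := hid.fst
  have hnn : PolyTime (extN N) (fun p => σ p.1 p.2) fun p => .num (n p.1) := hid.snd
  have hi : PolyTime (extN N) (fun p => σ p.1 p.2) fun p => .num p.2 := h1.fst.snd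
  have hone := PolyTime.const hσ (.num 1)
  have hw : PolyTime N (fun x => σ x 0) fun x => σ x (n x) := by
    refine PolyTime.while (c := fun p => .num (n p.1 - p.2)) hnb ((hnn.pair hi).op .sub) ?_ ?_ ?_
    · intro x i hi h
      injection h with h
      replace h : (n x : ℤ) - i = 0 := h
      omega
    · intro x
      simp
    · refine (((h1.fst.fst.pair ((hi.pair hone).op .add)).pair (hs.comp h1)).pair hnn).congr
        fun p => ?_
      simp [σ, Op.eval]
  refine PolyTime.snd (f := fun x => .pair (e x) (.num (n x))) (PolyTime.fst (g := fun x =>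
    .num (n x)) (hw.comp ?_))
  exact ((((PolyTime.refl h0.size_env).pair (.const h0.size_env (.num 0))).pair h0).pair hn).congr
    fun x => rfl

end PolyTime

/-- The `i`-th component of a list, and `num 0` beyond its end. -/
def Val.nth (v : Val) (i : ℕ) : Val := Op.first.eval (Op.second.eval^[i] v)

/-- A list of `n` values. -/
def Val.fam (n : ℕ) (f : ℕ → Val) : Val := .list ((List.range n).map f)

theorem Val.nth_list (l : List Val) (i : ℕ) :
    (Val.list l).nth i = (l[i]?).getD (.num 0) := by
  induction i generalizing l with
  | zero => cases l <;> simp [Val.nth, Val.list, Op.eval]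
  | succ i ih =>
    cases l with
    | nil =>
      have := ih []
      simpa [Val.nth, Val.list, Op.eval] using this
    | cons a l => simpa [Val.nth, Val.list, Op.eval] using ih l

theorem Val.nth_fam (n : ℕ) (f : ℕ → Val) (i : ℕ) :
    (Val.fam n f).nth i = if i < n then f i else .num 0 := by
  rw [Val.fam, Val.nth_list, List.getElem?_map]
  split_ifs with h
  · simp [List.getElem?_range h]
  · simp [List.getElem?_eq_none (l := List.range n) (i := i) (by simpa using h)]

theorem Val.nth_family {n : ℕ} (f : Fin n → Val) (i : ℕ) :
    (Val.family f).nth i = if h : i < n then f ⟨i, h⟩ else .num 0 := by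
  rw [Val.family, Val.nth_list]
  split_ifs with h <;> simp [h]

theorem Val.size_fam_le {n : ℕ} {f : ℕ → Val} {b : ℕ} (h : ∀ i < n, (f i).size ≤ b) :
    (Val.fam n f).size ≤ 1 + n * (b + 1) := by
  rw [Val.fam, Val.size_list, List.map_map]
  have := List.sum_le_card_nsmul ((List.range n).map ((fun v => v.size + 1) ∘ f)) (b + 1) (by
    simpa using h)
  simpa using this

theorem Val.nth_num_zero (i : ℕ) : (Val.num 0).nth i = .num 0 := by
  simpa [Val.list] using Val.nth_list [] i

/-! ### Arithmetic functions -/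

section Arith

variable {X : Type} {N : X → ℕ} {e : X → Val}

/-- Integer-valued polynomial-time functions. -/
def PolyInt (N : X → ℕ) (e : X → Val) (f : X → ℤ) : Prop := PolyTime N e fun x => .num (f x)

/-- Polynomial-time functions with values in the natural numbers, held in binary. -/
def PolyNat (N : X → ℕ) (e : X → Val) (f : X → ℕ) : Prop := PolyInt N e fun x => (f x : ℤ)

open Classical in
/-- Polynomial-time decidable predicates. -/
def PolyDec (N : X → ℕ) (e : X → Val) (c : X → Prop) : Prop :=
  PolyInt N e fun x => if c x then 1 else 0

/-- Polynomial-time functions whose values (and not only their lengths in binary) are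
polynomially bounded, so that they may count iterations. -/
structure PolySmall (N : X → ℕ) (e : X → Val) (f : X → ℕ) : Prop where
  nat : PolyNat N e f
  bdd : PolyBdd N f

variable {f g : X → ℤ} {f' g' : X → ℕ} {c d : X → Prop} {v : X → Val}

theorem PolyInt.wk (h : PolyInt N e f) : PolyInt (extN N) (extE e) fun p => f p.1 := PolyTime.wk h
theorem PolyNat.wk (h : PolyNat N e f') : PolyNat (extN N) (extE e) fun p => f' p.1 := PolyTime.wk h
theorem PolySmall.wk (h : PolySmall N e f') : PolySmall (extN N) (extE e) fun p => f' p.1 :=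
  ⟨h.nat.wk, h.bdd.wk⟩

theorem PolyInt.push (h : PolyInt N e f) (hv : PolyBdd N fun x => (v x).size) :
    PolyInt N (fun x => .pair (e x) (v x)) f := PolyTime.push h hv
theorem PolyNat.push (h : PolyNat N e f') (hv : PolyBdd N fun x => (v x).size) :
    PolyNat N (fun x => .pair (e x) (v x)) f' := PolyTime.push h hv
theorem PolySmall.push (h : PolySmall N e f') (hv : PolyBdd N fun x => (v x).size) :
    PolySmall N (fun x => .pair (e x) (v x)) f' := ⟨h.nat.push hv, h.bdd⟩

theorem PolySmall.var (h : PolyBdd N fun x => (e x).size) :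
    PolySmall (extN N) (extE e) fun p => p.2 :=
  ⟨PolyTime.top h.wk (size_var_polyBdd N), PolyBdd.var N⟩

theorem PolyInt.congr (h : PolyInt N e f) (hfg : ∀ x, f x = g x) : PolyInt N e g := by
  rwa [← funext hfg]
theorem PolyNat.congr (h : PolyNat N e f') (hfg : ∀ x, f' x = g' x) : PolyNat N e g' := by
  rwa [← funext hfg]
theorem PolyDec.congr (h : PolyDec N e c) (hfg : ∀ x, c x ↔ d x) : PolyDec N e d := by
  rwa [← funext fun x => propext (hfg x)]

theorem PolyNat.int (h : PolyNat N e f') : PolyInt N e fun x => (f' x : ℤ) := h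

theorem PolyInt.size_env (h : PolyInt N e f) : PolyBdd N fun x => (e x).size := PolyTime.size_env h
theorem PolyNat.size_env (h : PolyNat N e f') : PolyBdd N fun x => (e x).size :=
  PolyTime.size_env h

theorem PolyInt.const (h : PolyBdd N fun x => (e x).size) (z : ℤ) : PolyInt N e fun _ => z :=
  PolyTime.const h _
theorem PolyNat.const (h : PolyBdd N fun x => (e x).size) (z : ℕ) : PolyNat N e fun _ => z :=
  PolyTime.const h _
theorem PolySmall.const (h : PolyBdd N fun x => (e x).size) (z : ℕ) : PolySmall N e fun _ => z :=
  ⟨.const h z, .const z⟩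

theorem PolyInt.add (hf : PolyInt N e f) (hg : PolyInt N e g) : PolyInt N e fun x => f x + g x :=
  (PolyTime.pair hf hg).op .add
theorem PolyInt.sub (hf : PolyInt N e f) (hg : PolyInt N e g) : PolyInt N e fun x => f x - g x :=
  (PolyTime.pair hf hg).op .sub
theorem PolyInt.mul (hf : PolyInt N e f) (hg : PolyInt N e g) : PolyInt N e fun x => f x * g x :=
  (PolyTime.pair hf hg).op .mul
theorem PolyInt.div (hf : PolyInt N e f) (hg : PolyInt N e g) : PolyInt N e fun x => f x / g x :=
  (PolyTime.pair hf hg).op .div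

theorem PolyNat.add (hf : PolyNat N e f') (hg : PolyNat N e g') :
    PolyNat N e fun x => f' x + g' x :=
  (hf.int.add hg.int).congr fun x => by push_cast; rfl
theorem PolyNat.mul (hf : PolyNat N e f') (hg : PolyNat N e g') :
    PolyNat N e fun x => f' x * g' x :=
  (hf.int.mul hg.int).congr fun x => by push_cast; rfl
theorem PolyNat.div (hf : PolyNat N e f') (hg : PolyNat N e g') :
    PolyNat N e fun x => f' x / g' x :=
  (hf.int.div hg.int).congr fun x => by push_cast; rfl

theorem PolyInt.le (hf : PolyInt N e f) (hg : PolyInt N e g) : PolyDec N e fun x => f x ≤ g x := by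
  refine ((PolyTime.pair hf hg).op .le).congr fun x => ?_
  simp only [Op.eval]
  congr

theorem PolyDec.ite [DecidablePred c] {f g : X → Val} (hc : PolyDec N e c) (hf : PolyTime N e f)
    (hg : PolyTime N e g) : PolyTime N e fun x => if c x then f x else g x := by
  classical
  refine PolyTime.ite (c := c) (PolyTime.congr hc fun x => ?_) hf hg
  by_cases h : c x <;> simp [h]

theorem PolyInt.ite [DecidablePred c] (hc : PolyDec N e c) (hf : PolyInt N e f)
    (hg : PolyInt N e g) : PolyInt N e fun x => if c x then f x else g x :=
  (hc.ite hf hg).congr fun x => by by_cases h : c x <;> simp [h]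

theorem PolyNat.ite [DecidablePred c] (hc : PolyDec N e c) (hf : PolyNat N e f')
    (hg : PolyNat N e g') : PolyNat N e fun x => if c x then f' x else g' x :=
  (PolyInt.ite hc hf.int hg.int).congr fun x => by dsimp only; split_ifs <;> rfl

theorem PolyDec.not (hc : PolyDec N e c) : PolyDec N e fun x => ¬ c x := by
  classical
  refine ((PolyInt.const hc.size_env 1).sub hc).congr fun x => ?_
  by_cases h : c x <;> simp [h]

theorem PolyDec.and (hc : PolyDec N e c) (hd : PolyDec N e d) :
    PolyDec N e fun x => c x ∧ d x := by
  classical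
  refine (PolyInt.mul hc hd).congr fun x => ?_
  by_cases h : c x <;> by_cases h' : d x <;> simp [h, h']

theorem PolyDec.or (hc : PolyDec N e c) (hd : PolyDec N e d) :
    PolyDec N e fun x => c x ∨ d x :=
  (hc.not.and hd.not).not.congr fun x => by tauto

theorem PolyInt.lt (hf : PolyInt N e f) (hg : PolyInt N e g) : PolyDec N e fun x => f x < g x :=
  (hg.le hf).not.congr fun _ => not_le
theorem PolyInt.eq (hf : PolyInt N e f) (hg : PolyInt N e g) : PolyDec N e fun x => f x = g x :=
  ((hf.le hg).and (hg.le hf)).congr fun _ => le_antisymm_iff.symm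
theorem PolyNat.le (hf : PolyNat N e f') (hg : PolyNat N e g') :
    PolyDec N e fun x => f' x ≤ g' x := (hf.int.le hg.int).congr fun x => by simp
theorem PolyNat.lt (hf : PolyNat N e f') (hg : PolyNat N e g') :
    PolyDec N e fun x => f' x < g' x := (hf.int.lt hg.int).congr fun x => by simp
theorem PolyNat.eq (hf : PolyNat N e f') (hg : PolyNat N e g') :
    PolyDec N e fun x => f' x = g' x := (hf.int.eq hg.int).congr fun x => by simp

theorem PolyNat.sub (hf : PolyNat N e f') (hg : PolyNat N e g') :
    PolyNat N e fun x => f' x - g' x := by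
  classical
  refine (PolyInt.ite (hg.le hf) (hf.int.sub hg.int) (.const hf.size_env 0)).congr fun x => ?_
  dsimp only
  split_ifs <;> omega

theorem PolyNat.min (hf : PolyNat N e f') (hg : PolyNat N e g') :
    PolyNat N e fun x => Min.min (f' x) (g' x) :=
  (PolyNat.ite (hf.le hg) hf hg).congr fun _ => (min_def _ _).symm

theorem PolyInt.toNat (hf : PolyInt N e f) : PolyNat N e fun x => (f x).toNat := by
  classical
  refine (PolyInt.ite ((PolyInt.const hf.size_env 0).le hf) hf (.const hf.size_env 0)).congr
    fun x => ?_
  dsimp only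
  split_ifs <;> omega

theorem PolyInt.natAbs (hf : PolyInt N e f) : PolyNat N e fun x => (f x).natAbs :=
  (hf.toNat.add ((PolyInt.const hf.size_env 0).sub hf).toNat).congr fun x => by omega

theorem PolySmall.add (hf : PolySmall N e f') (hg : PolySmall N e g') :
    PolySmall N e fun x => f' x + g' x := ⟨hf.nat.add hg.nat, hf.bdd.add hg.bdd⟩
theorem PolySmall.mul (hf : PolySmall N e f') (hg : PolySmall N e g') :
    PolySmall N e fun x => f' x * g' x := ⟨hf.nat.mul hg.nat, hf.bdd.mul hg.bdd⟩
theorem PolySmall.sub (hf : PolySmall N e f') (hg : PolySmall N e g') :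
    PolySmall N e fun x => f' x - g' x :=
  ⟨hf.nat.sub hg.nat, hf.bdd.mono fun _ => Nat.sub_le _ _⟩

theorem PolyInt.sum {n : X → ℕ} {f : X → ℕ → ℤ} (hn : PolySmall N e n)
    (hf : PolyInt (extN N) (extE e) fun p => f p.1 p.2) :
    PolyInt N e fun x => ∑ i ∈ Finset.range (n x), f x i := by
  have hb : PolyBdd (extN N) fun p : X × ℕ =>
      (Val.num (∑ i ∈ Finset.range p.2, f p.1 i)).size := by
    have hf' : PolyBdd (extN N) fun p => (Val.num (f p.1 p.2)).size := PolyTime.size_out hf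
    obtain ⟨H, hH, h⟩ := hf'.exists_monotone
    refine ((PolyBdd.const 1).add ((PolyBdd.var N).mul (hH.add (.const 1)))).mono ?_
    rintro ⟨x, k⟩
    simp only [Val.size]
    refine Nat.add_le_add_left ?_ 1
    calc _ ≤ (∑ i ∈ Finset.range k, (f x i).natAbs).size :=
          Nat.size_le_size (Int.natAbs_sum_le _ _)
      _ ≤ ∑ i ∈ Finset.range k, ((f x i).natAbs.size + 1) := natSize_sum_le _ _
      _ ≤ ∑ i ∈ Finset.range k, (H (x, k) + 1) := by
          refine Finset.sum_le_sum fun i hi => ?_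
          have := h x i k (Finset.mem_range.1 hi).le
          simp only [Val.size] at this
          omega
      _ = _ := by simp
  refine PolyTime.iter (s := fun x i => .num (∑ j ∈ Finset.range i, f x j)) hn.nat hn.bdd
    ((PolyTime.const hn.nat.size_env (.num 0)).congr fun x => by simp) hb ?_
  have h1 : PolyInt (extN N)
      (fun p => .pair (extE e p) (.num (∑ j ∈ Finset.range p.2, f p.1 j)))
      fun p => ∑ j ∈ Finset.range p.2, f p.1 j := PolyTime.top (PolyTime.size_env hf) hb
  have h2 := PolyInt.push hf hb
  exact (h1.add h2).congr fun p => (Finset.sum_range_succ _ _).symm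

theorem PolyNat.sum {n : X → ℕ} {f : X → ℕ → ℕ} (hn : PolySmall N e n)
    (hf : PolyNat (extN N) (extE e) fun p => f p.1 p.2) :
    PolyNat N e fun x => ∑ i ∈ Finset.range (n x), f x i :=
  (PolyInt.sum hn hf.int).congr fun x => by push_cast; rfl

theorem PolySmall.sum {n : X → ℕ} {f : X → ℕ → ℕ} (hn : PolySmall N e n)
    (hf : PolySmall (extN N) (extE e) fun p => f p.1 p.2) :
    PolySmall N e fun x => ∑ i ∈ Finset.range (n x), f x i := by
  refine ⟨PolyNat.sum hn hf.nat, ?_⟩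
  obtain ⟨H, hH, h⟩ := hf.bdd.exists_monotone
  refine (hn.bdd.mul (hH.subst hn.bdd)).mono fun x => ?_
  calc _ ≤ ∑ i ∈ Finset.range (n x), H (x, n x) :=
        Finset.sum_le_sum fun i hi => h x i (n x) (Finset.mem_range.1 hi).le
    _ = _ := by simp

theorem PolyNat.prod {n : X → ℕ} {f : X → ℕ → ℕ} (hn : PolySmall N e n)
    (hf : PolyNat (extN N) (extE e) fun p => f p.1 p.2) :
    PolyNat N e fun x => ∏ i ∈ Finset.range (n x), f x i := by
  have hb : PolyBdd (extN N) fun p : X × ℕ =>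
      (Val.num ((∏ i ∈ Finset.range p.2, f p.1 i : ℕ) : ℤ)).size := by
    have hf' : PolyBdd (extN N) fun p => (Val.num (f p.1 p.2 : ℤ)).size := PolyTime.size_out hf
    obtain ⟨H, hH, h⟩ := hf'.exists_monotone
    refine ((PolyBdd.const 1).add (((PolyBdd.var N).mul hH).add (.const 1))).mono ?_
    rintro ⟨x, k⟩
    simp only [Val.size, Int.natAbs_natCast]
    refine Nat.add_le_add_left ?_ 1
    calc _ ≤ (∑ i ∈ Finset.range k, (f x i).size) + 1 := natSize_prod_le _ _
      _ ≤ (∑ i ∈ Finset.range k, H (x, k)) + 1 := by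
          refine Nat.add_le_add_right (Finset.sum_le_sum fun i hi => ?_) 1
          have := h x i k (Finset.mem_range.1 hi).le
          simp only [Val.size, Int.natAbs_natCast] at this
          omega
      _ = _ := by simp
  refine PolyTime.iter (s := fun x i => .num ((∏ j ∈ Finset.range i, f x j : ℕ) : ℤ)) hn.nat hn.bdd
    ((PolyTime.const hn.nat.size_env (.num 1)).congr fun x => by simp) hb ?_
  have h1 : PolyNat (extN N)
      (fun p => .pair (extE e p) (.num ((∏ j ∈ Finset.range p.2, f p.1 j : ℕ) : ℤ)))
      fun p => ∏ j ∈ Finset.range p.2, f p.1 j := PolyTime.top (PolyTime.size_env hf) hb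
  have h2 := PolyNat.push hf hb
  exact (h1.mul h2).congr fun p => (Finset.prod_range_succ _ _).symm

/-- Tabulation of a polynomial-time function. -/
theorem PolyTime.fam {n : X → ℕ} {f : X → ℕ → Val} (hn : PolySmall N e n)
    (hf : PolyTime (extN N) (extE e) fun p => f p.1 p.2) :
    PolyTime N e fun x => Val.fam (n x) (f x) := by
  -- the list is built from its end; `s x i` holds its last `i` components
  let s : X → ℕ → Val := fun x i => i.rec (.num 0) fun j v => .pair (f x (n x - 1 - j)) v
  have hs : ∀ x i, i ≤ n x → s x i = .list (((List.range (n x)).map (f x)).drop (n x - i)) := by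
    intro x i
    induction i with
    | zero => intro _; rw [Nat.sub_zero, List.drop_of_length_le (by simp)]; rfl
    | succ i ih =>
      intro hi
      have h1 : n x - (i + 1) < ((List.range (n x)).map (f x)).length := by simp; omega
      rw [List.drop_eq_getElem_cons h1, Val.list]
      have h2 : n x - (i + 1) + 1 = n x - i := by omega
      rw [h2, ← ih (by omega)]
      simp only [s, List.getElem_map, List.getElem_range]
      congr 2
      omega
  have hb : PolyBdd (extN N) fun p : X × ℕ => (s p.1 p.2).size := by
    obtain ⟨H, hH, h⟩ := hf.size_out.exists_monotone
    refine ((PolyBdd.const 1).add ((PolyBdd.var N).mul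
      ((hH.subst hn.bdd).wk.add (.const 1)))).mono fun p => ?_
    obtain ⟨x, i⟩ := p
    simp only
    induction i with
    | zero => simp [s, Val.size]
    | succ i ih =>
      have h1 := h x (n x - 1 - i) (n x) (by omega)
      have h2 : s x (i + 1) = .pair (f x (n x - 1 - i)) (s x i) := rfl
      rw [h2, Val.size, Nat.succ_mul]
      simp only at h1
      omega
  refine (PolyTime.iter (s := s) hn.nat hn.bdd (PolyTime.const hn.nat.size_env (.num 0)) hb
    ?_).congr fun x => ?_
  · refine PolyTime.pair (f := fun p => f p.1 (n p.1 - 1 - p.2)) ?_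
      (PolyTime.top (PolyTime.size_env hf) hb)
    have hi : PolySmall (extN N) (extE e) fun p => n p.1 - 1 - p.2 :=
      (hn.wk.sub (.const hn.wk.nat.size_env 1)).sub (.var hn.nat.size_env)
    refine PolyTime.push ?_ hb
    have := (hf.reindex fun p : X × ℕ => (p.1, n p.1 - 1 - p.2)).mono
      ((PolyBdd.self N).wk.add hi.bdd)
    exact this.comp (PolyTime.pair (PolyTime.fst (g := fun p : X × ℕ => .num (p.2 : ℤ))
      (.refl hn.wk.nat.size_env)) hi.nat)
  · rw [hs x _ le_rfl, Nat.sub_self, List.drop_zero, Val.fam]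

/-- Access to a list, by repeated passage to the tail. -/
theorem PolyTime.nth (hv : PolyTime N e v) (hi : PolySmall N e f') :
    PolyTime N e fun x => (v x).nth (f' x) := by
  have hb : PolyBdd (extN N) fun p : X × ℕ => (Op.second.eval^[p.2] (v p.1)).size := by
    refine hv.size_out.wk.mono fun p => ?_
    obtain ⟨x, i⟩ := p
    simp only
    induction i with
    | zero => simp
    | succ i ih =>
      rw [Function.iterate_succ_apply']
      exact (Val.size_second_le _).trans ih
  refine (PolyTime.iter (s := fun x i => Op.second.eval^[i] (v x)) hi.nat hi.bdd hv hb ?_).op .first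
  refine ((PolyTime.top hv.wk.size_env hb).op .second).congr fun p => ?_
  rw [Function.iterate_succ_apply']

/-- The length of a list is found by a loop that removes one item in each round. -/
theorem PolySmall.length {l : X → List Val} (h : PolyTime N e fun x => .list (l x)) :
    PolySmall N e fun x => (l x).length := by
  have hb : PolyBdd N fun x => (l x).length :=
    h.size_out.mono fun x => Val.length_le_size_list (l x)
  refine ⟨?_, hb⟩
  let s : X → ℕ → Val := fun x i => .pair (.list ((l x).drop i)) (.num i)
  have hdrop : ∀ x i, (Val.list ((l x).drop (i + 1))) = Op.second.eval (.list ((l x).drop i)) := by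
    intro x i
    rw [← List.tail_drop]
    cases (l x).drop i <;> simp [Val.list, Op.eval]
  have hsz : ∀ x i, (Val.list ((l x).drop i)).size ≤ (Val.list (l x)).size := by
    intro x i
    induction i with
    | zero => simp
    | succ i ih =>
      rw [hdrop]
      exact (Val.size_second_le _).trans ih
  have hσ : PolyBdd (extN N) fun p => (s p.1 p.2).size :=
    ((PolyBdd.const 1).add (h.size_out.wk.mono fun p => hsz p.1 p.2)).add (size_var_polyBdd N)
  have hid : PolyTime (extN N) (fun p => s p.1 p.2) fun p => s p.1 p.2 := .refl hσ
  have hone := PolyTime.const hσ (.num 1)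
  have hw : PolyTime N (fun x => s x 0) fun x => s x (l x).length := by
    refine PolyTime.while (c := fun p => Op.sub.eval (.pair (.num 1)
      (Op.isNum.eval (.list ((l p.1).drop p.2))))) hb
      ((hone.pair (hid.fst.op .isNum)).op .sub) ?_ ?_ ?_
    · intro x i hi
      rw [List.drop_eq_getElem_cons hi]
      simp [Val.list, Op.eval]
    · intro x
      simp [Val.list, Op.eval]
    · refine ((hid.fst.op .second).pair ((hid.snd.pair hone).op .add)).congr fun p => ?_
      simp [s, Op.eval, hdrop]
  refine PolyTime.snd (f := fun x => .list ((l x).drop (l x).length)) (hw.comp ?_)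
  exact (h.pair (.const h.size_env (.num 0))).congr fun x => by simp [s]

end Arith

/-! ### Uniform random numbers -/

theorem PolyTime.exists_prog {X : Type} {N : X → ℕ} {e f : X → Val} (h : PolyTime N e f) :
    ∃ (p : Prog) (t : X → ℕ), PolyBdd N t ∧ ∀ x,
      (∀ F, p.mean (e x) F = F (f x)) ∧ p.time (e x) ≤ t x := by
  obtain ⟨p, t, ht, h⟩ := h.exists_bound
  refine ⟨p, t, ht, fun x => ?_⟩
  obtain ⟨s, hs, h⟩ := h x
  exact ⟨mean_det h, by rw [time_det h]; exact_mod_cast hs⟩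

theorem mean_skip (x : Val) (F : Val → ℝ≥0∞) : (Prog.op .skip).mean x F = F x :=
  mean_det (.op .skip x) F

theorem time_skip (x : Val) : (Prog.op .skip).time x = ((1 + x.size + x.size : ℕ) : ℝ≥0∞) :=
  time_det (.op .skip x)

/-- The states in which random bits are collected: the bound `D`, a power of two, and the number
formed by the bits so far. -/
def bitState (z : ℕ × ℕ × ℕ) : Val := .pair (.num z.1) (.pair (.num z.2.1) (.num z.2.2))

/-- The length of a state in which random bits are collected. -/
abbrev bitSize (z : ℕ × ℕ × ℕ) : ℕ := z.1.size + z.2.1.size + z.2.2.size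

theorem size_bitState (z : ℕ × ℕ × ℕ) : (bitState z).size = bitSize z + 5 := by
  simp only [bitState, bitSize, Val.size, Int.natAbs_natCast]; omega

theorem size_lt_two_mul {a D : ℕ} (h : a < 2 * D) : a.size ≤ D.size + 1 := by
  rw [Nat.size_le, pow_succ]
  have := Nat.lt_size_self D
  omega

/-- A number drawn with `Nat.clog 2 D` bits is below `D` with probability more than one half. -/
theorem two_pow_clog_lt {D : ℕ} (hD : 0 < D) : 2 ^ Nat.clog 2 D < 2 * D := by
  rcases Nat.lt_or_ge 1 D with h | h
  · have h1 := Nat.pow_pred_clog_lt_self one_lt_two h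
    have h2 := Nat.clog_pos one_lt_two h
    calc 2 ^ Nat.clog 2 D = 2 * 2 ^ (Nat.clog 2 D - 1) := by
          rw [← pow_succ', Nat.sub_add_cancel h2]
      _ < _ := by rw [Nat.pred_eq_sub_one] at h1; omega
  · obtain rfl : D = 1 := by omega
    simp

theorem sum_range_two_pow_succ (j : ℕ) (G : ℕ → ℝ≥0∞) :
    ((2 : ℝ≥0∞) ^ (j + 1))⁻¹ * ∑ u ∈ Finset.range (2 ^ (j + 1)), G u =
      2⁻¹ * (((2 : ℝ≥0∞) ^ j)⁻¹ * ∑ u ∈ Finset.range (2 ^ j), G (2 ^ j + u)) +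
        2⁻¹ * (((2 : ℝ≥0∞) ^ j)⁻¹ * ∑ u ∈ Finset.range (2 ^ j), G u) := by
  rw [pow_succ (2 : ℕ) j, mul_two (2 ^ j : ℕ), Finset.sum_range_add, pow_succ (2 : ℝ≥0∞) j,
    ENNReal.mul_inv (.inr ENNReal.ofNat_ne_top) (.inr two_ne_zero)]
  ring

/-- One round of the collection of random bits: the test that compares the power of two with the
bound, and the body that doubles the power and appends a bit. -/
theorem exists_bit_step : ∃ (c f : Prog) (t : ℕ → ℕ), PolyBdd Nat.size t ∧
    (∀ z, (∀ F, c.mean (bitState z) F = F (.num (if z.2.1 < z.1 then 1 else 0))) ∧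
      ∀ F, f.mean (bitState z) F = 2⁻¹ * F (bitState (z.1, 2 * z.2.1, 2 * z.2.2 + 1)) +
        2⁻¹ * F (bitState (z.1, 2 * z.2.1, 2 * z.2.2))) ∧
    ∀ z, z.2.1 < 2 * z.1 → z.2.2 < 2 * z.1 →
      1 + c.time (bitState z) + f.time (bitState z) ≤ t z.1 := by
  classical
  have hs : PolyBdd bitSize fun z => (bitState z).size :=
    ((PolyBdd.self _).add (.const 5)).mono fun z => (size_bitState z).le
  have h0 : PolyTime bitSize bitState bitState := .refl hs
  have hD : PolyNat bitSize bitState fun z => z.1 := h0.fst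
  have hpw : PolyNat bitSize bitState fun z => z.2.1 := h0.snd.fst
  have hv : PolyNat bitSize bitState fun z => z.2.2 := h0.snd.snd
  have hc : PolyNat (extN bitSize) (extE bitState) fun p => p.2 := (PolySmall.var hs).nat
  have two : PolyNat (extN bitSize) (extE bitState) fun _ => 2 := .const h0.wk.size_env 2
  have hf : PolyTime (extN bitSize) (extE bitState) fun p =>
      bitState (p.1.1, 2 * p.1.2.1, 2 * p.1.2.2 + p.2) :=
    PolyTime.pair hD.wk (PolyTime.pair (two.mul hpw.wk) ((two.mul hv.wk).add hc))
  obtain ⟨c, t₁, ⟨P₁, hP₁⟩, h₁⟩ := PolyTime.exists_prog (hpw.lt hD)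
  obtain ⟨f, t₂, ⟨P₂, hP₂⟩, h₂⟩ := PolyTime.exists_prog hf
  let L : ℕ → ℕ := fun D => 3 * D.size + 3
  have hL : PolyBdd Nat.size L := ((PolyBdd.const 3).mul (.self _)).add (.const 3)
  refine ⟨c, .comp (.both (.op .skip) .flip) f,
    fun D => 1 + P₁.eval (L D) + (1 + (1 + (1 + (L D + 5) + (L D + 5)) + (3 + (L D + 5))) +
      P₂.eval (L D)), ?_, fun z => ⟨fun F => ?_, fun F => ?_⟩, fun z hz₁ hz₂ => ?_⟩
  · have e : ∀ P : Polynomial ℕ, PolyBdd Nat.size fun D => P.eval (L D) := fun P =>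
      PolyBdd.trans (h := fun D => P.eval (L D)) ⟨P, fun _ => le_rfl⟩ hL
    have hL5 := hL.add (.const 5)
    exact ((PolyBdd.const 1).add (e P₁)).add (((PolyBdd.const 1).add (((PolyBdd.const 1).add
      (((PolyBdd.const 1).add hL5).add hL5)).add ((PolyBdd.const 3).add hL5))).add (e P₂))
  · rw [(h₁ z).1]; dsimp only; congr
  · rw [mean_comp, mean_both, mean_skip, mean_flip]
    have e1 := (h₂ (z, 1)).1 F
    have e0 := (h₂ (z, 0)).1 F
    simp only [extE, Nat.cast_one, Nat.cast_zero, add_zero] at e1 e0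
    rw [e1, e0]
  · have hsz : bitSize z + 1 ≤ L z.1 := by
      have := size_lt_two_mul hz₁
      have := size_lt_two_mul hz₂
      simp only [L, bitSize]; omega
    have b1 : c.time (bitState z) ≤ (P₁.eval (L z.1) : ℕ) :=
      (h₁ z).2.trans (by exact_mod_cast (hP₁ z).trans (eval_mono_nat P₁ (by omega)))
    have b2 : ∀ i ≤ 1, f.time (.pair (bitState z) (.num (i : ℕ))) ≤ (P₂.eval (L z.1) : ℕ) :=
      fun i hi => (h₂ (z, i)).2.trans (by
        exact_mod_cast (hP₂ (z, i)).trans (eval_mono_nat P₂ (by simp only [extN]; omega)))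
    have b3 : (Prog.both (.op .skip) .flip).mean (bitState z) f.time ≤ (P₂.eval (L z.1) : ℕ) := by
      rw [mean_both, mean_skip, mean_flip]
      calc _ ≤ 2⁻¹ * ((P₂.eval (L z.1) : ℕ) : ℝ≥0∞) + 2⁻¹ * ((P₂.eval (L z.1) : ℕ) : ℝ≥0∞) := by
            gcongr
            · exact b2 1 le_rfl
            · exact b2 0 zero_le_one
        _ = _ := by rw [← add_mul, ENNReal.inv_two_add_inv_two, one_mul]
    have b4 : (bitState z).size ≤ L z.1 + 5 := by rw [size_bitState]; omega
    push_cast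
    gcongr
    refine (time_comp_le _ _ _).trans ?_
    gcongr
    refine (time_both_le _ _ _).trans ?_
    rw [time_skip, time_flip]
    push_cast
    have b5 : ((bitState z).size : ℝ≥0∞) ≤ (L z.1 : ℝ≥0∞) + 5 := by exact_mod_cast b4
    gcongr

/-- A uniformly random number with as many bits as are needed for numbers below `D`. -/
theorem exists_draw_bits : ∃ (p : Prog) (t : ℕ → ℕ), PolyBdd Nat.size t ∧ ∀ D : ℕ, 0 < D →
    (∀ F, p.mean (.num D) F = ((2 : ℝ≥0∞) ^ Nat.clog 2 D)⁻¹ *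
      ∑ v ∈ Finset.range (2 ^ Nat.clog 2 D), F (.num (v : ℤ))) ∧ p.time (.num D) ≤ t D := by
  classical
  obtain ⟨c, f, K, hK, hcf, ht⟩ := exists_bit_step
  have hs1 : PolyBdd Nat.size fun D => (Val.num (D : ℕ)).size :=
    ((PolyBdd.const 1).add (.self _)).mono fun D => by simp [Val.size]
  have h1 : PolyNat Nat.size (fun D => .num (D : ℕ)) fun D => D := PolyTime.refl hs1
  have hinit : PolyTime Nat.size (fun D => .num (D : ℕ)) fun D => bitState (D, 1, 0) :=
    PolyTime.pair h1 (PolyTime.pair (PolyTime.const hs1 (.num 1)) (PolyTime.const hs1 (.num 0)))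
  have hs : PolyBdd bitSize fun z => (bitState z).size :=
    ((PolyBdd.self _).add (.const 5)).mono fun z => (size_bitState z).le
  have hout : PolyTime bitSize bitState fun z => .num (z.2.2 : ℕ) :=
    (PolyTime.refl hs : PolyTime bitSize bitState bitState).snd.snd
  obtain ⟨p₁, t₁, ht₁, h₁⟩ := hinit.exists_prog
  obtain ⟨p₂, t₂, ⟨P₂, hP₂⟩, h₂⟩ := hout.exists_prog
  have hloop : ∀ D j k v : ℕ, k + j = Nat.clog 2 D → ∀ F,
      (Prog.loop c f).mean (bitState (D, 2 ^ k, v)) F = ((2 : ℝ≥0∞) ^ j)⁻¹ *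
        ∑ u ∈ Finset.range (2 ^ j), F (bitState (D, 2 ^ Nat.clog 2 D, 2 ^ j * v + u)) := by
    intro D j
    induction j with
    | zero =>
      intro k v hk F
      have hlt : ¬ 2 ^ k < D := by rw [← Nat.lt_clog_iff_pow_lt one_lt_two]; omega
      rw [mean_loop, (hcf _).1]
      simp only [if_neg hlt, if_true]
      obtain rfl : k = Nat.clog 2 D := hk
      simp
    | succ j ih =>
      intro k v hk F
      have hlt : 2 ^ k < D := by rw [← Nat.lt_clog_iff_pow_lt one_lt_two]; omega
      rw [mean_loop, (hcf _).1]
      simp only [if_pos hlt]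
      rw [if_neg (by simp), (hcf _).2]
      simp only [← pow_succ']
      rw [ih (k + 1) _ (by omega), ih (k + 1) _ (by omega), sum_range_two_pow_succ]
      simp only [pow_succ, mul_add, mul_assoc, mul_one, add_assoc]
  have htime : ∀ D : ℕ, 0 < D → (Prog.loop c f).time (bitState (D, 1, 0)) ≤
      ((Nat.clog 2 D + 1) * K D : ℕ) := by
    intro D hD
    have hb := two_pow_clog_lt hD
    refine time_loop_le_of_states
      (ι := {q : ℕ × ℕ // q.1 ≤ Nat.clog 2 D ∧ q.2 < 2 ^ q.1})
      (s := fun q => bitState (D, 2 ^ q.1.1, q.1.2))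
      (φ := fun q => ((Nat.clog 2 D - q.1.1 + 1) * K D : ℕ)) ?_ ⟨(0, 0), by simp⟩
    rintro Φ hΦ ⟨⟨k, v⟩, hk, hv⟩
    dsimp only at hk hv ⊢
    have hk2 : 2 ^ k < 2 * D := (Nat.pow_le_pow_right two_pos hk).trans_lt hb
    have hstep := ht (D, 2 ^ k, v) hk2 (hv.trans hk2)
    rw [(hcf _).1]
    dsimp only
    by_cases hlt : 2 ^ k < D
    · have hk' := (Nat.lt_clog_iff_pow_lt one_lt_two).2 hlt
      rw [if_pos hlt, if_neg (by simp), (hcf _).2, ← add_assoc]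
      have e1 := hΦ ⟨(k + 1, 2 * v + 1), hk', by rw [pow_succ']; dsimp only; omega⟩
      have e0 := hΦ ⟨(k + 1, 2 * v), hk', by rw [pow_succ']; dsimp only; omega⟩
      dsimp only at e1 e0
      rw [pow_succ'] at e1 e0
      rw [show Nat.clog 2 D - k + 1 = 1 + (Nat.clog 2 D - (k + 1) + 1) by omega, add_mul, one_mul,
        Nat.cast_add]
      refine add_le_add hstep ?_
      calc _ ≤ 2⁻¹ * (((Nat.clog 2 D - (k + 1) + 1) * K D : ℕ) : ℝ≥0∞) +
            2⁻¹ * (((Nat.clog 2 D - (k + 1) + 1) * K D : ℕ) : ℝ≥0∞) := by gcongr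
        _ = _ := by rw [← add_mul, ENNReal.inv_two_add_inv_two, one_mul]
    · rw [if_neg hlt, if_pos rfl, add_zero]
      refine (le_add_right le_rfl).trans (hstep.trans ?_)
      exact_mod_cast Nat.le_mul_of_pos_left _ (by omega)
  let L : ℕ → ℕ := fun D => 3 * D.size + 2
  have hL : PolyBdd Nat.size L := ((PolyBdd.const 3).mul (.self _)).add (.const 2)
  refine ⟨.comp p₁ (.comp (.loop c f) p₂),
    fun D => 1 + t₁ D + (1 + (D.size + 1) * K D + P₂.eval (L D)), ?_,
    fun D hD => ⟨fun F => ?_, ?_⟩⟩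
  · exact ((PolyBdd.const 1).add ht₁).add (((PolyBdd.const 1).add
      (((PolyBdd.self _).add (.const 1)).mul hK)).add
        (PolyBdd.trans (h := fun D => P₂.eval (L D)) ⟨P₂, fun _ => le_rfl⟩ hL))
  · rw [mean_comp, (h₁ D).1, mean_comp]
    have := hloop D _ 0 0 (zero_add _) fun y => p₂.mean y F
    rw [pow_zero] at this
    rw [this]
    simp only [(h₂ _).1, mul_zero, zero_add]
  · have hb := two_pow_clog_lt hD
    have hcl : Nat.clog 2 D ≤ D.size :=
      Nat.clog_le_of_le_pow (Nat.lt_size_self D).le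
    refine (time_comp_le _ _ _).trans ?_
    push_cast
    rw [(h₁ D).1]
    have e1 : (Prog.loop c f).time (bitState (D, 1, 0)) ≤ ((D.size : ℝ≥0∞) + 1) * (K D : ℝ≥0∞) := by
      refine (htime D hD).trans ?_
      exact_mod_cast Nat.mul_le_mul_right (K D) (Nat.add_le_add_right hcl 1)
    have e2 : (Prog.loop c f).mean (bitState (D, 1, 0)) p₂.time ≤ (P₂.eval (L D) : ℕ) := by
      have := hloop D _ 0 0 (zero_add _) p₂.time
      rw [pow_zero] at this
      rw [this]
      calc _ ≤ ((2 : ℝ≥0∞) ^ Nat.clog 2 D)⁻¹ *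
            ∑ u ∈ Finset.range (2 ^ Nat.clog 2 D), ((P₂.eval (L D) : ℕ) : ℝ≥0∞) := by
            gcongr with u hu
            refine (h₂ _).2.trans (Nat.cast_le.2 ((hP₂ _).trans (eval_mono_nat P₂ ?_)))
            have hu' := Finset.mem_range.1 hu
            have := size_lt_two_mul hb
            have := size_lt_two_mul (hu'.trans hb)
            simp only [bitSize, L, mul_zero, zero_add]
            omega
        _ = _ := by
            rw [Finset.sum_const, Finset.card_range, nsmul_eq_mul, ← mul_assoc, Nat.cast_pow,
              Nat.cast_two, ENNReal.inv_mul_cancel (by positivity) (by finiteness), one_mul]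
    gcongr
    · exact (h₁ D).2
    · exact (time_comp_le _ _ _).trans (by gcongr)

/-! ### Rejection sampling -/

section Uniform

variable {X : Type} {N : X → ℕ} {e : X → Val} {D : X → ℕ}

/-- The states of the rejection loop: the environment, the bound, and the current number. -/
def rejState (e : X → Val) (D : X → ℕ) (p : X × ℕ) : Val :=
  .pair (.pair (e p.1) (.num (D p.1))) (.num p.2)

/-- A fixed point equation for the mean over accepted numbers. -/
theorem eq_of_rejection {B D : ℕ} (hD : 0 < D) (hDB : D ≤ B) {m S : ℝ≥0∞} (hm : m ≠ ⊤)
    (h : m = (B : ℝ≥0∞)⁻¹ * (S + ((B - D : ℕ) : ℝ≥0∞) * m)) : m = (D : ℝ≥0∞)⁻¹ * S := by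
  have hB : (B : ℝ≥0∞) ≠ 0 := by exact_mod_cast (hD.trans_le hDB).ne'
  have hD' : (D : ℝ≥0∞) ≠ 0 := by exact_mod_cast hD.ne'
  have h1 : (B : ℝ≥0∞) * m = S + ((B - D : ℕ) : ℝ≥0∞) * m := by
    conv_lhs => rw [h]
    rw [← mul_assoc, ENNReal.mul_inv_cancel hB (by finiteness), one_mul]
  have h2 : (D : ℝ≥0∞) * m + ((B - D : ℕ) : ℝ≥0∞) * m = S + ((B - D : ℕ) : ℝ≥0∞) * m := by
    rw [← h1, ← add_mul, ← Nat.cast_add, Nat.add_sub_cancel' hDB]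
  have h3 := (ENNReal.add_left_inj (by finiteness)).1 h2
  rw [← h3, ← mul_assoc, ENNReal.inv_mul_cancel hD' (by finiteness), one_mul]

theorem inv_mul_sum_le {n : ℕ} (hn : 0 < n) {f : ℕ → ℝ≥0∞} {b : ℝ≥0∞} (h : ∀ v < n, f v ≤ b) :
    (n : ℝ≥0∞)⁻¹ * ∑ v ∈ Finset.range n, f v ≤ b := by
  have hn' : (n : ℝ≥0∞) ≠ 0 := by exact_mod_cast hn.ne'
  calc _ ≤ (n : ℝ≥0∞)⁻¹ * ∑ v ∈ Finset.range n, b := by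
        gcongr with v hv
        exact h v (Finset.mem_range.1 hv)
    _ = b := by
        rw [Finset.sum_const, Finset.card_range, nsmul_eq_mul, ← mul_assoc,
          ENNReal.inv_mul_cancel hn' (by finiteness), one_mul]

/-- Rejection sampling: with a polynomial expected number of steps, a number below `D x` is drawn
uniformly at random and added to the environment. -/
theorem exists_uniform (he : PolyBdd N fun x => (e x).size) (hD : PolyNat N e D)
    (hpos : ∀ x, 0 < D x) : ∃ (p : Prog) (t : X → ℕ), PolyBdd N t ∧ ∀ x,
      (∀ F, p.mean (e x) F = (D x : ℝ≥0∞)⁻¹ *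
        ∑ v ∈ Finset.range (D x), F (.pair (e x) (.num (v : ℤ)))) ∧ p.time (e x) ≤ t x := by
  classical
  obtain ⟨draw, td, htd, hdraw⟩ := exists_draw_bits
  have hDs : PolyBdd N fun x => (D x).size :=
    (PolyTime.size_out hD).mono fun x => by simp [Val.size]
  -- the rejection loop as a computation in a context extended by the current number
  let M : X × ℕ → ℕ := fun p => N p.1 + p.2.size
  let s : X × ℕ → Val := rejState e D
  have hM : PolyBdd M fun p => N p.1 := (PolyBdd.self M).mono fun p => Nat.le_add_right _ _
  have lift : ∀ {g : X → ℕ}, PolyBdd N g → PolyBdd M fun p => g p.1 := fun h =>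
    (h.reindex Prod.fst).trans hM
  have hv : PolyBdd M fun p => p.2.size := (PolyBdd.self M).mono fun p => Nat.le_add_left _ _
  have hs : PolyBdd M fun p => (s p).size :=
    ((((PolyBdd.const 1).add (((PolyBdd.const 1).add (lift he)).add ((PolyBdd.const 1).add
      (lift hDs)))).add ((PolyBdd.const 1).add hv))).mono fun p => by
        simp [s, rejState, Val.size]
  have h0 : PolyTime M s s := .refl hs
  have hcond : PolyDec M s fun p => D p.1 ≤ p.2 := PolyNat.le h0.fst.snd h0.snd
  have hin : PolyTime M s fun p => .num (D p.1) := h0.fst.snd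
  have hout : PolyTime M s fun p => .pair (e p.1) (.num p.2) := h0.fst.fst.pair h0.snd
  have hdata : PolyTime M s fun p => .pair (e p.1) (.num (D p.1)) := h0.fst
  have hprep : PolyTime N e fun x => s (x, D x) :=
    PolyTime.pair (PolyTime.pair (.refl he) hD) hD
  obtain ⟨c, t₁, ⟨P₁, hP₁⟩, h₁⟩ := hcond.exists_prog
  obtain ⟨a, t₂, ⟨P₂, hP₂⟩, h₂⟩ := hin.exists_prog
  obtain ⟨o, t₃, ⟨P₃, hP₃⟩, h₃⟩ := hout.exists_prog
  obtain ⟨d, t₄, ⟨P₄, hP₄⟩, h₄⟩ := hdata.exists_prog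
  obtain ⟨pr, t₅, ht₅, h₅⟩ := hprep.exists_prog
  let f : Prog := .both d (.comp a draw)
  let b : X → ℕ := fun x => Nat.clog 2 (D x)
  have hb1 : ∀ x, D x ≤ 2 ^ b x := fun x => Nat.le_pow_clog one_lt_two _
  have hb2 : ∀ x, 2 ^ b x < 2 * D x := fun x => two_pow_clog_lt (hpos x)
  have hc : ∀ p F, c.mean (s p) F = F (.num (if D p.1 ≤ p.2 then 1 else 0)) := fun p F => by
    rw [(h₁ p).1]; dsimp only; congr
  have hf : ∀ p F, f.mean (s p) F = ((2 : ℝ≥0∞) ^ b p.1)⁻¹ *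
      ∑ u ∈ Finset.range (2 ^ b p.1), F (s (p.1, u)) := fun p F => by
    rw [mean_both, (h₄ p).1, mean_comp, (h₂ p).1, (hdraw _ (hpos _)).1]; rfl
  -- output distribution of the loop
  have hacc : ∀ x v F, v < D x → (Prog.loop c f).mean (s (x, v)) F = F (s (x, v)) := by
    intro x v F h
    rw [mean_loop, hc, if_pos (by simp [h])]
  have hloop : ∀ x F, (Prog.loop c f).mean (s (x, D x)) F =
      (D x : ℝ≥0∞)⁻¹ * ∑ v ∈ Finset.range (D x), F (s (x, v)) := by
    intro x
    refine mean_eq_of_le_one fun F hF => ?_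
    have hrej : ∀ v, D x ≤ v → (Prog.loop c f).mean (s (x, v)) F =
        ((2 : ℝ≥0∞) ^ b x)⁻¹ * ∑ u ∈ Finset.range (2 ^ b x),
          (Prog.loop c f).mean (s (x, u)) F := by
      intro v h
      rw [mean_loop, hc, if_neg (by simp [h]), hf]
    have hfin : (Prog.loop c f).mean (s (x, D x)) F ≠ ⊤ :=
      ((mean_mono hF).trans (mean_const_le _ _ 1)).trans_lt ENNReal.one_lt_top |>.ne
    refine eq_of_rejection (hpos x) (hb1 x) hfin ?_
    conv_lhs => rw [hrej _ le_rfl, ← Nat.add_sub_cancel' (hb1 x), Finset.sum_range_add]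
    rw [Nat.cast_pow, Nat.cast_two]
    congr 2
    · exact Finset.sum_congr rfl fun v hv => hacc x v F (Finset.mem_range.1 hv)
    · rw [Finset.sum_congr rfl fun v _ =>
        (hrej _ (Nat.le_add_right _ v)).trans (hrej _ le_rfl).symm]
      rw [Finset.sum_const, Finset.card_range, nsmul_eq_mul]
  -- expected step count of the loop
  let L : X → ℕ := fun x => N x + (D x).size + 1
  have hL : PolyBdd N L := ((PolyBdd.self N).add hDs).add (.const 1)
  have ePoly : ∀ P : Polynomial ℕ, PolyBdd N fun x => P.eval (L x) := fun P =>
    PolyBdd.trans (h := fun x => P.eval (L x)) ⟨P, fun _ => le_rfl⟩ hL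
  have hle : ∀ (P : Polynomial ℕ) x v, v < 2 * D x → P.eval (M (x, v)) ≤ P.eval (L x) :=
    fun P x v hv => eval_mono_nat P (by
      have := size_lt_two_mul hv
      simp only [M, L]; omega)
  let K : X → ℕ := fun x => 1 + P₁.eval (L x) +
    (1 + P₄.eval (L x) + (1 + P₂.eval (L x) + td (D x)))
  have hK : PolyBdd N K := ((PolyBdd.const 1).add (ePoly P₁)).add
    (((PolyBdd.const 1).add (ePoly P₄)).add (((PolyBdd.const 1).add (ePoly P₂)).add
      ((htd.reindex D).trans hDs)))
  have hstep : ∀ x v, v < 2 * D x → 1 + c.time (s (x, v)) + f.time (s (x, v)) ≤ K x := by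
    intro x v hv
    have e1 : c.time (s (x, v)) ≤ (P₁.eval (L x) : ℕ) :=
      (h₁ _).2.trans (Nat.cast_le.2 ((hP₁ _).trans (hle P₁ x v hv)))
    have e2 : a.time (s (x, v)) ≤ (P₂.eval (L x) : ℕ) :=
      (h₂ _).2.trans (Nat.cast_le.2 ((hP₂ _).trans (hle P₂ x v hv)))
    have e4 : d.time (s (x, v)) ≤ (P₄.eval (L x) : ℕ) :=
      (h₄ _).2.trans (Nat.cast_le.2 ((hP₄ _).trans (hle P₄ x v hv)))
    simp only [K, Nat.cast_add, Nat.cast_one]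
    gcongr
    refine (time_both_le _ _ _).trans ?_
    gcongr
    refine (time_comp_le _ _ _).trans ?_
    rw [(h₂ _).1]
    gcongr
    exact (hdraw _ (hpos x)).2
  have htime : ∀ x, (Prog.loop c f).time (s (x, D x)) ≤ (3 * K x : ℕ) := by
    intro x
    have hx := hpos x
    have h2b : ((2 : ℝ≥0∞) ^ b x)⁻¹ * 2 ^ b x = 1 :=
      ENNReal.inv_mul_cancel (by positivity) (by finiteness)
    -- a rejected number costs two more rounds in expectation, as half of the draws are accepted
    let φ : ℕ → ℕ := fun v => K x + if D x ≤ v then 2 * K x else 0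
    have hφ : φ (D x) = 3 * K x := by simp only [φ, le_refl, if_true]; ring
    rw [← hφ]
    refine time_loop_le_of_states (ι := {v : ℕ // v < 2 * D x}) (s := fun v => s (x, v))
      (φ := fun v => φ v) ?_ ⟨D x, by omega⟩
    rintro Φ hΦ ⟨v, hv⟩
    have h := hstep x v hv
    dsimp only
    rw [hc]
    dsimp only
    by_cases hvD : D x ≤ v
    · rw [if_pos hvD, if_neg (by simp), hf, ← add_assoc, show φ v = K x + 2 * K x by
        simp only [φ, if_pos hvD], Nat.cast_add]
      refine add_le_add h ?_
      have hsum : ∑ u ∈ Finset.range (2 ^ b x), φ u ≤ 2 ^ b x * (2 * K x) := by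
        have h1 : ∑ u ∈ Finset.range (2 ^ b x), φ u =
            2 ^ b x * K x + (2 ^ b x - D x) * (2 * K x) := by
          rw [Finset.sum_add_distrib, Finset.sum_const, Finset.card_range, smul_eq_mul]
          congr 1
          conv_lhs => rw [← Nat.add_sub_cancel' (hb1 x), Finset.sum_range_add]
          rw [Finset.sum_eq_zero fun u hu => if_neg (by simpa using hu), zero_add]
          simp
        rw [h1]
        have h3 : 2 * (2 ^ b x - D x) ≤ 2 ^ b x := by have := hb2 x; have := hb1 x; lia
        calc _ = 2 ^ b x * K x + 2 * (2 ^ b x - D x) * K x := by ring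
          _ ≤ 2 ^ b x * K x + 2 ^ b x * K x := by gcongr
          _ = _ := by ring
      calc _ ≤ ((2 : ℝ≥0∞) ^ b x)⁻¹ * ∑ u ∈ Finset.range (2 ^ b x), (φ u : ℝ≥0∞) := by
            gcongr with u hu
            exact hΦ ⟨u, (Finset.mem_range.1 hu).trans (hb2 x)⟩
        _ ≤ ((2 : ℝ≥0∞) ^ b x)⁻¹ * (2 ^ b x * ((2 * K x : ℕ) : ℝ≥0∞)) := by
            gcongr
            exact_mod_cast hsum
        _ = _ := by rw [← mul_assoc, h2b, one_mul]
    · rw [if_neg hvD, if_pos rfl, add_zero]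
      refine (le_add_right le_rfl).trans (h.trans ?_)
      simp [φ]
  refine ⟨.comp pr (.comp (.loop c f) o),
    fun x => 1 + t₅ x + (1 + 3 * K x + P₃.eval (L x)), ?_, fun x => ⟨fun F => ?_, ?_⟩⟩
  · exact ((PolyBdd.const 1).add ht₅).add (((PolyBdd.const 1).add ((PolyBdd.const 3).mul hK)).add
      (ePoly P₃))
  · rw [mean_comp, (h₅ x).1, mean_comp, hloop]
    simp only [(h₃ _).1]
  · refine (time_comp_le _ _ _).trans ?_
    rw [(h₅ x).1]
    have e1 := htime x
    push_cast at e1 ⊢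
    gcongr
    · exact (h₅ x).2
    refine (time_comp_le _ _ _).trans ?_
    gcongr
    rw [hloop]
    refine inv_mul_sum_le (hpos x) fun v hv => (h₃ _).2.trans (Nat.cast_le.2 ((hP₃ _).trans
      (hle P₃ x v (by omega))))

end Uniform

/-! ### Automata with states and letters as natural numbers -/

namespace OutDFA

variable {a : ℕ} {β : Type}

/-- The transition function on natural numbers, with the value `0` outside its range. -/
def stepN (A : OutDFA a β) (q x : ℕ) : ℕ :=
  if h : q < A.states ∧ x < a then A.step ⟨q, h.1⟩ ⟨x, h.2⟩ else 0

/-- The output function on natural numbers, with the value `0` outside its range. -/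
def outN (A : OutDFA a ℤ) (q : ℕ) : ℤ := if h : q < A.states then A.out ⟨q, h⟩ else 0

theorem states_pos (A : OutDFA a β) : 0 < A.states := (Nat.zero_le _).trans_lt A.start.2

theorem stepN_lt (A : OutDFA a β) (q x : ℕ) : A.stepN q x < A.states := by
  unfold stepN
  split_ifs
  · exact Fin.is_lt _
  · exact A.states_pos

theorem stepN_val (A : OutDFA a β) (q : Fin A.states) (x : Fin a) :
    A.stepN q x = A.step q x := by simp [stepN]

theorem outN_val (A : OutDFA a ℤ) (q : Fin A.states) : A.outN q = A.out q := by simp [outN]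

end OutDFA

section PolyDFA

variable {X : Type} {N : X → ℕ} {e : X → Val} {a : X → ℕ} {A : ∀ x, OutDFA (a x) ℤ}

theorem OutDFA.polySmall_states (hA : PolyTime N e fun x => (A x).encode .num) :
    PolySmall N e fun x => (A x).states := by
  have := PolySmall.length (PolyTime.snd hA)
  simpa using this

theorem OutDFA.polySmall_start (hA : PolyTime N e fun x => (A x).encode .num) :
    PolySmall N e fun x => ((A x).start : ℕ) :=
  ⟨PolyTime.fst hA, (OutDFA.polySmall_states hA).bdd.mono fun x => (A x).start.2.le⟩

theorem OutDFA.polySmall_stepN (hA : PolyTime N e fun x => (A x).encode .num) {q y : X → ℕ}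
    (hq : PolySmall N e q) (hy : PolySmall N e y) :
    PolySmall N e fun x => (A x).stepN (q x) (y x) := by
  refine ⟨PolyTime.congr (((((PolyTime.snd hA).nth hq).op .second).nth hy)) fun x => ?_,
    (OutDFA.polySmall_states hA).bdd.mono fun x => ((A x).stepN_lt _ _).le⟩
  dsimp only
  rw [Val.nth_family, OutDFA.stepN]
  by_cases h : q x < (A x).states
  · rw [dif_pos h]
    simp only [Op.eval]
    rw [Val.nth_family]
    by_cases h' : y x < a x <;> simp [h, h', Val.nat]
  · simp [h, Op.eval, Val.nth_num_zero]

theorem OutDFA.polyInt_outN (hA : PolyTime N e fun x => (A x).encode .num) {q : X → ℕ}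
    (hq : PolySmall N e q) : PolyInt N e fun x => (A x).outN (q x) := by
  refine PolyTime.congr (((PolyTime.snd hA).nth hq).op .first) fun x => ?_
  dsimp only
  rw [Val.nth_family]
  unfold OutDFA.outN
  split_ifs <;> simp [Op.eval]

end PolyDFA

theorem Val.size_nth_le (v : Val) (i : ℕ) : (v.nth i).size ≤ v.size := by
  have h1 : (Op.second.eval^[i] v).size ≤ v.size := by
    induction i with
    | zero => simp
    | succ i ih =>
      rw [Function.iterate_succ_apply']
      exact (Val.size_second_le _).trans ih
  refine le_trans ?_ h1
  rw [Val.nth]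
  cases Op.second.eval^[i] v with
  | num z => simp [Op.eval, Val.size]
  | pair a b => simp only [Op.eval, Val.size]; omega

namespace AccInstance

/-! ### The automata of an instance and their product -/

open Classical in
/-- The hard specification as an automaton with the output `1` on accepting states. -/
noncomputable def hardA (C : AccInstance) : OutDFA C.letters ℤ where
  states := C.hardStates
  step := C.hard.step
  start := C.hard.start
  out q := if q ∈ C.hard.accept then 1 else 0

/-- The label automaton with integer outputs. -/
def labelA (C : AccInstance) : OutDFA C.letters ℤ where
  states := C.label.states
  step := C.label.step
  start := C.label.start
  out q := (C.label.out q : ℕ)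

/-- States of the product of the three automata. -/
abbrev St : Type := ℕ × ℕ × ℕ

/-- The transition function of the product automaton. -/
noncomputable def next (C : AccInstance) (s : St) (x : ℕ) : St :=
  (C.hardA.stepN s.1 x, C.labelA.stepN s.2.1 x, C.cost.stepN s.2.2 x)

/-- The start state of the product automaton. -/
noncomputable def init (C : AccInstance) : St := (C.hardA.start, C.labelA.start, C.cost.start)

/-- The cost of a state of the product automaton. -/
def stCost (C : AccInstance) (s : St) : ℤ := C.cost.outN s.2.2

/-- An upper bound on the absolute values of state costs. -/
def costBound (C : AccInstance) : ℕ := ∑ q ∈ Finset.range C.cost.states, (C.cost.outN q).natAbs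

/-- An upper bound on the absolute values of the costs of improvisations. -/
def bound (C : AccInstance) : ℕ := (C.params.n + 1) * C.costBound

/-- Word costs are shifted by `bound`; this is the number of possible shifted costs. -/
def width (C : AccInstance) : ℕ := 2 * C.bound + 1

/-- Valid states and shifted costs. -/
def InRange (C : AccInstance) (s : St) (k : ℤ) : Prop :=
  (s.1 < C.hardA.states ∧ s.2.1 < C.labelA.states ∧ s.2.2 < C.cost.states) ∧ 0 ≤ k ∧ k < C.width

open Classical in
/-- Is the empty word a valid continuation with shifted cost `k` and label `i` from the state `s`,
if `l` more letters are allowed? -/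
noncomputable def emptyCount (C : AccInstance) (i l : ℕ) (s : St) (k : ℤ) : ℕ :=
  if C.params.m + l ≤ C.params.n ∧ C.hardA.outN s.1 = 1 ∧ C.labelA.outN s.2.1 = i ∧
    k = C.stCost s + C.bound then 1 else 0

open Classical in
/-- The number of continuations with shifted cost `k` and label `i` from the state `s`, if `l` more
letters are allowed. -/
noncomputable def cnt (C : AccInstance) (i : ℕ) : ℕ → St → ℤ → ℕ
  | 0, s, k => if C.InRange s k then C.emptyCount i 0 s k else 0
  | l + 1, s, k => if C.InRange s k then
      C.emptyCount i (l + 1) s k +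
        ∑ x ∈ Finset.range C.letters, cnt C i l (C.next s x) (k - C.stCost s)
    else 0

/-- The values `cnt` at all valid states and shifted costs. -/
noncomputable def table (C : AccInstance) (i l : ℕ) : Val :=
  .fam C.hardA.states fun a => .fam C.labelA.states fun b => .fam C.cost.states fun c =>
    .fam C.width fun k => .num (C.cnt i l (a, b, c) k)

theorem cnt_of_not_inRange {C : AccInstance} {i l : ℕ} {s : St} {k : ℤ} (h : ¬ C.InRange s k) :
    C.cnt i l s k = 0 := by
  cases l <;> simp [cnt, h]

theorem nth_table (C : AccInstance) (i l : ℕ) (s : St) (k : ℕ) :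
    ((((C.table i l).nth s.1).nth s.2.1).nth s.2.2).nth k = .num (C.cnt i l s k) := by
  rw [table, Val.nth_fam]
  by_cases h1 : s.1 < C.hardA.states
  · rw [if_pos h1, Val.nth_fam]
    by_cases h2 : s.2.1 < C.labelA.states
    · rw [if_pos h2, Val.nth_fam]
      by_cases h3 : s.2.2 < C.cost.states
      · rw [if_pos h3, Val.nth_fam]
        by_cases h4 : k < C.width
        · rw [if_pos h4]
        · rw [if_neg h4, cnt_of_not_inRange fun h => h4 (by exact_mod_cast h.2.2)]; rfl
      · rw [if_neg h3, cnt_of_not_inRange fun h => h3 h.1.2.2, Val.nth_num_zero]; rfl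
    · rw [if_neg h2, cnt_of_not_inRange fun h => h2 h.1.2.1, Val.nth_num_zero, Val.nth_num_zero]
      rfl
  · rw [if_neg h1, cnt_of_not_inRange fun h => h1 h.1.1, Val.nth_num_zero, Val.nth_num_zero,
      Val.nth_num_zero]
    rfl

theorem emptyCount_le_one (C : AccInstance) (i l : ℕ) (s : St) (k : ℤ) :
    C.emptyCount i l s k ≤ 1 := by
  unfold emptyCount; split_ifs <;> simp

theorem cnt_le (C : AccInstance) (i l : ℕ) (s : St) (k : ℤ) :
    C.cnt i l s k ≤ (C.letters + 1) ^ l := by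
  induction l generalizing s k with
  | zero =>
    rw [cnt]
    split_ifs
    · simpa using C.emptyCount_le_one i 0 s k
    · simp
  | succ l ih =>
    rw [cnt]
    split_ifs
    · have h1 := C.emptyCount_le_one i (l + 1) s k
      have h2 : ∑ x ∈ Finset.range C.letters, C.cnt i l (C.next s x) (k - C.stCost s) ≤
          C.letters * (C.letters + 1) ^ l := by
        refine (Finset.sum_le_sum fun x _ => ih _ _).trans ?_
        simp
      have h3 : 1 ≤ (C.letters + 1) ^ l := Nat.one_le_pow _ _ (by omega)
      rw [pow_succ]
      nlinarith
    · simp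

/-! ### Access to the parts of an instance -/

/-- Polynomial-time access to an instance. -/
structure Poly {X : Type} (N : X → ℕ) (e : X → Val) (C : X → AccInstance) : Prop where
  text : PolyTime N e fun x => (C x).encode
  bdd : PolyBdd N fun x => (C x).pseudoSize

/-- Polynomial-time computable states of the product automaton. -/
structure PolySt {X : Type} (N : X → ℕ) (e : X → Val) (s : X → St) : Prop where
  hard : PolySmall N e fun x => (s x).1
  label : PolySmall N e fun x => (s x).2.1
  cost : PolySmall N e fun x => (s x).2.2

section Poly

variable {X : Type} {N : X → ℕ} {e v : X → Val} {C : X → AccInstance} {s : X → St}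
  {i l : X → ℕ} {k : X → ℤ}

theorem Poly.wk (h : Poly N e C) : Poly (extN N) (extE e) fun p => C p.1 :=
  ⟨h.text.wk, h.bdd.wk⟩
theorem Poly.push (h : Poly N e C) (hv : PolyBdd N fun x => (v x).size) :
    Poly N (fun x => .pair (e x) (v x)) C := ⟨h.text.push hv, h.bdd⟩
theorem PolySt.wk (h : PolySt N e s) : PolySt (extN N) (extE e) fun p => s p.1 :=
  ⟨h.hard.wk, h.label.wk, h.cost.wk⟩

theorem Poly.size_env (h : Poly N e C) : PolyBdd N fun x => (e x).size := h.text.size_env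

theorem Poly.nth (h : Poly N e C) (i : ℕ) : PolyTime N e fun x => (C x).encode.nth i :=
  h.text.nth (.const h.size_env i)

theorem Poly.costA (h : Poly N e C) : PolyTime N e fun x => (C x).cost.encode .num := h.nth 11

theorem Poly.labelA (h : Poly N e C) : PolyTime N e fun x => (C x).labelA.encode .num := h.nth 10

theorem Poly.hardA (h : Poly N e C) : PolyTime N e fun x => (C x).hardA.encode .num := h.nth 9

/-- Numbers bounded by the length of the text may count iterations. -/
theorem Poly.small_of_le (h : Poly N e C) {f : X → ℕ} (hf : PolyNat N e f)
    (hle : ∀ x, f x ≤ (C x).encode.size) : PolySmall N e f :=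
  ⟨hf, h.bdd.mono fun x => (hle x).trans (Nat.le_add_right _ _)⟩

theorem Poly.letters (h : Poly N e C) : PolySmall N e fun x => (C x).letters := by
  refine h.small_of_le (h.nth 0) fun x => ?_
  have h1 := (C x).encode.size_nth_le 11
  have h2 : (C x).encode.nth 11 = (C x).cost.encode .num := rfl
  rw [h2, OutDFA.encode, Val.size] at h1
  have h3 := Val.size_nth_le (.family fun q => .pair (.num ((C x).cost.out q))
    (.family fun y => .nat ((C x).cost.step q y))) (C x).cost.start
  rw [Val.nth_family, dif_pos (C x).cost.start.2, Val.size] at h3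
  have h4 := Val.length_le_size_list (List.ofFn fun y => .nat ((C x).cost.step (C x).cost.start y))
  rw [List.length_ofFn] at h4
  unfold Val.family at h3 h1
  simp only [Fin.eta] at h3
  omega

theorem Poly.labels (h : Poly N e C) : PolySmall N e fun x => (C x).labels := by
  refine h.small_of_le (h.nth 1) fun x => ?_
  have h1 := (C x).encode.size_nth_le 7
  have h2 : (C x).encode.nth 7 = .family fun i => .rat ((C x).params.alpha i) := rfl
  rw [h2] at h1
  have h4 := Val.length_le_size_list (List.ofFn fun i => .rat ((C x).params.alpha i))
  rw [List.length_ofFn] at h4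
  exact h4.trans h1

theorem Poly.m (h : Poly N e C) : PolySmall N e fun x => (C x).params.m := by
  have : PolyTime N e fun x => .list (List.replicate (C x).params.m (.num 0)) := h.nth 2
  simpa using PolySmall.length this

theorem Poly.n (h : Poly N e C) : PolySmall N e fun x => (C x).params.n := by
  have : PolyTime N e fun x => .list (List.replicate (C x).params.n (.num 0)) := h.nth 3
  simpa using PolySmall.length this

theorem Poly.init (h : Poly N e C) : PolySt N e fun x => (C x).init :=
  ⟨OutDFA.polySmall_start h.hardA, OutDFA.polySmall_start h.labelA, OutDFA.polySmall_start h.costA⟩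

theorem Poly.next (h : Poly N e C) (hs : PolySt N e s) {y : X → ℕ} (hy : PolySmall N e y) :
    PolySt N e fun x => (C x).next (s x) (y x) :=
  ⟨OutDFA.polySmall_stepN h.hardA hs.hard hy, OutDFA.polySmall_stepN h.labelA hs.label hy,
    OutDFA.polySmall_stepN h.costA hs.cost hy⟩

theorem Poly.stCost (h : Poly N e C) (hs : PolySt N e s) :
    PolyInt N e fun x => (C x).stCost (s x) := OutDFA.polyInt_outN h.costA hs.cost

theorem natAbs_outN_le (C : AccInstance) (q : ℕ) : (C.cost.outN q).natAbs ≤ C.maxCost := by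
  unfold OutDFA.outN maxCost
  split_ifs with h
  · exact Finset.le_sup (f := fun q => (C.cost.out q).natAbs) (Finset.mem_univ (⟨q, h⟩ : Fin _))
  · simp

theorem natAbs_outN_le_costBound (C : AccInstance) (q : ℕ) :
    (C.cost.outN q).natAbs ≤ C.costBound := by
  by_cases h : q < C.cost.states
  · exact Finset.single_le_sum (f := fun q => (C.cost.outN q).natAbs) (fun _ _ => Nat.zero_le _)
      (Finset.mem_range.2 h)
  · simp [OutDFA.outN, h]

theorem Poly.costBound (h : Poly N e C) : PolySmall N e fun x => (C x).costBound := by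
  have h1 : PolySmall (extN N) (extE e) fun p => ((C p.1).cost.outN p.2).natAbs :=
    ⟨PolyInt.natAbs (OutDFA.polyInt_outN h.wk.costA (.var h.size_env)),
      h.bdd.wk.mono fun p => (natAbs_outN_le _ _).trans (Nat.le_add_left _ _)⟩
  exact PolySmall.sum (OutDFA.polySmall_states h.costA) h1

theorem Poly.bound (h : Poly N e C) : PolySmall N e fun x => (C x).bound :=
  (h.n.add (.const h.size_env 1)).mul h.costBound

theorem Poly.width (h : Poly N e C) : PolySmall N e fun x => (C x).width :=
  ((PolySmall.const h.size_env 2).mul h.bound).add (.const h.size_env 1)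

theorem Poly.inRange (h : Poly N e C) (hs : PolySt N e s) (hk : PolyInt N e k) :
    PolyDec N e fun x => (C x).InRange (s x) (k x) :=
  ((hs.hard.nat.lt (OutDFA.polySmall_states h.hardA).nat).and
    ((hs.label.nat.lt (OutDFA.polySmall_states h.labelA).nat).and
      (hs.cost.nat.lt (OutDFA.polySmall_states h.costA).nat))).and
    (((PolyInt.const h.size_env 0).le hk).and (hk.lt h.width.nat.int))

theorem Poly.emptyCount (h : Poly N e C) (hi : PolyNat N e i) (hl : PolyNat N e l)
    (hs : PolySt N e s) (hk : PolyInt N e k) :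
    PolyNat N e fun x => (C x).emptyCount (i x) (l x) (s x) (k x) :=
  PolyNat.ite (((h.m.nat.add hl).le h.n.nat).and (((OutDFA.polyInt_outN h.hardA hs.hard).eq
    (.const h.size_env 1)).and (((OutDFA.polyInt_outN h.labelA hs.label).eq hi.int).and
      (hk.eq ((h.stCost hs).add h.bound.nat.int))))) (.const h.size_env 1) (.const h.size_env 0)

/-! ### Counting words by dynamic programming -/

/-- Values of `cnt` are looked up in the table. -/
theorem PolySt.lookup (ht : PolyTime N e fun x => (C x).table (i x) (l x))
    (hw : PolySmall N e fun x => (C x).width) (hs : PolySt N e s) (hk : PolyInt N e k) :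
    PolyNat N e fun x => (C x).cnt (i x) (l x) (s x) (k x) := by
  classical
  have h0 := PolyInt.const hk.size_env 0
  have hc : PolyDec N e fun x => 0 ≤ k x ∧ k x < (C x).width :=
    (h0.le hk).and (hk.lt hw.nat.int)
  have hsm : PolySmall N e fun x => if 0 ≤ k x ∧ k x < (C x).width then (k x).toNat else 0 := by
    refine ⟨PolyNat.ite hc hk.toNat (.const hk.size_env 0), hw.bdd.mono fun x => ?_⟩
    split_ifs <;> omega
  have hn : PolyNat N e fun x => (C x).cnt (i x) (l x) (s x)
      (if 0 ≤ k x ∧ k x < (C x).width then (k x).toNat else 0 : ℕ) :=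
    PolyTime.congr ((((ht.nth hs.hard).nth hs.label).nth hs.cost).nth hsm)
      fun x => nth_table _ _ _ _ _
  refine (PolyNat.ite hc hn (.const hk.size_env 0)).congr fun x => ?_
  by_cases h : 0 ≤ k x ∧ k x < (C x).width
  · simp [h]
  · rw [if_neg h]
    exact (cnt_of_not_inRange fun h' => h h'.2).symm

/-- A table whose entries are polynomial-time computable. -/
theorem Poly.fam_entries (h : Poly N e C) {f : X → St → ℤ → ℕ}
    (hf : PolyNat (extN (extN (extN (extN N)))) (extE (extE (extE (extE e))))
      fun p => f p.1.1.1.1 (p.1.1.1.2, p.1.1.2, p.1.2) p.2) :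
    PolyTime N e fun x => .fam (C x).hardA.states fun a => .fam (C x).labelA.states fun b =>
      .fam (C x).cost.states fun c => .fam (C x).width fun k => .num (f x (a, b, c) k) := by
  refine .fam (OutDFA.polySmall_states h.hardA) ?_
  refine .fam (OutDFA.polySmall_states h.wk.labelA) ?_
  refine .fam (OutDFA.polySmall_states h.wk.wk.costA) ?_
  exact .fam h.wk.wk.wk.width hf

/-- The table is built by dynamic programming, one round for each value of `l`. -/
theorem Poly.table (h : Poly N e C) (hi : PolyNat N e i) (hl : PolySmall N e l) :
    PolyTime N e fun x => (C x).table (i x) (l x) := by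
  classical
  have hvar : ∀ {Y : Type} {M : Y → ℕ} {d : Y → Val} {D : Y → AccInstance}, Poly M d D →
      PolySt (extN (extN (extN (extN M)))) (extE (extE (extE (extE d))))
        fun p => (p.1.1.1.2, p.1.1.2, p.1.2) := fun h =>
    ⟨(PolySmall.var h.size_env).wk.wk.wk, (PolySmall.var h.wk.size_env).wk.wk,
      (PolySmall.var h.wk.wk.size_env).wk⟩
  have hb : PolyBdd (extN N) fun p => ((C p.1).table (i p.1) p.2).size := by
    have h1 : PolyBdd (extN N) fun p => 1 + p.2 * (C p.1).letters + p.2 :=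
      ((PolyBdd.const 1).add ((PolyBdd.var N).mul h.letters.bdd.wk)).add (PolyBdd.var N)
    have h2 : ∀ (C : AccInstance) (i l : ℕ) (s : St) (k : ℤ),
        (Val.num (C.cnt i l s k)).size ≤ 1 + (1 + l * C.letters + l) := by
      intro C i l s k
      simp only [Val.size, Int.natAbs_natCast]
      refine Nat.add_le_add_left ((Nat.size_le_size (C.cnt_le i l s k)).trans ?_) 1
      rw [Nat.size_le, pow_add, pow_add, pow_mul']
      have h3 : (C.letters + 1) ^ l ≤ (2 ^ C.letters) ^ l :=
        Nat.pow_le_pow_left Nat.lt_two_pow_self l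
      have h4 : 1 ≤ 2 ^ l := Nat.one_le_two_pow
      have h5 : 1 ≤ (C.letters + 1) ^ l := Nat.one_le_pow _ _ (by omega)
      nlinarith
    have hk := (PolyBdd.const 1).add
      (h.width.bdd.wk.mul ((((PolyBdd.const 1).add h1)).add (.const 1)))
    have hcs := (PolyBdd.const 1).add
      ((OutDFA.polySmall_states h.costA).bdd.wk.mul (hk.add (.const 1)))
    have hls := (PolyBdd.const 1).add
      ((OutDFA.polySmall_states h.labelA).bdd.wk.mul (hcs.add (.const 1)))
    refine ((PolyBdd.const 1).add
      ((OutDFA.polySmall_states h.hardA).bdd.wk.mul (hls.add (.const 1)))).mono fun p => ?_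
    exact Val.size_fam_le fun a _ => Val.size_fam_le fun b _ => Val.size_fam_le fun c _ =>
      Val.size_fam_le fun k _ => h2 _ _ _ _ _
  refine PolyTime.iter (s := fun x l => (C x).table (i x) l) hl.nat hl.bdd ?_ hb ?_
  · refine h.fam_entries (f := fun x s k => (C x).cnt (i x) 0 s k) ?_
    have hC := h.wk.wk.wk.wk
    have hk := PolySmall.var h.wk.wk.wk.size_env
    exact PolyNat.ite (hC.inRange (hvar h) hk.nat.int)
      (hC.emptyCount hi.wk.wk.wk.wk (.const hC.size_env 0) (hvar h) hk.nat.int)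
      (.const hC.size_env 0)
  · have hp := h.wk.push hb
    refine hp.fam_entries (f := fun p s k => (C p.1).cnt (i p.1) (p.2 + 1) s k) ?_
    have hC := hp.wk.wk.wk.wk
    have hs := hvar hp
    have hk := PolySmall.var hp.wk.wk.wk.size_env
    have hi' := (hi.wk.push hb).wk.wk.wk.wk
    have hl' := ((PolySmall.var h.size_env).push hb).wk.wk.wk.wk
    have ht : PolyTime (extN N) (fun p => .pair (extE e p) ((C p.1).table (i p.1) p.2))
        fun p => (C p.1).table (i p.1) p.2 := PolyTime.top h.wk.size_env hb
    refine PolyNat.ite (hC.inRange hs hk.nat.int) ((hC.emptyCount hi' (hl'.nat.add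
      (.const hC.size_env 1)) hs hk.nat.int).add (PolyNat.sum hC.letters ?_)) (.const hC.size_env 0)
    exact PolySt.lookup ht.wk.wk.wk.wk.wk hC.wk.width
      (hC.wk.next hs.wk (PolySmall.var hC.size_env))
      (hk.nat.int.wk.sub (hC.wk.stCost hs.wk))

theorem Poly.cnt (h : Poly N e C) (hi : PolyNat N e i) (hl : PolySmall N e l) (hs : PolySt N e s)
    (hk : PolyInt N e k) : PolyNat N e fun x => (C x).cnt (i x) (l x) (s x) (k x) :=
  PolySt.lookup (h.table hi hl) h.width hs hk

end Poly
end AccInstance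

/-! ### Selection of a block by cumulative sums -/

open Classical in
/-- The index of the block that contains position `r`, if block `y < a` ends before position
`cum (y + 1)`. -/
noncomputable def blockOf (cum : ℕ → ℕ) (a : ℕ) (r : ℤ) : ℕ :=
  ∑ y ∈ Finset.range a, if (cum (y + 1) : ℤ) ≤ r then 1 else 0

theorem blockOf_le (cum : ℕ → ℕ) (a : ℕ) (r : ℤ) : blockOf cum a r ≤ a := by
  classical
  calc _ ≤ ∑ y ∈ Finset.range a, 1 := Finset.sum_le_sum fun y _ => by split_ifs <;> simp
    _ = a := by simp

theorem blockOf_eq {cum : ℕ → ℕ} (hc : Monotone cum) {a x : ℕ} {r : ℤ} (hx : x ≤ a)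
    (h1 : (cum x : ℤ) ≤ r ∨ x = 0) (h2 : x < a → r < cum (x + 1)) : blockOf cum a r = x := by
  classical
  have : ∀ y ∈ Finset.range a, (if (cum (y + 1) : ℤ) ≤ r then 1 else 0) =
      if y < x then 1 else 0 := by
    intro y hy
    refine if_congr ⟨fun h => ?_, fun h => ?_⟩ rfl rfl
    · by_contra hxy
      have h3 := h2 (by simp at hy; omega)
      have h4 := hc (show x + 1 ≤ y + 1 by omega)
      omega
    · have h4 := hc (show y + 1 ≤ x by omega)
      rcases h1 with h1 | h1 <;> omega
  rw [blockOf, Finset.sum_congr rfl this, ← Finset.sum_filter, Finset.sum_const, smul_eq_mul,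
    mul_one]
  have : (Finset.range a).filter (· < x) = Finset.range x := by
    ext y; simp; omega
  rw [this, Finset.card_range]

theorem exists_block (cum : ℕ → ℕ) (h0 : cum 0 = 0) (a : ℕ) {r : ℤ} (hr : 0 ≤ r) :
    ∃ x ≤ a, (cum x : ℤ) ≤ r ∧ (x < a → r < cum (x + 1)) := by
  classical
  let P : ℕ → Prop := fun x => (cum x : ℤ) ≤ r
  have hP : P 0 := by simp [P, h0, hr]
  induction a with
  | zero => exact ⟨0, le_rfl, hP, by simp⟩
  | succ a ih =>
    obtain ⟨x, hx, h1, h2⟩ := ih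
    rcases hx.lt_or_eq with hxa | rfl
    · exact ⟨x, by omega, h1, fun _ => h2 hxa⟩
    · by_cases h : (cum (x + 1) : ℤ) ≤ r
      · exact ⟨x + 1, le_rfl, h, by omega⟩
      · exact ⟨x, by omega, h1, fun _ => by omega⟩

theorem blockOf_spec {cum : ℕ → ℕ} (hc : Monotone cum) (h0 : cum 0 = 0) (a : ℕ) {r : ℤ}
    (hr : 0 ≤ r) : (cum (blockOf cum a r) : ℤ) ≤ r ∧
      (r < cum a → blockOf cum a r < a ∧ r < cum (blockOf cum a r + 1)) := by
  obtain ⟨x, hx, h1, h2⟩ := exists_block cum h0 a hr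
  rw [blockOf_eq hc hx (Or.inl h1) h2]
  refine ⟨h1, fun h => ?_⟩
  rcases hx.lt_or_eq with hxa | rfl
  · exact ⟨hxa, h2 hxa⟩
  · omega

theorem PolySmall.blockOf {X : Type} {N : X → ℕ} {e : X → Val} {cum : X → ℕ → ℕ} {a : X → ℕ}
    {r : X → ℤ} (ha : PolySmall N e a) (hr : PolyInt N e r)
    (hc : PolyNat (extN N) (extE e) fun p => cum p.1 (p.2 + 1)) :
    PolySmall N e fun x => LQCI.blockOf (cum x) (a x) (r x) := by
  classical
  exact ⟨PolyNat.sum ha (PolyNat.ite (hc.int.le hr.wk) (.const hc.size_env 1)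
    (.const hc.size_env 0)), ha.bdd.mono fun x => blockOf_le _ _ _⟩

namespace AccInstance

/-! ### The word at a given position of the list of continuations -/

/-- The number of continuations of positive length whose first letter is below `y`, if at most
`l + 1` more letters are allowed. -/
noncomputable def cum (C : AccInstance) (i l : ℕ) (s : St) (k : ℤ) (y : ℕ) : ℕ :=
  ∑ x ∈ Finset.range y, C.cnt i l (C.next s x) (k - C.stCost s)

/-- The first letter of the continuation at position `r`, not counting the empty one, if `l + 1`
more letters are allowed. -/
noncomputable def pick (C : AccInstance) (i l : ℕ) (s : St) (k r : ℤ) : ℕ :=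
  blockOf (C.cum i l s k) C.letters r

/-- A position in a list of continuations: a state, a shifted cost, and an index. The index `-1`
marks the end of the word. -/
abbrev Pos : Type := St × ℤ × ℤ

open Classical in
/-- The position after the first letter of the continuation. -/
noncomputable def advance (C : AccInstance) (i l : ℕ) (w : Pos) : Pos :=
  if w.2.2 < C.emptyCount i l w.1 w.2.1 then (w.1, w.2.1, -1) else
    let r := w.2.2 - C.emptyCount i l w.1 w.2.1
    let x := C.pick i (l - 1) w.1 w.2.1 r
    (C.next w.1 x, w.2.1 - C.stCost w.1, r - C.cum i (l - 1) w.1 w.2.1 x)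

/-- The position after `j` letters. -/
noncomputable def walk (C : AccInstance) (i l : ℕ) (w : Pos) : ℕ → Pos
  | 0 => w
  | j + 1 => C.advance i (l - j) (C.walk i l w j)

/-- The letter that follows the first `j` letters. -/
noncomputable def letter (C : AccInstance) (i l : ℕ) (w : Pos) (j : ℕ) : ℕ :=
  let u := C.walk i l w j
  C.pick i (l - j - 1) u.1 u.2.1 (u.2.2 - C.emptyCount i (l - j) u.1 u.2.1)

open Classical in
/-- The length of the continuation at a position. -/
noncomputable def walkLen (C : AccInstance) (i l : ℕ) (w : Pos) : ℕ :=
  ∑ j ∈ Finset.range l, if 0 ≤ (C.walk i l w (j + 1)).2.2 then 1 else 0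

theorem cum_mono (C : AccInstance) (i l : ℕ) (s : St) (k : ℤ) : Monotone (C.cum i l s k) :=
  fun _ _ h => Finset.sum_le_sum_of_subset (Finset.range_subset_range.2 h)

theorem cum_zero (C : AccInstance) (i l : ℕ) (s : St) (k : ℤ) : C.cum i l s k 0 = 0 := by
  simp [cum]

section Poly

variable {X : Type} {N : X → ℕ} {e v : X → Val} {C : X → AccInstance} {s : X → St}
  {i l y : X → ℕ} {k r : X → ℤ} {w : X → Pos}

/-- Polynomial-time computable positions. -/
structure PolyPos (N : X → ℕ) (e : X → Val) (w : X → Pos) : Prop where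
  st : PolySt N e fun x => (w x).1
  cost : PolyInt N e fun x => (w x).2.1
  idx : PolyInt N e fun x => (w x).2.2

theorem PolyPos.wk (h : PolyPos N e w) : PolyPos (extN N) (extE e) fun p => w p.1 :=
  ⟨h.st.wk, h.cost.wk, h.idx.wk⟩

theorem Poly.cum (h : Poly N e C) (hi : PolyNat N e i) (hl : PolySmall N e l) (hs : PolySt N e s)
    (hk : PolyInt N e k) (hy : PolySmall N e y) :
    PolyNat N e fun x => (C x).cum (i x) (l x) (s x) (k x) (y x) :=
  PolyNat.sum hy (h.wk.cnt hi.wk hl.wk (h.wk.next hs.wk (.var h.size_env))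
    (hk.wk.sub (h.wk.stCost hs.wk)))

theorem Poly.pick (h : Poly N e C) (hi : PolyNat N e i) (hl : PolySmall N e l) (hs : PolySt N e s)
    (hk : PolyInt N e k) (hr : PolyInt N e r) :
    PolySmall N e fun x => (C x).pick (i x) (l x) (s x) (k x) (r x) :=
  PolySmall.blockOf h.letters hr (h.wk.cum hi.wk hl.wk hs.wk hk.wk
    ((PolySmall.var h.size_env).add (.const h.wk.size_env 1)))

/-- A position as a value. -/
def encPos (w : Pos) : Val :=
  .pair (.pair (.num w.1.1) (.pair (.num w.1.2.1) (.num w.1.2.2))) (.pair (.num w.2.1) (.num w.2.2))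

theorem PolyPos.enc (h : PolyPos N e w) : PolyTime N e fun x => encPos (w x) :=
  (PolyTime.pair h.st.hard.nat (PolyTime.pair h.st.label.nat h.st.cost.nat)).pair
    (PolyTime.pair h.cost h.idx)

theorem Poly.advance (h : Poly N e C) (hi : PolyNat N e i) (hl : PolySmall N e l)
    (hw : PolyPos N e w) : PolyTime N e fun x => encPos ((C x).advance (i x) (l x) (w x)) := by
  have hst := (h.emptyCount hi hl.nat hw.st hw.cost).int
  have hr := hw.idx.sub hst
  have hl1 := hl.sub (PolySmall.const h.size_env 1)
  have hx := h.pick hi hl1 hw.st hw.cost hr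
  refine ((hw.idx.lt hst).ite
    (PolyPos.enc (w := fun x => ((w x).1, (w x).2.1, -1))
      ⟨hw.st, hw.cost, .const h.size_env (-1)⟩)
    (PolyPos.enc (w := fun x => (_, _, _)) ⟨h.next hw.st hx, hw.cost.sub (h.stCost hw.st),
      hr.sub (h.cum hi hl1 hw.st hw.cost hx).int⟩)).congr fun x => ?_
  unfold AccInstance.advance
  split_ifs <;> rfl

theorem natAbs_walk_le (C : AccInstance) (i l : ℕ) (w : Pos) (j : ℕ) :
    (C.walk i l w j).1.1 ≤ w.1.1 + C.hardA.states ∧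
    (C.walk i l w j).1.2.1 ≤ w.1.2.1 + C.labelA.states ∧
    (C.walk i l w j).1.2.2 ≤ w.1.2.2 + C.cost.states ∧
    (C.walk i l w j).2.1.natAbs ≤ w.2.1.natAbs + j * C.costBound ∧
    (C.walk i l w j).2.2.natAbs ≤ w.2.2.natAbs + 1 := by
  induction j with
  | zero => simp [walk]
  | succ j ih =>
    obtain ⟨h1, h2, h3, h4, h5⟩ := ih
    rw [walk, AccInstance.advance]
    have h6 := natAbs_outN_le_costBound C (C.walk i l w j).1.2.2
    split_ifs with h
    · refine ⟨h1, h2, h3, ?_, by simp⟩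
      rw [Nat.succ_mul]
      dsimp only
      omega
    · refine ⟨(C.hardA.stepN_lt _ _).le.trans (Nat.le_add_left _ _),
        (C.labelA.stepN_lt _ _).le.trans (Nat.le_add_left _ _),
        (C.cost.stepN_lt _ _).le.trans (Nat.le_add_left _ _), ?_, ?_⟩
      · rw [Nat.succ_mul]
        dsimp only [AccInstance.stCost]
        omega
      · have h7 := (blockOf_spec (C.cum_mono i (l - j - 1) (C.walk i l w j).1
          (C.walk i l w j).2.1) (C.cum_zero ..) C.letters (sub_nonneg.2 (not_lt.1 h))).1
        dsimp only [AccInstance.pick]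
        omega

theorem natSize_le_of_natAbs_le {z : ℤ} {a b : ℕ} (h : z.natAbs ≤ a + b) :
    z.natAbs.size ≤ a.size + b + 1 :=
  ((Nat.size_le_size h).trans (natSize_add_le _ _)).trans (by
    have := natSize_le_self b; omega)

theorem Poly.walk (h : Poly N e C) (hi : PolyNat N e i) (hl : PolySmall N e l)
    (hw : PolyPos N e w) (hy : PolySmall N e y) :
    PolyPos N e fun x => (C x).walk (i x) (l x) (w x) (y x) := by
  have hb : PolyBdd (extN N) fun p => (encPos ((C p.1).walk (i p.1) (l p.1) (w p.1) p.2)).size := by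
    have b1 := (hw.st.hard.add (OutDFA.polySmall_states h.hardA)).bdd.wk
    have b2 := (hw.st.label.add (OutDFA.polySmall_states h.labelA)).bdd.wk
    have b3 := (hw.st.cost.add (OutDFA.polySmall_states h.costA)).bdd.wk
    have b4 : PolyBdd (extN N) fun p => (Val.num (w p.1).2.1).size + p.2 * (C p.1).costBound + 1 :=
      ((PolyTime.size_out hw.cost).wk.add ((PolyBdd.var N).mul h.costBound.bdd.wk)).add (.const 1)
    have b5 : PolyBdd (extN N) fun p => (Val.num (w p.1).2.2).size + 1 + 1 :=
      ((PolyTime.size_out hw.idx).wk.add (.const 1)).add (.const 1)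
    refine (((((b1.add b2).add b3).add b4).add b5).add (.const 9)).mono fun p => ?_
    obtain ⟨h1, h2, h3, h4, h5⟩ := natAbs_walk_le (C p.1) (i p.1) (l p.1) (w p.1) p.2
    have g1 := (natSize_le_self _).trans h1
    have g2 := (natSize_le_self _).trans h2
    have g3 := (natSize_le_self _).trans h3
    have g4 := natSize_le_of_natAbs_le h4
    have g5 := natSize_le_of_natAbs_le h5
    simp only [encPos, Val.size, Int.natAbs_natCast]
    omega
  have key : PolyTime N e fun x => encPos ((C x).walk (i x) (l x) (w x) (y x)) := by
    refine PolyTime.iter (s := fun x j => encPos ((C x).walk (i x) (l x) (w x) j)) hy.nat hy.bdd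
      hw.enc hb ?_
    have ht := PolyTime.top h.wk.size_env hb
    have hd := h.wk.push hb
    refine hd.advance (hi.wk.push hb) ((hl.wk.push hb).sub ((PolySmall.var h.size_env).push hb))
      ⟨⟨⟨ht.fst.fst, ?_⟩, ⟨ht.fst.snd.fst, ?_⟩, ⟨ht.fst.snd.snd, ?_⟩⟩, ht.snd.fst, ht.snd.snd⟩
    · exact (hw.st.hard.add (OutDFA.polySmall_states h.hardA)).bdd.wk.mono fun p =>
        (natAbs_walk_le ..).1
    · exact (hw.st.label.add (OutDFA.polySmall_states h.labelA)).bdd.wk.mono fun p =>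
        (natAbs_walk_le ..).2.1
    · exact (hw.st.cost.add (OutDFA.polySmall_states h.costA)).bdd.wk.mono fun p =>
        (natAbs_walk_le ..).2.2.1
  refine ⟨⟨⟨key.fst.fst, ?_⟩, ⟨key.fst.snd.fst, ?_⟩, ⟨key.fst.snd.snd, ?_⟩⟩,
    key.snd.fst, key.snd.snd⟩
  · exact (hw.st.hard.add (OutDFA.polySmall_states h.hardA)).bdd.mono fun p =>
      (natAbs_walk_le ..).1
  · exact (hw.st.label.add (OutDFA.polySmall_states h.labelA)).bdd.mono fun p =>
      (natAbs_walk_le ..).2.1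
  · exact (hw.st.cost.add (OutDFA.polySmall_states h.costA)).bdd.mono fun p =>
      (natAbs_walk_le ..).2.2.1

theorem Poly.letter (h : Poly N e C) (hi : PolyNat N e i) (hl : PolySmall N e l)
    (hw : PolyPos N e w) (hy : PolySmall N e y) :
    PolySmall N e fun x => (C x).letter (i x) (l x) (w x) (y x) := by
  have hu := h.walk hi hl hw hy
  exact h.pick hi ((hl.sub hy).sub (.const h.size_env 1)) hu.st hu.cost
    (hu.idx.sub (h.emptyCount hi (hl.sub hy).nat hu.st hu.cost).int)

theorem Poly.walkLen (h : Poly N e C) (hi : PolyNat N e i) (hl : PolySmall N e l)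
    (hw : PolyPos N e w) : PolySmall N e fun x => (C x).walkLen (i x) (l x) (w x) := by
  classical
  have hc := PolySmall.var h.size_env
  have h1 := PolySmall.const h.wk.size_env 1
  have h0 := PolySmall.const h.wk.size_env 0
  refine PolySmall.sum hl ⟨PolyNat.ite ((PolyInt.const h.wk.size_env 0).le
    (h.wk.walk hi.wk hl.wk hw.wk (hc.add h1)).idx) h1.nat h0.nat, ?_⟩
  refine h1.bdd.mono fun p => ?_
  split_ifs <;> simp

/-- The word at a given position, as a value. -/
noncomputable def wordVal (C : AccInstance) (i : ℕ) (w : Pos) : Val :=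
  .fam (C.walkLen i C.params.n w) fun j => .num (C.letter i C.params.n w j)

theorem Poly.wordVal (h : Poly N e C) (hi : PolyNat N e i) (hw : PolyPos N e w) :
    PolyTime N e fun x => (C x).wordVal (i x) (w x) :=
  .fam (h.walkLen hi h.n hw) (h.wk.letter hi.wk h.n.wk hw.wk (.var h.size_env)).nat

end Poly
end AccInstance

/-! ### Greedy distributions with integer weights -/

/-- The greedy distribution gives each of `N` items the weight `a`, and the rest of the total weight
`T` to the first items, at most `d` to each; this is the weight of the first `s` items. -/
def greedySum (a d N T s : ℕ) : ℕ := a * s + min (T - a * N) (d * s)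

/-- The weight of item `j` in the greedy distribution. -/
def greedy (a d N T j : ℕ) : ℕ := greedySum a d N T (j + 1) - greedySum a d N T j

/-- The item of a position `r < T`, when each item occupies as many positions as it has weight in
the greedy distribution. -/
def greedyItem (a d N r : ℕ) : ℕ := if r < a * N then r / a else (r - a * N) / d

section Poly

variable {X : Type} {N : X → ℕ} {e : X → Val} {a d n T s : X → ℕ}

theorem PolyNat.greedySum (ha : PolyNat N e a) (hd : PolyNat N e d) (hn : PolyNat N e n)
    (hT : PolyNat N e T) (hs : PolyNat N e s) :
    PolyNat N e fun x => LQCI.greedySum (a x) (d x) (n x) (T x) (s x) :=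
  (ha.mul hs).add ((hT.sub (ha.mul hn)).min (hd.mul hs))

theorem PolyNat.greedy (ha : PolyNat N e a) (hd : PolyNat N e d) (hn : PolyNat N e n)
    (hT : PolyNat N e T) (hs : PolyNat N e s) :
    PolyNat N e fun x => LQCI.greedy (a x) (d x) (n x) (T x) (s x) :=
  (PolyNat.greedySum ha hd hn hT (hs.add (.const hs.size_env 1))).sub
    (PolyNat.greedySum ha hd hn hT hs)

theorem PolyNat.greedyItem (ha : PolyNat N e a) (hd : PolyNat N e d) (hn : PolyNat N e n)
    (hs : PolyNat N e s) : PolyNat N e fun x => LQCI.greedyItem (a x) (d x) (n x) (s x) :=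
  PolyNat.ite (hs.lt (ha.mul hn)) (hs.div ha) ((hs.sub (ha.mul hn)).div hd)

end Poly

/-- The denominator of a member of a family, and `0` outside its range. -/
def denN {n : ℕ} (f : Fin n → ℚ) (i : ℕ) : ℕ := if h : i < n then (f ⟨i, h⟩).den else 0

/-- The numerator of a member of a family, and `0` outside its range. -/
def numN {n : ℕ} (f : Fin n → ℚ) (i : ℕ) : ℤ := if h : i < n then (f ⟨i, h⟩).num else 0

namespace AccInstance

/-! ### The decision procedure and the distribution -/

/-- A common denominator of the bounds on probabilities. -/
def den (C : AccInstance) : ℕ :=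
  C.params.lam.den * C.params.rho.den * (∏ i ∈ Finset.range C.labels, denN C.params.alpha i) *
    ∏ i ∈ Finset.range C.labels, denN C.params.beta i

/-- The lower bound on label probabilities, in units of `1 / den`. -/
def lamN (C : AccInstance) : ℕ := C.params.lam.num.toNat * (C.den / C.params.lam.den)
/-- The upper bound on label probabilities, in units of `1 / den`. -/
def rhoN (C : AccInstance) : ℕ := C.params.rho.num.toNat * (C.den / C.params.rho.den)
/-- The lower bound on conditional word probabilities, in units of `1 / den`. -/
def alphaN (C : AccInstance) (i : ℕ) : ℕ :=
  (numN C.params.alpha i).toNat * (C.den / denN C.params.alpha i)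
/-- The upper bound on conditional word probabilities, in units of `1 / den`. -/
def betaN (C : AccInstance) (i : ℕ) : ℕ :=
  (numN C.params.beta i).toNat * (C.den / denN C.params.beta i)

/-- The number of words with label `i` and shifted cost below `k`. -/
noncomputable def below (C : AccInstance) (i k : ℕ) : ℕ :=
  ∑ j ∈ Finset.range k, C.cnt i C.params.n C.init j

/-- The number of words with label `i`. -/
noncomputable def size (C : AccInstance) (i : ℕ) : ℕ := C.below i C.width

/-- Labels for which the bounds on conditional probabilities can be met. -/
def Good (C : AccInstance) (i : ℕ) : Prop :=
  C.alphaN i * C.size i ≤ C.den ∧ C.den ≤ C.betaN i * C.size i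

/-- The greedy weight of the first `s` words with label `i`. -/
noncomputable def wordSum (C : AccInstance) (i s : ℕ) : ℕ :=
  greedySum (C.alphaN i) (C.betaN i - C.alphaN i) (C.size i) C.den s

/-- The least expected cost under label `i`, multiplied by `den`. -/
noncomputable def labelCost (C : AccInstance) (i : ℕ) : ℤ :=
  ∑ k ∈ Finset.range C.width, ((k : ℤ) - C.bound) *
    ((C.wordSum i (C.below i (k + 1)) : ℤ) - C.wordSum i (C.below i k))

/-- The order of good labels by cost. -/
def Before (C : AccInstance) (j i : ℕ) : Prop :=
  C.Good j ∧ (C.labelCost j < C.labelCost i ∨ C.labelCost j = C.labelCost i ∧ j < i)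

open Classical in
/-- The position of a label in the order by cost. -/
noncomputable def rank (C : AccInstance) (i : ℕ) : ℕ :=
  ∑ j ∈ Finset.range C.labels, if C.Before j i then 1 else 0

open Classical in
/-- The number of good labels. -/
noncomputable def numGood (C : AccInstance) : ℕ :=
  ∑ i ∈ Finset.range C.labels, if C.Good i then 1 else 0

/-- The probability of the label at position `j`, in units of `1 / den`. -/
noncomputable def labelWeight (C : AccInstance) (j : ℕ) : ℕ :=
  greedy C.lamN (C.rhoN - C.lamN) C.numGood C.den j

open Classical in
/-- The least expected cost, multiplied by `den ^ 2`. -/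
noncomputable def totalCost (C : AccInstance) : ℤ :=
  ∑ i ∈ Finset.range C.labels, if C.Good i then C.labelCost i * C.labelWeight (C.rank i) else 0

/-- The criterion for feasibility. -/
def Criterion (C : AccInstance) : Prop :=
  (C.lamN = 0 ∨ C.numGood = C.labels) ∧
    (C.lamN * C.numGood ≤ C.den ∧ C.den ≤ C.rhoN * C.numGood) ∧
    (C.params.c.den : ℤ) * C.totalCost ≤ C.params.c.num * (C.den * C.den : ℕ)

open Classical in
/-- The label that is drawn, for a position `r < den`. -/
noncomputable def drawLabel (C : AccInstance) (r : ℕ) : ℕ :=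
  ∑ i ∈ Finset.range C.labels,
    if C.Good i ∧ C.rank i = greedyItem C.lamN (C.rhoN - C.lamN) C.numGood r then i else 0

/-- The index of the word that is drawn under label `i`, for a position `r < den`. -/
noncomputable def drawIndex (C : AccInstance) (i r : ℕ) : ℕ :=
  greedyItem (C.alphaN i) (C.betaN i - C.alphaN i) (C.size i) r

/-- The place of the word with index `j` among the words with label `i`. -/
noncomputable def place (C : AccInstance) (i j : ℕ) : Pos :=
  (C.init, (blockOf (C.below i) C.width j : ℕ), (j : ℤ) - C.below i (blockOf (C.below i) C.width j))

/-- The word that is drawn for a position `r < den ^ 2`. -/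
noncomputable def drawVal (C : AccInstance) (r : ℕ) : Val :=
  let i := C.drawLabel (r / C.den)
  C.wordVal i (C.place i (C.drawIndex i (r - C.den * (r / C.den))))

theorem Poly.rat {X : Type} {N : X → ℕ} {e : X → Val} {q : X → ℚ}
    (h : PolyTime N e fun x => .rat (q x)) :
    PolyInt N e (fun x => (q x).num) ∧ PolyNat N e fun x => (q x).den := ⟨h.fst, h.snd⟩

section Poly

variable {X : Type} {N : X → ℕ} {e : X → Val} {C : X → AccInstance} {i j k s r : X → ℕ}

theorem Poly.numN_denN {n : X → ℕ} {f : ∀ x, Fin (n x) → ℚ}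
    (h : PolyTime N e fun x => .family fun i => .rat (f x i)) (hi : PolySmall N e i) :
    PolyInt N e (fun x => numN (f x) (i x)) ∧ PolyNat N e fun x => denN (f x) (i x) := by
  have h1 := h.nth hi
  constructor
  · refine PolyTime.congr (h1.op .first) fun x => ?_
    dsimp only
    rw [Val.nth_family]
    unfold numN
    split_ifs <;> simp [Op.eval, Val.rat]
  · refine PolyTime.congr (h1.op .second) fun x => ?_
    dsimp only
    rw [Val.nth_family]
    unfold denN
    split_ifs <;> simp [Op.eval, Val.rat, Val.nat]

theorem Poly.alpha (h : Poly N e C) (hi : PolySmall N e i) :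
    PolyInt N e (fun x => numN (C x).params.alpha (i x)) ∧
      PolyNat N e fun x => denN (C x).params.alpha (i x) := Poly.numN_denN (h.nth 7) hi

theorem Poly.beta (h : Poly N e C) (hi : PolySmall N e i) :
    PolyInt N e (fun x => numN (C x).params.beta (i x)) ∧
      PolyNat N e fun x => denN (C x).params.beta (i x) := Poly.numN_denN (h.nth 8) hi

theorem Poly.c (h : Poly N e C) : PolyInt N e (fun x => (C x).params.c.num) ∧
    PolyNat N e fun x => (C x).params.c.den := Poly.rat (h.nth 4)

theorem Poly.lam (h : Poly N e C) : PolyInt N e (fun x => (C x).params.lam.num) ∧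
    PolyNat N e fun x => (C x).params.lam.den := Poly.rat (h.nth 5)

theorem Poly.rho (h : Poly N e C) : PolyInt N e (fun x => (C x).params.rho.num) ∧
    PolyNat N e fun x => (C x).params.rho.den := Poly.rat (h.nth 6)

theorem Poly.den (h : Poly N e C) : PolyNat N e fun x => (C x).den :=
  ((h.lam.2.mul h.rho.2).mul (PolyNat.prod h.labels (h.wk.alpha (.var h.size_env)).2)).mul
    (PolyNat.prod h.labels (h.wk.beta (.var h.size_env)).2)

theorem Poly.lamN (h : Poly N e C) : PolyNat N e fun x => (C x).lamN :=
  h.lam.1.toNat.mul (h.den.div h.lam.2)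

theorem Poly.rhoN (h : Poly N e C) : PolyNat N e fun x => (C x).rhoN :=
  h.rho.1.toNat.mul (h.den.div h.rho.2)

theorem Poly.alphaN (h : Poly N e C) (hi : PolySmall N e i) :
    PolyNat N e fun x => (C x).alphaN (i x) :=
  (h.alpha hi).1.toNat.mul (h.den.div (h.alpha hi).2)

theorem Poly.betaN (h : Poly N e C) (hi : PolySmall N e i) :
    PolyNat N e fun x => (C x).betaN (i x) :=
  (h.beta hi).1.toNat.mul (h.den.div (h.beta hi).2)

theorem Poly.below (h : Poly N e C) (hi : PolySmall N e i) (hk : PolySmall N e k) :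
    PolyNat N e fun x => (C x).below (i x) (k x) :=
  PolyNat.sum hk (h.wk.cnt hi.nat.wk h.wk.n h.wk.init (PolySmall.var h.size_env).nat.int)

theorem Poly.size (h : Poly N e C) (hi : PolySmall N e i) :
    PolyNat N e fun x => (C x).size (i x) := h.below hi h.width

theorem Poly.good (h : Poly N e C) (hi : PolySmall N e i) :
    PolyDec N e fun x => (C x).Good (i x) :=
  (((h.alphaN hi).mul (h.size hi)).le h.den).and (h.den.le ((h.betaN hi).mul (h.size hi)))

theorem Poly.wordSum (h : Poly N e C) (hi : PolySmall N e i) (hs : PolyNat N e s) :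
    PolyNat N e fun x => (C x).wordSum (i x) (s x) :=
  .greedySum (h.alphaN hi) ((h.betaN hi).sub (h.alphaN hi)) (h.size hi) h.den hs

theorem Poly.labelCost (h : Poly N e C) (hi : PolySmall N e i) :
    PolyInt N e fun x => (C x).labelCost (i x) := by
  have hk := PolySmall.var h.size_env
  refine PolyInt.sum h.width (PolyInt.mul (hk.nat.int.sub h.wk.bound.nat.int) (PolyInt.sub ?_ ?_))
  · exact h.wk.wordSum hi.wk (h.wk.below hi.wk (hk.add (.const h.wk.size_env 1)))
  · exact h.wk.wordSum hi.wk (h.wk.below hi.wk hk)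

theorem Poly.before (h : Poly N e C) (hj : PolySmall N e j) (hi : PolySmall N e i) :
    PolyDec N e fun x => (C x).Before (j x) (i x) :=
  (h.good hj).and (((h.labelCost hj).lt (h.labelCost hi)).or
    (((h.labelCost hj).eq (h.labelCost hi)).and (hj.nat.lt hi.nat)))

theorem Poly.rank (h : Poly N e C) (hi : PolySmall N e i) :
    PolyNat N e fun x => (C x).rank (i x) :=
  open Classical in PolyNat.sum h.labels (PolyNat.ite (h.wk.before (.var h.size_env) hi.wk)
    (.const h.wk.size_env 1) (.const h.wk.size_env 0))

theorem Poly.numGood (h : Poly N e C) : PolyNat N e fun x => (C x).numGood :=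
  open Classical in PolyNat.sum h.labels (PolyNat.ite (h.wk.good (.var h.size_env))
    (.const h.wk.size_env 1) (.const h.wk.size_env 0))

theorem Poly.labelWeight (h : Poly N e C) (hj : PolyNat N e j) :
    PolyNat N e fun x => (C x).labelWeight (j x) :=
  .greedy h.lamN (h.rhoN.sub h.lamN) h.numGood h.den hj

theorem Poly.totalCost (h : Poly N e C) : PolyInt N e fun x => (C x).totalCost := by
  classical
  have hi := PolySmall.var h.size_env
  exact PolyInt.sum h.labels (PolyInt.ite (h.wk.good hi)
    ((h.wk.labelCost hi).mul (h.wk.labelWeight (h.wk.rank hi)).int) (.const h.wk.size_env 0))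

theorem Poly.criterion (h : Poly N e C) : PolyDec N e fun x => (C x).Criterion :=
  ((h.lamN.eq (.const h.size_env 0)).or (h.numGood.eq h.labels.nat)).and
    ((((h.lamN.mul h.numGood).le h.den).and (h.den.le (h.rhoN.mul h.numGood))).and
      ((h.c.2.int.mul h.totalCost).le (h.c.1.mul (h.den.mul h.den).int)))

theorem Poly.drawLabel (h : Poly N e C) (hr : PolyNat N e r) :
    PolySmall N e fun x => (C x).drawLabel (r x) := by
  classical
  have hi := PolySmall.var h.size_env
  refine PolySmall.sum h.labels ⟨PolyNat.ite ((h.wk.good hi).and ((h.wk.rank hi).eq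
    (.greedyItem h.wk.lamN (h.wk.rhoN.sub h.wk.lamN) h.wk.numGood hr.wk))) hi.nat
    (.const h.wk.size_env 0), hi.bdd.mono fun p => ?_⟩
  split_ifs <;> simp

theorem Poly.place (h : Poly N e C) (hi : PolySmall N e i) (hj : PolyNat N e j) :
    PolyPos N e fun x => (C x).place (i x) (j x) := by
  have hb : PolySmall N e fun x => blockOf ((C x).below (i x)) (C x).width (j x) :=
    PolySmall.blockOf h.width hj.int (h.wk.below hi.wk
      ((PolySmall.var h.size_env).add (.const h.wk.size_env 1)))
  exact ⟨h.init, hb.nat.int, hj.int.sub (h.below hi hb).int⟩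

theorem Poly.drawVal (h : Poly N e C) (hr : PolyNat N e r) :
    PolyTime N e fun x => (C x).drawVal (r x) := by
  have hi := h.drawLabel (hr.div h.den)
  exact h.wordVal hi.nat (h.place hi (.greedyItem (h.alphaN hi) ((h.betaN hi).sub (h.alphaN hi))
    (h.size hi) (hr.sub (h.den.mul (hr.div h.den)))))

end Poly
end AccInstance

/-! ### Concatenated lists -/

theorem length_flatMap_range {α : Type} (g : ℕ → List α) (a : ℕ) :
    ((List.range a).flatMap g).length = ∑ z ∈ Finset.range a, (g z).length := by
  induction a with
  | zero => simp
  | succ b ih => rw [List.range_succ, List.flatMap_append, List.length_append, ih,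
      Finset.sum_range_succ]; simp

theorem getElem?_flatMap_range {α : Type} (g : ℕ → List α) {a x r : ℕ} (hx : x < a)
    (h1 : ∑ z ∈ Finset.range x, (g z).length ≤ r)
    (h2 : r < ∑ z ∈ Finset.range (x + 1), (g z).length) :
    ((List.range a).flatMap g)[r]? = (g x)[r - ∑ z ∈ Finset.range x, (g z).length]? := by
  have hlen := length_flatMap_range g
  induction a with
  | zero => omega
  | succ a ih =>
    rw [List.range_succ, List.flatMap_append]
    rcases Nat.lt_succ_iff_lt_or_eq.1 hx with hxa | rfl
    · rw [List.getElem?_append_left, ih hxa]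
      rw [hlen]
      exact h2.trans_le (Finset.sum_le_sum_of_subset (Finset.range_subset_range.2 hxa))
    · rw [List.getElem?_append_right (by rw [hlen]; exact h1), hlen]
      simp

theorem Val.word_eq {a : ℕ} (w : List (Fin a)) :
    Val.word w = .list (w.map fun x : Fin a => .num ((x : ℕ) : ℤ)) := by
  induction w with
  | nil => rfl
  | cons x w ih =>
    have : Val.word (x :: w) = .pair (.num ((x : ℕ) : ℤ)) (.word w) := rfl
    rw [this, ih]
    rfl

namespace AccInstance

variable (C : AccInstance) (i : ℕ)

/-! ### Lists of words in the order of the dynamic program -/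

/-- The continuations with shifted cost `k` and label `i` from the state `s`, if `l` more letters
are allowed. -/
noncomputable def conts : ℕ → St → ℤ → List (List ℕ)
  | 0, s, k => List.replicate (C.emptyCount i 0 s k) []
  | l + 1, s, k => List.replicate (C.emptyCount i (l + 1) s k) [] ++
      (List.range C.letters).flatMap fun x =>
        (conts l (C.next s x) (k - C.stCost s)).map (x :: ·)

/-- The cost of the run on `v` from the state `s`. -/
noncomputable def runCost : St → List ℕ → ℤ
  | s, [] => C.stCost s
  | s, x :: v => C.stCost s + runCost (C.next s x) v

/-- Accepting states with label `i`. -/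
def IsEnd (s : St) : Prop := C.hardA.outN s.1 = 1 ∧ C.labelA.outN s.2.1 = i

/-- States within the range of the automata. -/
def Valid (s : St) : Prop :=
  s.1 < C.hardA.states ∧ s.2.1 < C.labelA.states ∧ s.2.2 < C.cost.states

variable {C i}

theorem valid_next (s : St) (x : ℕ) : C.Valid (C.next s x) :=
  ⟨C.hardA.stepN_lt _ _, C.labelA.stepN_lt _ _, C.cost.stepN_lt _ _⟩

theorem valid_init : C.Valid C.init := ⟨Fin.is_lt _, Fin.is_lt _, Fin.is_lt _⟩

theorem mem_replicate_emptyCount {l : ℕ} {s : St} {k : ℤ} {v : List ℕ} :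
    v ∈ List.replicate (C.emptyCount i l s k) [] ↔
      v = [] ∧ C.params.m + l ≤ C.params.n ∧ C.IsEnd i s ∧ k = C.stCost s + C.bound := by
  rw [List.mem_replicate]
  unfold emptyCount IsEnd
  split_ifs with h
  · simp [h]
  · simp only [ne_eq, not_true_eq_false, false_and, false_iff]
    tauto

/-- The list `conts` is complete: as `l` is counted down from the upper bound on the length, the
lower bound reads `m + l ≤ n + v.length`. -/
theorem mem_conts {l : ℕ} {s : St} {k : ℤ} {v : List ℕ} : v ∈ C.conts i l s k ↔
    v.length ≤ l ∧ C.params.m + l ≤ C.params.n + v.length ∧ (∀ x ∈ v, x < C.letters) ∧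
      C.IsEnd i (v.foldl C.next s) ∧ k = C.runCost s v + C.bound := by
  induction l generalizing s k v with
  | zero =>
    rw [conts, mem_replicate_emptyCount]
    cases v with
    | nil => simp [runCost]
    | cons x v => simp
  | succ l ih =>
    rw [conts, List.mem_append, mem_replicate_emptyCount]
    cases v with
    | nil => simp [runCost]
    | cons x v =>
      simp only [reduceCtorEq, false_and, false_or, List.mem_flatMap, List.mem_range, List.mem_map,
        List.cons.injEq, ih, List.length_cons, List.mem_cons,
        forall_eq_or_imp, List.foldl_cons, runCost]
      constructor
      · rintro ⟨y, hy, u, ⟨h1, h2, h3, h4, h5⟩, rfl, rfl⟩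
        exact ⟨by omega, by omega, ⟨hy, h3⟩, h4, by omega⟩
      · rintro ⟨h1, h2, ⟨hy, h3⟩, h4, h5⟩
        exact ⟨x, hy, v, ⟨by omega, by omega, h3, h4, by omega⟩, rfl, rfl⟩

theorem natAbs_runCost_le (s : St) (v : List ℕ) :
    (C.runCost s v).natAbs ≤ (v.length + 1) * C.costBound := by
  induction v generalizing s with
  | nil => simpa [runCost, stCost] using natAbs_outN_le_costBound C s.2.2
  | cons x v ih =>
    have h1 : (C.stCost s).natAbs ≤ C.costBound := natAbs_outN_le_costBound C s.2.2
    have h2 := ih (C.next s x)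
    rw [runCost, List.length_cons, Nat.succ_mul]
    omega

theorem natAbs_runCost_le_bound {s : St} {v : List ℕ} (h : v.length ≤ C.params.n) :
    (C.runCost s v).natAbs ≤ C.bound :=
  (natAbs_runCost_le s v).trans (Nat.mul_le_mul_right _ (by omega))

/-- The dynamic program counts the listed continuations; there are none with a shifted cost out of
range, where `cnt` is cut off. -/
theorem cnt_eq_length {l : ℕ} (hl : l ≤ C.params.n) {s : St} (hs : C.Valid s) (k : ℤ) :
    C.cnt i l s k = (C.conts i l s k).length := by
  by_cases hk : 0 ≤ k ∧ k < C.width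
  · induction l generalizing s k with
    | zero => rw [cnt, if_pos ⟨hs, hk⟩, conts, List.length_replicate]
    | succ l ih =>
      rw [cnt, if_pos ⟨hs, hk⟩, conts, List.length_append, List.length_replicate,
        length_flatMap_range]
      congr 1
      refine Finset.sum_congr rfl fun x _ => ?_
      rw [List.length_map]
      by_cases hk' : 0 ≤ k - C.stCost s ∧ k - C.stCost s < C.width
      · exact ih (by omega) (valid_next s x) _ hk'
      · rw [cnt_of_not_inRange fun h => hk' h.2]
        refine (List.length_eq_zero_iff.2
          (List.eq_nil_iff_forall_not_mem.2 fun v hv => hk' ?_)).symm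
        obtain ⟨h1, -, -, -, h5⟩ := mem_conts.1 hv
        have := natAbs_runCost_le_bound (s := C.next s x) (h1.trans (by omega : l ≤ C.params.n))
        unfold width
        omega
  · rw [cnt_of_not_inRange fun h => hk h.2]
    refine (List.length_eq_zero_iff.2 (List.eq_nil_iff_forall_not_mem.2 fun v hv => hk ?_)).symm
    obtain ⟨h1, -, -, -, h5⟩ := mem_conts.1 hv
    have := natAbs_runCost_le_bound (s := s) (h1.trans hl)
    unfold width
    omega

theorem nodup_replicate_emptyCount (l : ℕ) (s : St) (k : ℤ) :
    (List.replicate (C.emptyCount i l s k) ([] : List ℕ)).Nodup :=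
  List.nodup_replicate.2 (C.emptyCount_le_one i l s k)

theorem nodup_conts (l : ℕ) (s : St) (k : ℤ) : (C.conts i l s k).Nodup := by
  induction l generalizing s k with
  | zero => exact nodup_replicate_emptyCount ..
  | succ l ih =>
    rw [conts, List.nodup_append]
    refine ⟨nodup_replicate_emptyCount .., List.nodup_flatMap.2 ⟨fun x _ => ?_, ?_⟩, ?_⟩
    · exact (ih _ _).map (List.cons_injective)
    · refine List.nodup_range.imp fun {x y} hxy v hx hy => ?_
      obtain ⟨v', -, rfl⟩ := List.mem_map.1 hx
      obtain ⟨v'', -, h⟩ := List.mem_map.1 hy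
      exact hxy (List.cons.inj h).1.symm
    · intro v hv v' hv'
      obtain ⟨rfl, -⟩ := mem_replicate_emptyCount.1 hv
      obtain ⟨x, -, hx⟩ := List.mem_flatMap.1 hv'
      obtain ⟨v'', -, rfl⟩ := List.mem_map.1 hx
      simp

/-! ### The walk visits the letters of the listed word -/

theorem walk_succ (l : ℕ) (w : Pos) (j : ℕ) :
    C.walk i (l + 1) w (j + 1) = C.walk i l (C.advance i (l + 1) w) j := by
  induction j with
  | zero => rfl
  | succ j ih => rw [walk, ih, walk, Nat.add_sub_add_right]

theorem letter_succ (l : ℕ) (w : Pos) (j : ℕ) :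
    C.letter i (l + 1) w (j + 1) = C.letter i l (C.advance i (l + 1) w) j := by
  unfold letter
  rw [walk_succ, Nat.add_sub_add_right]

theorem walkLen_succ (l : ℕ) (w : Pos) : C.walkLen i (l + 1) w =
    C.walkLen i l (C.advance i (l + 1) w) +
      if 0 ≤ (C.advance i (l + 1) w).2.2 then 1 else 0 := by
  unfold walkLen
  rw [Finset.sum_range_succ']
  simp only [walk_succ]
  congr

theorem advance_of_lt {l : ℕ} {w : Pos} (h : w.2.2 < C.emptyCount i l w.1 w.2.1) :
    (C.advance i l w).2.2 = -1 := by
  rw [advance, if_pos h]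

theorem walkLen_of_neg (l : ℕ) {w : Pos} (h : w.2.2 < 0) : C.walkLen i l w = 0 := by
  induction l generalizing w with
  | zero => simp [walkLen]
  | succ l ih =>
    have h1 := advance_of_lt (C := C) (i := i) (l := l + 1) (w := w) (by omega)
    rw [walkLen_succ, ih (by omega), h1]
    simp

theorem cum_eq_sum_length {l : ℕ} (hl : l ≤ C.params.n) (s : St) (k : ℤ) (y : ℕ) :
    C.cum i l s k y = ∑ x ∈ Finset.range y,
      ((C.conts i l (C.next s x) (k - C.stCost s)).map (x :: ·)).length := by
  refine Finset.sum_congr rfl fun x _ => ?_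
  rw [cnt_eq_length hl (valid_next s x), List.length_map]

/-- The walk from position `r` spells out the `r`-th listed continuation. -/
theorem walk_spec {l : ℕ} (hl : l ≤ C.params.n) {s : St} (hs : C.Valid s) {k : ℤ} {r : ℕ}
    {v : List ℕ} (hv : (C.conts i l s k)[r]? = some v) :
    C.walkLen i l (s, k, r) = v.length ∧
      ∀ j, ∀ h : j < v.length, C.letter i l (s, k, r) j = v[j] := by
  induction l generalizing s k r v with
  | zero =>
    obtain ⟨rfl, -⟩ := mem_replicate_emptyCount.1 (List.mem_of_getElem? hv)
    simp [walkLen]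
  | succ l ih =>
    have hl' : l ≤ C.params.n := by omega
    by_cases hr : r < C.emptyCount i (l + 1) s k
    · have hv' : (List.replicate (C.emptyCount i (l + 1) s k) [])[r]? = some v := by
        rw [← hv, conts, List.getElem?_append_left (by simpa using hr)]
      obtain ⟨rfl, -⟩ := mem_replicate_emptyCount.1 (List.mem_of_getElem? hv')
      have h1 := advance_of_lt (C := C) (i := i) (l := l + 1) (w := (s, k, (r : ℤ)))
        (by simpa using hr)
      rw [walkLen_succ, walkLen_of_neg _ (by omega), h1]
      simp
    · -- the word starts with the letter whose block contains the position `r - emptyCount`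
      have hc0 := C.cum_zero i l s k
      have hcm := C.cum_mono i l s k
      set r' := r - C.emptyCount i (l + 1) s k with hr'
      have hrr : ((r : ℤ) - C.emptyCount i (l + 1) s k) = (r' : ℤ) := by omega
      have hv' : ((List.range C.letters).flatMap fun x =>
          (C.conts i l (C.next s x) (k - C.stCost s)).map (x :: ·))[r']? = some v := by
        rw [← hv, conts, List.getElem?_append_right (by simpa using hr), List.length_replicate]
      obtain ⟨h1, h2⟩ := blockOf_spec hcm hc0 C.letters (r := (r' : ℤ)) (by omega)
      have hlt : (r' : ℤ) < C.cum i l s k C.letters := by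
        have := (List.getElem?_eq_some_iff.1 hv').1
        rw [length_flatMap_range, ← cum_eq_sum_length hl'] at this
        exact_mod_cast this
      obtain ⟨hx, h2⟩ := h2 hlt
      set x := blockOf (C.cum i l s k) C.letters r' with hxdef
      have h1' : C.cum i l s k x ≤ r' := by exact_mod_cast h1
      have h2' : r' < C.cum i l s k (x + 1) := by exact_mod_cast h2
      rw [getElem?_flatMap_range _ hx (by rwa [← cum_eq_sum_length hl'])
        (by rwa [← cum_eq_sum_length hl']), ← cum_eq_sum_length hl', List.getElem?_map] at hv'
      obtain ⟨u, hu, rfl⟩ := Option.map_eq_some_iff.1 hv'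
      have hpick : C.pick i l s k r' = x := rfl
      have hadv : C.advance i (l + 1) (s, k, (r : ℤ)) =
          (C.next s x, k - C.stCost s, ((r' - C.cum i l s k x : ℕ) : ℤ)) := by
        rw [advance, if_neg (by simpa using hr)]
        simp only [hrr, Nat.add_sub_cancel, hpick]
        rw [Nat.cast_sub h1']
      obtain ⟨ih1, ih2⟩ := ih hl' (valid_next s x) hu
      constructor
      · rw [walkLen_succ, hadv, ih1]
        simp
      · intro j hj
        cases j with
        | zero =>
          unfold letter
          simp only [walk, Nat.sub_zero, hrr, Nat.add_sub_cancel, hpick, List.getElem_cons_zero]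
        | succ j =>
          rw [letter_succ, hadv, List.getElem_cons_succ]
          exact ih2 j _

/-! ### The words with a given label, in the order of their costs -/

variable (C i)

/-- The words with label `i`, as lists of numbers, sorted by cost. -/
noncomputable def wordsN : List (List ℕ) :=
  (List.range C.width).flatMap fun k : ℕ => C.conts i C.params.n C.init (k : ℤ)

variable {C i}

theorem below_eq (k : ℕ) : C.below i k =
    ∑ j ∈ Finset.range k, (C.conts i C.params.n C.init j).length :=
  Finset.sum_congr rfl fun _ _ => cnt_eq_length le_rfl valid_init _

theorem below_mono : Monotone (C.below i) :=
  fun _ _ h => Finset.sum_le_sum_of_subset (Finset.range_subset_range.2 h)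

theorem below_zero : C.below i 0 = 0 := by simp [below]

theorem length_wordsN : (C.wordsN i).length = C.size i := by
  rw [wordsN, length_flatMap_range, size, below_eq]

theorem nodup_wordsN : (C.wordsN i).Nodup := by
  refine List.nodup_flatMap.2 ⟨fun k _ => nodup_conts .., ?_⟩
  refine List.nodup_range.imp fun {x y} hxy v hx hy => hxy ?_
  obtain ⟨-, -, -, -, h⟩ := mem_conts.1 hx
  obtain ⟨-, -, -, -, h'⟩ := mem_conts.1 hy
  omega

theorem mem_wordsN {v : List ℕ} : v ∈ C.wordsN i ↔ C.params.m ≤ v.length ∧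
    v.length ≤ C.params.n ∧ (∀ x ∈ v, x < C.letters) ∧ C.IsEnd i (v.foldl C.next C.init) := by
  simp only [wordsN, List.mem_flatMap, List.mem_range, mem_conts]
  constructor
  · rintro ⟨k, hk, h1, h2, h3, h4, h5⟩
    exact ⟨by omega, h1, h3, h4⟩
  · rintro ⟨h1, h2, h3, h4⟩
    have h5 := natAbs_runCost_le_bound (s := C.init) h2
    refine ⟨(C.runCost C.init v + C.bound).toNat, ?_, h2, by omega, h3, h4, by omega⟩
    unfold width
    omega

theorem getElem?_wordsN {k j : ℕ} (hk : k < C.width) (h1 : C.below i k ≤ j)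
    (h2 : j < C.below i (k + 1)) :
    (C.wordsN i)[j]? = (C.conts i C.params.n C.init k)[j - C.below i k]? := by
  rw [wordsN, getElem?_flatMap_range _ hk (by rwa [← below_eq]) (by rwa [← below_eq]), below_eq]

theorem runCost_of_getElem? {k j : ℕ} {v : List ℕ} (hk : k < C.width) (h1 : C.below i k ≤ j)
    (h2 : j < C.below i (k + 1)) (hv : (C.wordsN i)[j]? = some v) :
    C.runCost C.init v = k - C.bound := by
  rw [getElem?_wordsN hk h1 h2] at hv
  have := (mem_conts.1 (List.mem_of_getElem? hv)).2.2.2.2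
  omega

/-- Each word is found in the block of its cost. -/
theorem exists_block_below {j : ℕ} (hj : j < C.size i) :
    ∃ k < C.width, C.below i k ≤ j ∧ j < C.below i (k + 1) ∧
      blockOf (C.below i) C.width j = k := by
  obtain ⟨h1, h2⟩ := blockOf_spec (below_mono (C := C) (i := i)) below_zero C.width
    (r := (j : ℤ)) (by omega)
  obtain ⟨h2, h3⟩ := h2 (by exact_mod_cast hj)
  exact ⟨_, h2, by exact_mod_cast h1, by exact_mod_cast h3, rfl⟩

theorem wordVal_place {j : ℕ} {v : List ℕ} (hv : (C.wordsN i)[j]? = some v) :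
    C.wordVal i (C.place i j) = .list (v.map fun x : ℕ => .num (x : ℤ)) := by
  have hj : j < C.size i := by
    rw [← length_wordsN]; exact (List.getElem?_eq_some_iff.1 hv).1
  obtain ⟨k, hk, h1, h2, hb⟩ := exists_block_below hj
  rw [getElem?_wordsN hk h1 h2] at hv
  obtain ⟨h3, h4⟩ := walk_spec le_rfl valid_init hv
  have hp : C.place i j = (C.init, (k : ℤ), ((j - C.below i k : ℕ) : ℤ)) := by
    rw [place, hb, Nat.cast_sub h1]
  rw [hp, wordVal, h3, Val.fam]
  congr 1
  refine List.ext_getElem (by simp) fun n h5 h6 => ?_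
  simp only [List.length_map, List.length_range] at h5
  simp [h4 n h5]

/-! ### Words over the alphabet of the instance -/

theorem foldl_next (w : List (Fin C.letters)) (a : Fin C.hardStates) (b : Fin C.label.states)
    (c : Fin C.cost.states) :
    (w.map Fin.val).foldl C.next ((a : ℕ), (b : ℕ), (c : ℕ)) =
      (((w.foldl C.hard.step a : Fin _) : ℕ), ((w.foldl C.label.step b : Fin _) : ℕ),
        ((w.foldl C.cost.step c : Fin _) : ℕ)) := by
  induction w generalizing a b c with
  | nil => rfl
  | cons x w ih =>
    simp only [List.map_cons, List.foldl_cons]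
    rw [← ih]
    congr 1
    exact Prod.ext (C.hardA.stepN_val a x) (Prod.ext (C.labelA.stepN_val b x)
      (C.cost.stepN_val c x))

theorem isEnd_foldl (w : List (Fin C.letters)) (i : Fin C.labels) :
    C.IsEnd i ((w.map Fin.val).foldl C.next C.init) ↔
      w ∈ C.hard.accepts ∧ C.label.final w = i := by
  have h := foldl_next (C := C) w C.hard.start C.label.start C.cost.start
  rw [show C.init = ((C.hard.start : ℕ), (C.label.start : ℕ), (C.cost.start : ℕ)) from rfl, h]
  have h1 := C.hardA.outN_val (w.foldl C.hard.step C.hard.start)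
  have h2 := C.labelA.outN_val (w.foldl C.label.step C.label.start)
  refine and_congr (Eq.congr_left h1 |>.trans ?_) (Eq.congr_left h2 |>.trans ?_)
  · rw [DFA.mem_accepts]
    dsimp only [hardA, DFA.eval, DFA.evalFrom]
    split_ifs with h <;> simp [h]
  · dsimp only [labelA, OutDFA.final]
    rw [Fin.ext_iff]
    exact_mod_cast Iff.rfl

theorem runCost_eq_acc (w : List (Fin C.letters)) :
    C.runCost C.init (w.map Fin.val) = C.cost.acc w := by
  have key : ∀ (w : List (Fin C.letters)) (s : St) (c : Fin C.cost.states), s.2.2 = c →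
      C.runCost s (w.map Fin.val) = ((w.scanl C.cost.step c).map C.cost.out).sum := by
    intro w
    induction w with
    | nil =>
      intro s c hc
      simp [runCost, stCost, OutDFA.outN, hc]
    | cons x w ih =>
      intro s c hc
      rw [List.map_cons, runCost, List.scanl_cons, ih _ (C.cost.step c x)]
      · simp [stCost, OutDFA.outN, hc]
      · simp [next, hc, OutDFA.stepN_val]
  exact key w _ _ rfl

theorem exists_words (C : AccInstance) (i : ℕ) :
    ∃ W : List (List (Fin C.letters)), W.map (List.map Fin.val) = C.wordsN i := by
  have : C.wordsN i ∈ Set.range (List.map (List.map (Fin.val (n := C.letters)))) := by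
    rw [Set.range_list_map]
    intro v hv
    rw [Set.range_list_map]
    intro x hx
    exact ⟨⟨x, (mem_wordsN.1 hv).2.2.1 x hx⟩, rfl⟩
  exact this

/-- The words with label `i`, sorted by cost. -/
noncomputable def words (C : AccInstance) (i : ℕ) : List (List (Fin C.letters)) :=
  (C.exists_words i).choose

theorem map_words : (C.words i).map (List.map Fin.val) = C.wordsN i :=
  (C.exists_words i).choose_spec

theorem map_val_injective (n : ℕ) : Function.Injective (List.map (Fin.val (n := n))) :=
  List.map_injective_iff.2 Fin.val_injective

theorem length_words : (C.words i).length = C.size i := by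
  rw [← length_wordsN, ← map_words, List.length_map]

theorem nodup_words : (C.words i).Nodup := by
  have := nodup_wordsN (C := C) (i := i)
  rw [← map_words] at this
  exact this.of_map

/-- The list `words` enumerates a label class. -/
theorem mem_words {i : Fin C.labels} {w : List (Fin C.letters)} :
    w ∈ C.words i ↔ w ∈ C.toInstance.labelClass i := by
  have this : w ∈ C.words i ↔ w.map Fin.val ∈ (C.words i).map (List.map Fin.val) :=
    (List.mem_map_of_injective (map_val_injective _)).symm
  rw [this, map_words, mem_wordsN, isEnd_foldl, List.length_map]
  have h : ∀ x ∈ w.map Fin.val, x < C.letters := by simp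
  change _ ↔ (C.params.m ≤ w.length ∧ w.length ≤ C.params.n ∧ w ∈ C.hard.accepts) ∧
    C.label.final w = i
  tauto

/-- The computed value is the word with the given index. -/
theorem wordVal_words {j : ℕ} (hj : j < (C.words i).length) :
    C.wordVal i (C.place i j) = .word (C.words i)[j] := by
  have : (C.wordsN i)[j]? = some ((C.words i)[j].map Fin.val) := by
    rw [← map_words, List.getElem?_map, List.getElem?_eq_getElem hj]; rfl
  rw [wordVal_place this, Val.word_eq, List.map_map]
  rfl

/-- The blocks of the list `words` have constant cost. -/
theorem acc_words {j k : ℕ} (hj : j < (C.words i).length) (hk : k < C.width)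
    (h1 : C.below i k ≤ j) (h2 : j < C.below i (k + 1)) :
    C.cost.acc (C.words i)[j] = k - C.bound := by
  rw [← runCost_eq_acc]
  refine runCost_of_getElem? hk h1 h2 ?_
  rw [← map_words, List.getElem?_map, List.getElem?_eq_getElem hj]; rfl

end AccInstance

/-! ### Properties of the greedy distribution -/

section Greedy

variable {a d N T : ℕ}

theorem greedySum_zero : greedySum a d N T 0 = 0 := by simp [greedySum]

theorem greedySum_full (h1 : a * N ≤ T) (h2 : T ≤ (a + d) * N) : greedySum a d N T N = T := by
  rw [add_mul] at h2
  rw [greedySum, min_eq_left (by omega)]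
  omega

theorem greedySum_succ (j : ℕ) : greedySum a d N T j + a ≤ greedySum a d N T (j + 1) ∧
    greedySum a d N T (j + 1) ≤ greedySum a d N T j + (a + d) := by
  unfold greedySum
  rw [mul_add a, mul_add d, mul_one, mul_one]
  omega

theorem le_greedy (j : ℕ) : a ≤ greedy a d N T j := by
  have := greedySum_succ (a := a) (d := d) (N := N) (T := T) j
  unfold greedy; omega

theorem greedy_le (j : ℕ) : greedy a d N T j ≤ a + d := by
  have := greedySum_succ (a := a) (d := d) (N := N) (T := T) j
  unfold greedy; omega

theorem sum_greedy (s : ℕ) : ∑ j ∈ Finset.range s, greedy a d N T j = greedySum a d N T s := by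
  induction s with
  | zero => simp [greedySum_zero]
  | succ s ih =>
    have := greedySum_succ (a := a) (d := d) (N := N) (T := T) s
    rw [Finset.sum_range_succ, ih, greedy]
    omega

theorem sum_greedy_full (h1 : a * N ≤ T) (h2 : T ≤ (a + d) * N) :
    ∑ j ∈ Finset.range N, greedy a d N T j = T := by
  rw [sum_greedy, greedySum_full h1 h2]

theorem greedyItem_lt_iff (h1 : a * N ≤ T) (h2 : T ≤ (a + d) * N) {r s : ℕ} (hr : r < T)
    (hs : s ≤ N) : greedyItem a d N r < s ↔
      r < a * s ∨ a * N ≤ r ∧ r < a * N + min (T - a * N) (d * s) := by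
  have has : a * s ≤ a * N := Nat.mul_le_mul_left a hs
  rw [add_mul] at h2
  unfold greedyItem
  split_ifs with h
  · have ha : 0 < a := Nat.pos_of_ne_zero fun h0 => by simp [h0] at h
    rw [Nat.div_lt_iff_lt_mul ha, mul_comm s a]
    omega
  · have hd : 0 < d := Nat.pos_of_ne_zero fun h0 => by simp [h0] at h2; omega
    rw [Nat.div_lt_iff_lt_mul hd, mul_comm s d]
    omega

theorem greedyItem_lt (h1 : a * N ≤ T) (h2 : T ≤ (a + d) * N) {r : ℕ} (hr : r < T) :
    greedyItem a d N r < N := by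
  rw [greedyItem_lt_iff h1 h2 hr le_rfl]
  rw [add_mul] at h2
  omega

theorem card_greedyItem_lt (h1 : a * N ≤ T) (h2 : T ≤ (a + d) * N) {s : ℕ} (hs : s ≤ N) :
    ((Finset.range T).filter fun r => greedyItem a d N r < s).card = greedySum a d N T s := by
  have has : a * s ≤ a * N := Nat.mul_le_mul_left a hs
  have : (Finset.range T).filter (fun r => greedyItem a d N r < s) =
      Finset.range (a * s) ∪ Finset.Ico (a * N) (a * N + min (T - a * N) (d * s)) := by
    ext r
    simp only [Finset.mem_filter, Finset.mem_range, Finset.mem_union, Finset.mem_Ico]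
    constructor
    · rintro ⟨hr, h⟩
      exact (greedyItem_lt_iff h1 h2 hr hs).1 h
    · intro h
      have hr : r < T := by omega
      exact ⟨hr, (greedyItem_lt_iff h1 h2 hr hs).2 h⟩
  rw [this, Finset.card_union_of_disjoint, Finset.card_range, Nat.card_Ico, greedySum]
  · omega
  · rw [Finset.disjoint_left]
    intro r
    simp only [Finset.mem_range, Finset.mem_Ico]
    omega

theorem card_greedyItem_eq (h1 : a * N ≤ T) (h2 : T ≤ (a + d) * N) {j : ℕ} (hj : j < N) :
    ((Finset.range T).filter fun r => greedyItem a d N r = j).card = greedy a d N T j := by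
  rw [greedy, ← card_greedyItem_lt h1 h2 (show j + 1 ≤ N by omega),
    ← card_greedyItem_lt h1 h2 hj.le, ← Finset.card_sdiff_of_subset]
  · congr 1
    ext r
    simp only [Finset.mem_filter, Finset.mem_sdiff, Finset.mem_range]
    omega
  · intro r
    simp only [Finset.mem_filter, Finset.mem_range]
    omega

/-- Drawing the item of a random position realizes the greedy distribution. -/
theorem sum_greedyItem (h1 : a * N ≤ T) (h2 : T ≤ (a + d) * N) (f : ℕ → ℝ) :
    ∑ r ∈ Finset.range T, f (greedyItem a d N r) =
      ∑ j ∈ Finset.range N, (greedy a d N T j : ℝ) * f j := by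
  rw [← Finset.sum_fiberwise_of_maps_to (s := Finset.range T) (t := Finset.range N)
    (g := greedyItem a d N) fun r hr => Finset.mem_range.2
      (greedyItem_lt h1 h2 (Finset.mem_range.1 hr))]
  refine Finset.sum_congr rfl fun j hj => ?_
  rw [← card_greedyItem_eq h1 h2 (Finset.mem_range.1 hj), Finset.sum_congr rfl
    (g := fun _ => f j) fun r hr => by rw [(Finset.mem_filter.1 hr).2]]
  simp

/-- The greedy distribution has the least expected cost, since it has the greatest initial sums. -/
theorem greedy_optimal (h1 : a * N ≤ T) (h2 : T ≤ (a + d) * N) {c y : ℕ → ℝ}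
    (hc : ∀ i j, i ≤ j → j < N → c i ≤ c j) (hl : ∀ j < N, (a : ℝ) ≤ y j)
    (hu : ∀ j < N, y j ≤ a + d) (hs : ∑ j ∈ Finset.range N, y j = T) :
    ∑ j ∈ Finset.range N, (greedy a d N T j : ℝ) * c j ≤ ∑ j ∈ Finset.range N, y j * c j := by
  have hpre : ∀ s ≤ N, ∑ j ∈ Finset.range s, (y j - greedy a d N T j) ≤ 0 := by
    intro s hs'
    rw [Finset.sum_sub_distrib, ← Nat.cast_sum, sum_greedy, sub_nonpos]
    have e1 : ∑ j ∈ Finset.range s, y j ≤ s * (a + d) := by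
      calc _ ≤ ∑ j ∈ Finset.range s, ((a : ℝ) + d) :=
            Finset.sum_le_sum fun j hj => hu j (by have := Finset.mem_range.1 hj; omega)
        _ = _ := by rw [Finset.sum_const, Finset.card_range, nsmul_eq_mul]
    have e2 : ∑ j ∈ Finset.range s, y j ≤ T - (N - s) * a := by
      rw [← hs, ← Finset.sum_range_add_sum_Ico _ hs']
      have : ∑ j ∈ Finset.Ico s N, (a : ℝ) ≤ ∑ j ∈ Finset.Ico s N, y j :=
        Finset.sum_le_sum fun j hj => hl j (Finset.mem_Ico.1 hj).2
      simp only [Finset.sum_const, Nat.card_Ico, nsmul_eq_mul, Nat.cast_sub hs'] at this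
      linarith
    rw [greedySum, Nat.cast_add, Nat.cast_min, Nat.cast_sub h1]
    push_cast
    rcases min_choice ((T : ℝ) - a * N) (d * s) with h | h <;> rw [h] <;> linarith
  have key : ∀ s, s < N → c s * ∑ j ∈ Finset.range (s + 1), (y j - greedy a d N T j) ≤
      ∑ j ∈ Finset.range (s + 1), (y j - greedy a d N T j) * c j := by
    intro s
    induction s with
    | zero => intro _; simp [mul_comm]
    | succ s ih =>
      intro hsN
      rw [Finset.sum_range_succ, Finset.sum_range_succ _ (s + 1), mul_add]
      have e1 := ih (by omega)
      have e2 := mul_le_mul_of_nonpos_right (hc s (s + 1) (by omega) hsN)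
        (hpre (s + 1) hsN.le)
      linarith
  rcases Nat.eq_zero_or_pos N with rfl | hN
  · simp
  · obtain ⟨s, rfl⟩ := Nat.exists_eq_succ_of_ne_zero hN.ne'
    have e := key s (by omega)
    rw [Finset.sum_sub_distrib, ← Nat.cast_sum, sum_greedy_full h1 h2, hs, sub_self, mul_zero] at e
    simp only [sub_mul, Finset.sum_sub_distrib] at e
    linarith

end Greedy

/-! ### Positions in a finite linear order -/

section Rank

variable {s : Finset ℕ} {R : ℕ → ℕ → Prop} [DecidableRel R]

theorem card_filter_lt_card (hirr : ∀ i, ¬ R i i) {i : ℕ} (hi : i ∈ s) :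
    (s.filter (R · i)).card < s.card :=
  Finset.card_lt_card (Finset.filter_ssubset.2 ⟨i, hi, hirr i⟩)

theorem card_filter_lt_of_rel (hirr : ∀ i, ¬ R i i) (htr : ∀ i j k, R i j → R j k → R i k)
    {i j : ℕ} (hi : i ∈ s) (h : R i j) : (s.filter (R · i)).card < (s.filter (R · j)).card := by
  refine Finset.card_lt_card ⟨fun k hk => ?_, fun hsub => ?_⟩
  · rw [Finset.mem_filter] at hk ⊢
    exact ⟨hk.1, htr _ _ _ hk.2 h⟩
  · exact hirr i (Finset.mem_filter.1 (hsub (Finset.mem_filter.2 ⟨hi, h⟩))).2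

/-- The members of a finite linear order can be listed by position. -/
theorem exists_position_inverse (hirr : ∀ i, ¬ R i i) (htr : ∀ i j k, R i j → R j k → R i k)
    (htri : ∀ i ∈ s, ∀ j ∈ s, R i j ∨ i = j ∨ R j i) :
    ∃ σ : ℕ → ℕ, (∀ j < s.card, σ j ∈ s ∧ (s.filter (R · (σ j))).card = j) ∧
      (∀ i ∈ s, σ (s.filter (R · i)).card = i) ∧
      ∀ f : ℕ → ℝ, ∑ j ∈ Finset.range s.card, f (σ j) = ∑ i ∈ s, f i := by
  set rk : ℕ → ℕ := fun i => (s.filter (R · i)).card with hrk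
  have hinj : ∀ i ∈ s, ∀ j ∈ s, rk i = rk j → i = j := by
    intro i hi j hj h
    rcases htri i hi j hj with h' | h' | h'
    · exact absurd h (card_filter_lt_of_rel hirr htr hi h').ne
    · exact h'
    · exact absurd h (card_filter_lt_of_rel hirr htr hj h').ne'
  have hsurj : ∀ j < s.card, ∃ i ∈ s, rk i = j := by
    intro j hj
    have := Finset.surj_on_of_inj_on_of_card_le (s := s) (t := Finset.range s.card)
      (fun i _ => rk i) (fun i hi => Finset.mem_range.2 (card_filter_lt_card hirr hi))
      (fun i j hi hj h => hinj i hi j hj h) (by simp) j (Finset.mem_range.2 hj)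
    obtain ⟨i, hi, h⟩ := this
    exact ⟨i, hi, h.symm⟩
  classical
  choose! σ hσ using hsurj
  refine ⟨σ, hσ, fun i hi => ?_, fun f => ?_⟩
  · have := hσ (rk i) (card_filter_lt_card hirr hi)
    exact hinj _ this.1 _ hi this.2
  · refine Finset.sum_bij' (fun j _ => σ j) (fun i _ => rk i) ?_ ?_ ?_ ?_ ?_
    · exact fun j hj => (hσ j (Finset.mem_range.1 hj)).1
    · exact fun i hi => Finset.mem_range.2 (card_filter_lt_card hirr hi)
    · exact fun j hj => (hσ j (Finset.mem_range.1 hj)).2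
    · intro i hi
      have := hσ (rk i) (card_filter_lt_card hirr hi)
      exact hinj _ this.1 _ hi this.2
    · exact fun _ _ => rfl

end Rank

namespace AccInstance

variable {C : AccInstance} {i : ℕ}

/-! ### Common denominators -/

theorem denN_pos {n : ℕ} (f : Fin n → ℚ) {i : ℕ} (hi : i < n) : 0 < denN f i := by
  rw [denN, dif_pos hi]; exact Rat.den_pos _

theorem den_pos : 0 < C.den :=
  Nat.mul_pos (Nat.mul_pos (Nat.mul_pos (Rat.den_pos _) (Rat.den_pos _))
    (Finset.prod_pos fun _ hi => denN_pos _ (Finset.mem_range.1 hi)))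
    (Finset.prod_pos fun _ hi => denN_pos _ (Finset.mem_range.1 hi))

/-- Scaling a rational number by a multiple of its denominator gives an integer. -/
theorem cast_scale {q : ℚ} (hq : 0 ≤ q) {T : ℕ} (h : q.den ∣ T) :
    ((q.num.toNat * (T / q.den) : ℕ) : ℝ) = q * T := by
  obtain ⟨t, rfl⟩ := h
  rw [Nat.mul_div_cancel_left _ q.den_pos]
  have h1 : ((q.num.toNat : ℤ) : ℝ) = q.num := by rw [Int.toNat_of_nonneg (Rat.num_nonneg.2 hq)]
  have h2 : (q : ℝ) = q.num / q.den := by exact_mod_cast (Rat.num_div_den q).symm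
  have h3 : (q.den : ℝ) ≠ 0 := by exact_mod_cast q.den_ne_zero
  rw [Int.cast_natCast] at h1
  push_cast
  rw [h1, h2]
  field_simp

theorem cast_lamN : (C.lamN : ℝ) = C.params.lam * C.den :=
  cast_scale C.params.lam_nonneg (by
    unfold den; rw [mul_assoc, mul_assoc]; exact dvd_mul_right _ _)

theorem cast_rhoN : (C.rhoN : ℝ) = C.params.rho * C.den :=
  cast_scale (C.params.lam_nonneg.trans C.params.lam_le_rho) (by
    unfold den; rw [mul_comm C.params.lam.den, mul_assoc, mul_assoc]; exact dvd_mul_right _ _)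

theorem cast_alphaN (i : Fin C.labels) : (C.alphaN i : ℝ) = C.params.alpha i * C.den := by
  have h : denN C.params.alpha i ∣ C.den := Dvd.dvd.mul_right (Dvd.dvd.mul_left
    (Finset.dvd_prod_of_mem _ (Finset.mem_range.2 i.2)) _) _
  rw [alphaN]
  unfold denN numN at *
  rw [dif_pos i.2] at *
  rw [dif_pos i.2]
  exact cast_scale (C.params.alpha_nonneg i) h

theorem cast_betaN (i : Fin C.labels) : (C.betaN i : ℝ) = C.params.beta i * C.den := by
  have h : denN C.params.beta i ∣ C.den := Dvd.dvd.mul_left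
    (Finset.dvd_prod_of_mem _ (Finset.mem_range.2 i.2)) _
  rw [betaN]
  unfold denN numN at *
  rw [dif_pos i.2] at *
  rw [dif_pos i.2]
  exact cast_scale ((C.params.alpha_nonneg i).trans (C.params.alpha_le_beta i)) h

theorem lamN_le_rhoN : C.lamN ≤ C.rhoN := by
  have : (C.lamN : ℝ) ≤ C.rhoN := by
    rw [cast_lamN, cast_rhoN]
    have : (C.params.lam : ℝ) ≤ C.params.rho := by exact_mod_cast C.params.lam_le_rho
    gcongr
  exact_mod_cast this

theorem alphaN_le_betaN (i : Fin C.labels) : C.alphaN i ≤ C.betaN i := by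
  have : (C.alphaN i : ℝ) ≤ C.betaN i := by
    rw [cast_alphaN, cast_betaN]
    have : (C.params.alpha i : ℝ) ≤ C.params.beta i := by exact_mod_cast C.params.alpha_le_beta i
    gcongr
  exact_mod_cast this

/-! ### The least expected cost under a label -/

/-- The cost of the word with index `j` and label `i`. -/
noncomputable def wordCost (C : AccInstance) (i j : ℕ) : ℤ :=
  ((C.words i)[j]?.map C.cost.acc).getD 0

theorem wordCost_eq {j k : ℕ} (hk : k < C.width) (h1 : C.below i k ≤ j)
    (h2 : j < C.below i (k + 1)) : C.wordCost i j = k - C.bound := by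
  have hj : j < (C.words i).length := by
    rw [length_words]; exact h2.trans_le (below_mono (show k + 1 ≤ C.width by omega))
  rw [wordCost, List.getElem?_eq_getElem hj, Option.map_some, Option.getD_some,
    acc_words hj hk h1 h2]

theorem wordCost_mono {j j' : ℕ} (h : j ≤ j') (h' : j' < C.size i) :
    C.wordCost i j ≤ C.wordCost i j' := by
  obtain ⟨k, hk, h1, h2, -⟩ := exists_block_below (h.trans_lt h')
  obtain ⟨k', hk', h1', h2', -⟩ := exists_block_below h'
  rw [wordCost_eq hk h1 h2, wordCost_eq hk' h1' h2']
  have : k ≤ k' := by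
    by_contra hkk
    have := below_mono (C := C) (i := i) (show k' + 1 ≤ k by omega)
    omega
  omega

/-- The weight of the word with index `j` in the greedy distribution under label `i`. -/
noncomputable def wordWeight (C : AccInstance) (i j : ℕ) : ℕ :=
  greedy (C.alphaN i) (C.betaN i - C.alphaN i) (C.size i) C.den j

/-- The expected cost under a label, computed block by block from the counts, is that of the greedy
distribution on the words. -/
theorem labelCost_eq : C.labelCost i =
    ∑ j ∈ Finset.range (C.size i), (C.wordWeight i j : ℤ) * C.wordCost i j := by
  have key : ∀ K ≤ C.width, ∑ k ∈ Finset.range K, ((k : ℤ) - C.bound) *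
      ((C.wordSum i (C.below i (k + 1)) : ℤ) - C.wordSum i (C.below i k)) =
      ∑ j ∈ Finset.range (C.below i K), (C.wordWeight i j : ℤ) * C.wordCost i j := by
    intro K
    induction K with
    | zero => simp [below_zero]
    | succ K ih =>
      intro hK
      have hm : C.below i K ≤ C.below i (K + 1) := below_mono (Nat.le_succ K)
      rw [Finset.sum_range_succ, ih (by omega), ← Finset.sum_range_add_sum_Ico _ hm]
      congr 1
      rw [Finset.sum_congr rfl (g := fun j => ((K : ℤ) - C.bound) * (C.wordWeight i j : ℤ))
        fun j hj => by
          obtain ⟨h1, h2⟩ := Finset.mem_Ico.1 hj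
          rw [wordCost_eq hK h1 h2, mul_comm], ← Finset.mul_sum]
      congr 1
      rw [Finset.sum_Ico_eq_sub _ hm, ← Nat.cast_sum, ← Nat.cast_sum]
      simp only [wordWeight, wordSum, sum_greedy]
  exact key _ le_rfl

theorem good_gap (i : Fin C.labels) (h : C.Good i) :
    C.alphaN i * C.size i ≤ C.den ∧
      C.den ≤ (C.alphaN i + (C.betaN i - C.alphaN i)) * C.size i := by
  rw [Nat.add_sub_cancel' (alphaN_le_betaN i)]
  exact h

/-- No admissible conditional distribution has a lower expected cost than the greedy one. -/
theorem labelCost_le (i : Fin C.labels) (h : C.Good i) {y : ℕ → ℝ}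
    (hl : ∀ j < C.size i, (C.alphaN i : ℝ) ≤ y j) (hu : ∀ j < C.size i, y j ≤ C.betaN i)
    (hs : ∑ j ∈ Finset.range (C.size i), y j = C.den) :
    (C.labelCost i : ℝ) ≤ ∑ j ∈ Finset.range (C.size i), y j * C.wordCost i j := by
  obtain ⟨h1, h2⟩ := good_gap i h
  rw [labelCost_eq]
  push_cast
  refine greedy_optimal h1 h2 (c := fun j => (C.wordCost i j : ℝ)) ?_ hl ?_ hs
  · intro j j' hj hj'
    exact_mod_cast wordCost_mono hj hj'
  · intro j hj
    rw [Nat.cast_sub (alphaN_le_betaN i)]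
    linarith [hu j hj]

/-! ### The order of the good labels -/

open Classical in
/-- The set of good labels. -/
noncomputable def goodSet (C : AccInstance) : Finset ℕ := (Finset.range C.labels).filter C.Good

theorem mem_goodSet : i ∈ C.goodSet ↔ i < C.labels ∧ C.Good i := by
  simp [goodSet]

theorem numGood_eq : C.numGood = C.goodSet.card := by
  classical
  rw [numGood, goodSet, Finset.card_filter]

open Classical in
theorem rank_eq : C.rank i = (C.goodSet.filter fun j => C.labelCost j < C.labelCost i ∨
    C.labelCost j = C.labelCost i ∧ j < i).card := by
  rw [rank, goodSet, Finset.filter_filter, Finset.card_filter]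
  exact Finset.sum_congr rfl fun j _ => if_congr Iff.rfl rfl rfl

/-- The good labels in the order of their costs. -/
theorem exists_label_order (C : AccInstance) :
    ∃ σ : ℕ → ℕ, (∀ j < C.numGood, σ j ∈ C.goodSet ∧ C.rank (σ j) = j) ∧
      (∀ i ∈ C.goodSet, σ (C.rank i) = i) ∧
      (∀ j j', j ≤ j' → j' < C.numGood → C.labelCost (σ j) ≤ C.labelCost (σ j')) ∧
      ∀ f : ℕ → ℝ, ∑ j ∈ Finset.range C.numGood, f (σ j) = ∑ i ∈ C.goodSet, f i := by
  classical
  simp only [rank_eq, numGood_eq]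
  set R : ℕ → ℕ → Prop := fun j i =>
    C.labelCost j < C.labelCost i ∨ C.labelCost j = C.labelCost i ∧ j < i with hR
  have hirr : ∀ i, ¬ R i i := by intro i; simp [R]
  have htr : ∀ i j k, R i j → R j k → R i k := by intro i j k; simp only [R]; omega
  have htri : ∀ i ∈ C.goodSet, ∀ j ∈ C.goodSet, R i j ∨ i = j ∨ R j i := by
    intro i _ j _; simp only [R]; omega
  obtain ⟨σ, h1, h2, h3⟩ := exists_position_inverse hirr htr htri
  refine ⟨σ, h1, h2, fun j j' hj hj' => ?_, h3⟩
  obtain ⟨a1, a2⟩ := h1 j (by omega)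
  obtain ⟨b1, b2⟩ := h1 j' hj'
  by_contra hlt
  have := card_filter_lt_of_rel (s := C.goodSet) hirr htr b1 (show R (σ j') (σ j) from
    Or.inl (by omega))
  omega

theorem totalCost_eq : (C.totalCost : ℝ) =
    ∑ i ∈ C.goodSet, (C.labelWeight (C.rank i) : ℝ) * C.labelCost i := by
  classical
  rw [totalCost, goodSet, Finset.sum_filter]
  push_cast
  refine Finset.sum_congr rfl fun i _ => ?_
  split_ifs
  · ring
  · simp

/-- Among the admissible distributions on the good labels, each label taken with its least cost, the
greedy one is the cheapest. -/
theorem totalCost_le (h1 : C.lamN * C.numGood ≤ C.den) (h2 : C.den ≤ C.rhoN * C.numGood)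
    {y : ℕ → ℝ} (hl : ∀ i ∈ C.goodSet, (C.lamN : ℝ) ≤ y i)
    (hu : ∀ i ∈ C.goodSet, y i ≤ C.rhoN) (hs : ∑ i ∈ C.goodSet, y i = C.den) :
    (C.totalCost : ℝ) ≤ ∑ i ∈ C.goodSet, y i * C.labelCost i := by
  obtain ⟨σ, e1, e2, e3, e4⟩ := C.exists_label_order
  rw [totalCost_eq, ← e4, ← e4]
  rw [Finset.sum_congr rfl (g := fun j => (C.labelWeight j : ℝ) * C.labelCost (σ j)) fun j hj => by
    rw [(e1 j (Finset.mem_range.1 hj)).2]]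
  refine greedy_optimal h1 (by rwa [Nat.add_sub_cancel' lamN_le_rhoN]) (y := fun j => y (σ j))
    (c := fun j => (C.labelCost (σ j) : ℝ)) ?_ ?_ ?_ ?_
  · intro j j' hj hj'
    exact_mod_cast e3 j j' hj hj'
  · exact fun j hj => hl _ (e1 j hj).1
  · intro j hj
    rw [Nat.cast_sub lamN_le_rhoN]
    linarith [hu _ (e1 j hj).1]
  · rw [e4, hs]

variable {C : AccInstance} {i : ℕ}

/-! ### Words of a label class by index -/

/-- The word with index `j` and label `i`. -/
noncomputable def word (C : AccInstance) (i j : ℕ) : List (Fin C.letters) :=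
  (C.words i)[j]?.getD []

theorem word_eq {j : ℕ} (hj : j < (C.words i).length) : C.word i j = (C.words i)[j] := by
  rw [word, List.getElem?_eq_getElem hj, Option.getD_some]

theorem wordCost_eq_acc {j : ℕ} (hj : j < C.size i) : C.wordCost i j = C.cost.acc (C.word i j) := by
  rw [← length_words] at hj
  rw [word_eq hj, wordCost, List.getElem?_eq_getElem hj, Option.map_some, Option.getD_some]

theorem word_injOn : Set.InjOn (C.word i) (Finset.range (C.size i)) := by
  intro j hj j' hj' h
  simp only [Finset.coe_range, Set.mem_Iio, ← length_words] at hj hj'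
  rw [word_eq hj, word_eq hj'] at h
  exact (nodup_words.getElem_inj_iff).1 h

theorem toFinset_words : (C.words i).toFinset = (Finset.range (C.size i)).image (C.word i) := by
  ext w
  rw [List.mem_toFinset, Finset.mem_image, List.mem_iff_getElem]
  simp only [Finset.mem_range, ← length_words]
  constructor
  · rintro ⟨j, hj, rfl⟩
    exact ⟨j, hj, word_eq hj⟩
  · rintro ⟨j, hj, rfl⟩
    exact ⟨j, hj, (word_eq hj).symm⟩

theorem sum_words (f : List (Fin C.letters) → ℝ) :
    ∑ w ∈ (C.words i).toFinset, f w = ∑ j ∈ Finset.range (C.size i), f (C.word i j) := by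
  rw [toFinset_words, Finset.sum_image word_injOn]

theorem mem_labelClass_iff {i : Fin C.labels} {w : List (Fin C.letters)} :
    w ∈ C.toInstance.labelClass i ↔ ∃ j < C.size i, C.word i j = w := by
  rw [← mem_words, ← List.mem_toFinset, toFinset_words]
  simp

theorem coe_words (i : Fin C.labels) :
    ((C.words i).toFinset : Set (List (Fin C.letters))) = C.toInstance.labelClass i := by
  ext w
  simp [mem_words]

/-! ### Feasible instances satisfy the criterion -/

theorem prob_finset {α : Type} (D : PMF (List α)) (s : Finset (List α)) :
    prob D s = ∑ w ∈ s, (D w).toReal := by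
  rw [prob, PMF.toOuterMeasure_apply_finset, ENNReal.toReal_sum fun w _ => D.apply_ne_top w]

theorem prob_singleton {α : Type} (D : PMF (List α)) (w : List α) : prob D {w} = (D w).toReal := by
  have := prob_finset D {w}
  simpa using this

/-- The probability of the words with label `i`. -/
noncomputable def labelProb (C : AccInstance) (D : PMF (List (Fin C.letters))) (i : ℕ) : ℝ :=
  ∑ j ∈ Finset.range (C.size i), (D (C.word i j)).toReal

theorem prob_labelClass (D : PMF (List (Fin C.letters))) (i : Fin C.labels) :
    prob D (C.toInstance.labelClass i) = C.labelProb D i := by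
  rw [← coe_words, prob_finset, sum_words, labelProb]

/-- Under the hard constraint, an expectation is a finite sum over the label classes. -/
theorem tsum_eq_sum_labels {D : PMF (List (Fin C.letters))} (h : prob D C.toInstance.impr = 1)
    (f : List (Fin C.letters) → ℝ) : ∑' w, (D w).toReal * f w =
      ∑ i ∈ Finset.range C.labels, ∑ j ∈ Finset.range (C.size i),
        (D (C.word i j)).toReal * f (C.word i j) := by
  classical
  have hsup : ∀ w, w ∉ C.toInstance.impr → (D w).toReal = 0 := by
    have h1 : D.toOuterMeasure C.toInstance.impr = 1 := by
      have := (ENNReal.toReal_eq_one_iff _).1 h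
      exact this
    rw [PMF.toOuterMeasure_apply_eq_one_iff] at h1
    intro w hw
    have : D w = 0 := by
      by_contra h0
      exact hw (h1 ((PMF.mem_support_iff _ _).2 h0))
    rw [this, ENNReal.toReal_zero]
  rw [tsum_eq_sum (s := Finset.univ.biUnion fun i : Fin C.labels => (C.words i).toFinset),
    Finset.sum_biUnion, Finset.sum_range]
  · exact Finset.sum_congr rfl fun i _ => sum_words fun w => (D w).toReal * f w
  · intro i _ j _ hij
    refine Finset.disjoint_left.2 fun w hi hj => hij ?_
    rw [List.mem_toFinset, mem_words] at hi hj
    exact hi.2.symm.trans hj.2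
  · intro w hw
    rw [hsup w fun h => hw ?_, zero_mul]
    exact Finset.mem_biUnion.2 ⟨C.toInstance.L w, Finset.mem_univ _,
      List.mem_toFinset.2 (mem_words.2 ⟨h, rfl⟩)⟩

section Feasible

variable {D : PMF (List (Fin C.letters))} (hD : C.toInstance.IsImprovising D)

include hD

theorem sum_labelProb : ∑ i ∈ Finset.range C.labels, C.labelProb D i = 1 := by
  have h := tsum_eq_sum_labels hD.hard fun _ => 1
  simp only [mul_one] at h
  rw [← ENNReal.tsum_toReal_eq fun w => D.apply_ne_top w, D.tsum_coe, ENNReal.toReal_one] at h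
  exact h.symm

theorem cond_bounds {i : Fin C.labels} (hi : 0 < C.labelProb D i) {j : ℕ} (hj : j < C.size i) :
    (C.alphaN i : ℝ) ≤ (D (C.word i j)).toReal / C.labelProb D i * C.den ∧
      (D (C.word i j)).toReal / C.labelProb D i * C.den ≤ C.betaN i := by
  have h := hD.words i (by rwa [prob_labelClass]) (C.word i j) (mem_labelClass_iff.2 ⟨j, hj, rfl⟩)
  rw [prob_labelClass, prob_singleton] at h
  rw [cast_alphaN, cast_betaN]
  have : (0 : ℝ) ≤ C.den := Nat.cast_nonneg _
  exact ⟨mul_le_mul_of_nonneg_right h.1 this, mul_le_mul_of_nonneg_right h.2 this⟩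

omit hD in
theorem sum_cond {i : ℕ} (hi : 0 < C.labelProb D i) :
    ∑ j ∈ Finset.range (C.size i), (D (C.word i j)).toReal / C.labelProb D i * C.den = C.den := by
  rw [← Finset.sum_mul, ← Finset.sum_div, ← labelProb, div_self hi.ne', one_mul]

/-- Only good labels can have positive probability: sum the bounds over the label class. -/
theorem good_of_pos {i : Fin C.labels} (hi : 0 < C.labelProb D i) : C.Good i := by
  have hs := sum_cond hi
  constructor
  · have : ∑ j ∈ Finset.range (C.size i), (C.alphaN i : ℝ) ≤ C.den := by
      rw [← hs]
      exact Finset.sum_le_sum fun j hj => (cond_bounds hD hi (Finset.mem_range.1 hj)).1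
    rw [Finset.sum_const, Finset.card_range, nsmul_eq_mul] at this
    rw [mul_comm]
    exact_mod_cast this
  · have : (C.den : ℝ) ≤ ∑ j ∈ Finset.range (C.size i), (C.betaN i : ℝ) := by
      rw [← hs]
      exact Finset.sum_le_sum fun j hj => (cond_bounds hD hi (Finset.mem_range.1 hj)).2
    rw [Finset.sum_const, Finset.card_range, nsmul_eq_mul] at this
    rw [mul_comm]
    exact_mod_cast this

omit hD in
theorem labelProb_nonneg : 0 ≤ C.labelProb D i := Finset.sum_nonneg fun _ _ => ENNReal.toReal_nonneg

theorem labelProb_eq_zero {i : ℕ} (hi : i < C.labels) (h : ¬ C.Good i) : C.labelProb D i = 0 := by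
  by_contra h0
  exact h (good_of_pos hD (i := ⟨i, hi⟩) (lt_of_le_of_ne labelProb_nonneg (Ne.symm h0)))

theorem label_bounds {i : ℕ} (hi : i < C.labels) : (C.lamN : ℝ) ≤ C.labelProb D i * C.den ∧
    C.labelProb D i * C.den ≤ C.rhoN := by
  have h := hD.labels ⟨i, hi⟩
  rw [prob_labelClass] at h
  rw [cast_lamN, cast_rhoN]
  have : (0 : ℝ) ≤ C.den := Nat.cast_nonneg _
  exact ⟨mul_le_mul_of_nonneg_right h.1 this, mul_le_mul_of_nonneg_right h.2 this⟩

theorem sum_labelProb_good : ∑ i ∈ C.goodSet, C.labelProb D i = 1 := by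
  classical
  rw [← sum_labelProb hD, goodSet, Finset.sum_filter]
  refine Finset.sum_congr rfl fun i hi => ?_
  split_ifs with h
  · rfl
  · exact (labelProb_eq_zero hD (Finset.mem_range.1 hi) h).symm

/-- The contribution of a good label to the expected cost is at least its probability times the
least expected cost under that label. -/
theorem labelProb_mul_cost_le {i : ℕ} (hi : i ∈ C.goodSet) :
    C.labelProb D i * C.labelCost i ≤
      C.den * ∑ j ∈ Finset.range (C.size i), (D (C.word i j)).toReal * C.wordCost i j := by
  obtain ⟨hi, hg⟩ := mem_goodSet.1 hi
  rcases labelProb_nonneg.eq_or_lt with h0 | h0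
  · have h1 : ∀ j ∈ Finset.range (C.size i), (D (C.word i j)).toReal = 0 :=
      (Finset.sum_eq_zero_iff_of_nonneg fun _ _ => ENNReal.toReal_nonneg).1 h0.symm
    rw [← h0, Finset.sum_eq_zero fun j hj => by rw [h1 j hj, zero_mul]]
    simp
  · have h1 := labelCost_le ⟨i, hi⟩ hg
      (fun j hj => (cond_bounds hD (i := ⟨i, hi⟩) h0 hj).1)
      (fun j hj => (cond_bounds hD (i := ⟨i, hi⟩) h0 hj).2) (sum_cond h0)
    refine (mul_le_mul_of_nonneg_left h1 h0.le).trans (le_of_eq ?_)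
    rw [Finset.mul_sum, Finset.mul_sum]
    refine Finset.sum_congr rfl fun j _ => ?_
    dsimp only
    field_simp

/-- The criterion is necessary: averaging the bounds over the good labels gives the existence of the
greedy distributions, and their optimality gives the bound on the cost. -/
theorem criterion_of_improvising : C.Criterion := by
  have hsum : ∑ i ∈ C.goodSet, C.labelProb D i * C.den = C.den := by
    rw [← Finset.sum_mul, sum_labelProb_good hD, one_mul]
  have hb : ∀ i ∈ C.goodSet, _ := fun i hi => label_bounds hD (mem_goodSet.1 hi).1
  have h2 : C.lamN * C.numGood ≤ C.den ∧ C.den ≤ C.rhoN * C.numGood := by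
    constructor
    · have := Finset.sum_le_sum fun i hi => (hb i hi).1
      rw [hsum, Finset.sum_const, nsmul_eq_mul, ← numGood_eq, mul_comm] at this
      exact_mod_cast this
    · have := Finset.sum_le_sum fun i hi => (hb i hi).2
      rw [hsum, Finset.sum_const, nsmul_eq_mul, ← numGood_eq, mul_comm] at this
      exact_mod_cast this
  refine ⟨?_, h2, ?_⟩
  · by_contra! h
    have hlt : C.goodSet.card ≠ (Finset.range C.labels).card := by
      rw [← numGood_eq, Finset.card_range]; exact h.2
    have : ∃ i < C.labels, ¬ C.Good i := by
      by_contra! hall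
      refine hlt ?_
      congr 1
      ext i
      rw [mem_goodSet, Finset.mem_range]
      exact ⟨fun h => h.1, fun h => ⟨h, hall i h⟩⟩
    obtain ⟨i, hi, hg⟩ := this
    have h3 := (label_bounds hD hi).1
    rw [labelProb_eq_zero hD hi hg, zero_mul] at h3
    have : C.lamN ≤ 0 := by exact_mod_cast h3
    exact h.1 (by omega)
  · have h3 := totalCost_le h2.1 h2.2 (fun i hi => (hb i hi).1) (fun i hi => (hb i hi).2) hsum
    have h4 : ∑ i ∈ C.goodSet, C.labelProb D i * C.den * C.labelCost i ≤
        C.den * C.den * ∑' w, (D w).toReal * (C.toInstance.K w : ℝ) := by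
      rw [tsum_eq_sum_labels hD.hard, ← Finset.sum_subset (s₁ := C.goodSet)
        (fun i hi => Finset.mem_range.2 (mem_goodSet.1 hi).1), Finset.mul_sum]
      · refine Finset.sum_le_sum fun i hi => ?_
        have h5 := labelProb_mul_cost_le hD hi
        have h6 : ∑ j ∈ Finset.range (C.size i),
            (D (C.word i j)).toReal * (C.toInstance.K (C.word i j) : ℝ) =
            ∑ j ∈ Finset.range (C.size i), (D (C.word i j)).toReal * C.wordCost i j := by
          refine Finset.sum_congr rfl fun j hj => ?_
          rw [wordCost_eq_acc (Finset.mem_range.1 hj)]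
          simp [toInstance]
        rw [h6]
        have h7 : (0 : ℝ) ≤ C.den := Nat.cast_nonneg _
        nlinarith
      · intro i hi hg
        have h8 : C.labelProb D i = 0 := labelProb_eq_zero hD (Finset.mem_range.1 hi)
          fun h => hg (mem_goodSet.2 ⟨Finset.mem_range.1 hi, h⟩)
        have h1 : ∀ j ∈ Finset.range (C.size i), (D (C.word i j)).toReal = 0 :=
          (Finset.sum_eq_zero_iff_of_nonneg fun _ _ => ENNReal.toReal_nonneg).1 h8
        exact Finset.sum_eq_zero fun j hj => by rw [h1 j hj, zero_mul]
    have h5 : (C.totalCost : ℝ) ≤ C.den * C.den * C.params.c :=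
      (h3.trans h4).trans (mul_le_mul_of_nonneg_left hD.cost (by positivity))
    have h6 : (C.params.c : ℝ) = C.params.c.num / C.params.c.den := by
      exact_mod_cast (Rat.num_div_den C.params.c).symm
    have h7 : (0 : ℝ) < C.params.c.den := by exact_mod_cast C.params.c.den_pos
    rw [h6, ← mul_div_assoc, le_div_iff₀ h7] at h5
    have : (C.params.c.den : ℝ) * C.totalCost ≤ C.params.c.num * (C.den * C.den) := by linarith
    exact_mod_cast this

end Feasible

/-! ### The distribution of an instance that satisfies the criterion -/

theorem sum_range_mul' (f : ℕ → ℝ) (a b : ℕ) : ∑ r ∈ Finset.range (a * b), f r =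
    ∑ x ∈ Finset.range a, ∑ y ∈ Finset.range b, f (b * x + y) := by
  induction a with
  | zero => simp
  | succ a ih => rw [Nat.succ_mul, Finset.sum_range_add, ih, Finset.sum_range_succ, mul_comm a b]

/-- The word that is drawn for a position `r < den ^ 2`. -/
noncomputable def drawWord (C : AccInstance) (r : ℕ) : List (Fin C.letters) :=
  C.word (C.drawLabel (r / C.den))
    (C.drawIndex (C.drawLabel (r / C.den)) (r - C.den * (r / C.den)))

section Criterion

variable (hC : C.Criterion)

include hC

theorem criterion_gap : C.lamN * C.numGood ≤ C.den ∧
    C.den ≤ (C.lamN + (C.rhoN - C.lamN)) * C.numGood := by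
  rw [Nat.add_sub_cancel' lamN_le_rhoN]
  exact hC.2.1

omit hC in
/-- The label with a given rank is unique, so the sum in `drawLabel` has one term. -/
theorem drawLabel_eq {σ : ℕ → ℕ} (h1 : ∀ j < C.numGood, σ j ∈ C.goodSet ∧ C.rank (σ j) = j)
    (h2 : ∀ i ∈ C.goodSet, σ (C.rank i) = i) {r : ℕ}
    (hr : greedyItem C.lamN (C.rhoN - C.lamN) C.numGood r < C.numGood) :
    C.drawLabel r = σ (greedyItem C.lamN (C.rhoN - C.lamN) C.numGood r) := by
  classical
  obtain ⟨h3, h4⟩ := h1 _ hr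
  obtain ⟨h5, h6⟩ := mem_goodSet.1 h3
  rw [drawLabel, Finset.sum_eq_single (σ (greedyItem C.lamN (C.rhoN - C.lamN) C.numGood r)),
    if_pos ⟨h6, h4⟩]
  · intro i hi hne
    refine if_neg fun h => hne ?_
    rw [← h.2, h2 i (mem_goodSet.2 ⟨Finset.mem_range.1 hi, h.1⟩)]
  · intro h
    exact absurd (Finset.mem_range.2 h5) h

theorem drawLabel_mem {r : ℕ} (hr : r < C.den) : C.drawLabel r ∈ C.goodSet := by
  obtain ⟨σ, h1, h2, -⟩ := C.exists_label_order
  have := greedyItem_lt (criterion_gap hC).1 (criterion_gap hC).2 hr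
  rw [drawLabel_eq h1 h2 this]
  exact (h1 _ this).1

/-- The value computed for a position is the word drawn for it. -/
theorem drawVal_eq {r : ℕ} (hr : r < C.den * C.den) : C.drawVal r = .word (C.drawWord r) := by
  have h1 := mem_goodSet.1 (drawLabel_mem hC (r := r / C.den) (Nat.div_lt_of_lt_mul hr))
  have h2 := good_gap ⟨_, h1.1⟩ h1.2
  have h3 : r - C.den * (r / C.den) < C.den := by
    rw [← Nat.mod_eq_sub_mul_div]; exact Nat.mod_lt _ C.den_pos
  have h4 := greedyItem_lt h2.1 h2.2 h3
  have h5 : C.drawIndex (C.drawLabel (r / C.den)) (r - C.den * (r / C.den)) <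
      (C.words (C.drawLabel (r / C.den))).length := by
    rw [length_words]; exact h4
  rw [drawVal, drawWord, word_eq h5, ← wordVal_words]

/-- A uniformly random position draws word `j` of label `i` with the product of the greedy weights
of `i` and of `j`. -/
theorem sum_drawWord (f : List (Fin C.letters) → ℝ) :
    ∑ r ∈ Finset.range (C.den * C.den), f (C.drawWord r) =
      ∑ i ∈ C.goodSet, (C.labelWeight (C.rank i) : ℝ) *
        ∑ j ∈ Finset.range (C.size i), (C.wordWeight i j : ℝ) * f (C.word i j) := by
  obtain ⟨σ, h1, h2, -, h4⟩ := C.exists_label_order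
  obtain ⟨g1, g2⟩ := criterion_gap hC
  rw [sum_range_mul', ← h4]
  have e1 : ∀ x ∈ Finset.range C.den, ∑ y ∈ Finset.range C.den, f (C.drawWord (C.den * x + y)) =
      ∑ j ∈ Finset.range (C.size (σ (greedyItem C.lamN (C.rhoN - C.lamN) C.numGood x))),
        (C.wordWeight (σ (greedyItem C.lamN (C.rhoN - C.lamN) C.numGood x)) j : ℝ) *
          f (C.word (σ (greedyItem C.lamN (C.rhoN - C.lamN) C.numGood x)) j) := by
    intro x hx
    have hx' := Finset.mem_range.1 hx
    have hi := mem_goodSet.1 (h1 _ (greedyItem_lt g1 g2 hx')).1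
    have hgap := good_gap ⟨_, hi.1⟩ hi.2
    unfold wordWeight
    rw [← sum_greedyItem hgap.1 hgap.2 fun j =>
      f (C.word (σ (greedyItem C.lamN (C.rhoN - C.lamN) C.numGood x)) j)]
    refine Finset.sum_congr rfl fun y hy => ?_
    have hy' := Finset.mem_range.1 hy
    rw [drawWord, Nat.mul_add_div C.den_pos, Nat.div_eq_of_lt hy', add_zero,
      drawLabel_eq h1 h2 (greedyItem_lt g1 g2 hx'), Nat.add_sub_cancel_left]
    rfl
  rw [Finset.sum_congr rfl e1, sum_greedyItem g1 g2 fun t => ∑ j ∈ Finset.range (C.size (σ t)),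
    (C.wordWeight (σ t) j : ℝ) * f (C.word (σ t) j)]
  refine Finset.sum_congr rfl fun j hj => ?_
  rw [(h1 j (Finset.mem_range.1 hj)).2]
  rfl

omit hC in
theorem sum_wordWeight {i : ℕ} (hi : i ∈ C.goodSet) :
    ∑ j ∈ Finset.range (C.size i), (C.wordWeight i j : ℝ) = C.den := by
  obtain ⟨h1, h2⟩ := mem_goodSet.1 hi
  have hgap := good_gap ⟨i, h1⟩ h2
  rw [← Nat.cast_sum]
  exact congrArg _ (sum_greedy_full hgap.1 hgap.2)

end Criterion

instance : NeZero (C.den * C.den) := ⟨(Nat.mul_pos C.den_pos C.den_pos).ne'⟩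

/-- The distribution of the word that is drawn for a uniformly random position. -/
noncomputable def dist (C : AccInstance) : PMF (List (Fin C.letters)) :=
  PMF.map (fun r : Fin (C.den * C.den) => C.drawWord r)
    (PMF.uniformOfFintype (Fin (C.den * C.den)))

open Classical in
theorem dist_apply (w : List (Fin C.letters)) : C.dist w =
    ((C.den * C.den : ℕ) : ℝ≥0∞)⁻¹ *
      ∑ r ∈ Finset.range (C.den * C.den), if C.drawWord r = w then 1 else 0 := by
  rw [dist, PMF.map_apply, tsum_fintype, Finset.mul_sum, Finset.sum_range]
  refine Finset.sum_congr rfl fun r _ => ?_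
  rw [PMF.uniformOfFintype_apply, Fintype.card_fin]
  by_cases h : C.drawWord r = w
  · simp [h]
  · simp [h, Ne.symm h]

open Classical in
theorem toReal_dist (w : List (Fin C.letters)) : (C.dist w).toReal =
    (∑ r ∈ Finset.range (C.den * C.den), if C.drawWord r = w then 1 else 0) /
      ((C.den : ℝ) * C.den) := by
  rw [dist_apply, ENNReal.toReal_mul, ENNReal.toReal_inv, ENNReal.toReal_natCast, mul_comm,
    ← div_eq_mul_inv, Nat.cast_mul, ENNReal.toReal_sum]
  · congr 1
    exact Finset.sum_congr rfl fun r _ => by split_ifs <;> simp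
  · intro r _; split_ifs <;> simp

theorem tsum_dist (f : List (Fin C.letters) → ℝ) : ∑' w, (C.dist w).toReal * f w =
    (∑ r ∈ Finset.range (C.den * C.den), f (C.drawWord r)) / ((C.den : ℝ) * C.den) := by
  classical
  simp only [toReal_dist, div_mul_eq_mul_div, Finset.sum_mul, ite_mul, one_mul, zero_mul]
  rw [tsum_div_const, Summable.tsum_finsetSum]
  · refine congrArg (· / ((C.den : ℝ) * C.den)) (Finset.sum_congr rfl fun r _ => ?_)
    rw [tsum_eq_single (C.drawWord r) fun w hw => if_neg hw.symm, if_pos rfl]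
  · intro r _
    exact (hasSum_ite_eq (C.drawWord r) (f (C.drawWord r))).summable.congr fun w => by
      by_cases h : w = C.drawWord r
      · simp [h]
      · simp [h, Ne.symm h]

open Classical in
theorem prob_dist (A : Set (List (Fin C.letters))) : prob C.dist A =
    (∑ r ∈ Finset.range (C.den * C.den), if C.drawWord r ∈ A then 1 else 0) /
      ((C.den : ℝ) * C.den) := by
  rw [← tsum_dist fun w => if w ∈ A then 1 else 0, prob, PMF.toOuterMeasure_apply,
    ENNReal.tsum_toReal_eq]
  · refine tsum_congr fun w => ?_
    by_cases h : w ∈ A <;> simp [h]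
  · intro w
    by_cases h : w ∈ A <;> simp [h, PMF.apply_ne_top]

section Criterion

variable (hC : C.Criterion)

include hC

theorem prob_dist_labelClass (i : Fin C.labels) : prob C.dist (C.toInstance.labelClass i) =
    if (i : ℕ) ∈ C.goodSet then (C.labelWeight (C.rank i) : ℝ) / C.den else 0 := by
  classical
  have hT : (C.den : ℝ) ≠ 0 := by exact_mod_cast C.den_pos.ne'
  rw [prob_dist, sum_drawWord hC fun w => if w ∈ C.toInstance.labelClass i then 1 else 0]
  have h1 : ∀ i' ∈ C.goodSet, (C.labelWeight (C.rank i') : ℝ) *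
      ∑ j ∈ Finset.range (C.size i'), (C.wordWeight i' j : ℝ) *
        (if C.word i' j ∈ C.toInstance.labelClass i then 1 else 0) =
      if i' = i then (C.labelWeight (C.rank i) : ℝ) * C.den else 0 := by
    intro i' hi'
    have h2 : ∀ j ∈ Finset.range (C.size i'),
        (C.word i' j ∈ C.toInstance.labelClass i ↔ i' = i) := by
      intro j hj
      have h3 : C.word i' j ∈ C.toInstance.labelClass ⟨i', (mem_goodSet.1 hi').1⟩ :=
        mem_labelClass_iff.2 ⟨j, Finset.mem_range.1 hj, rfl⟩
      constructor
      · intro h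
        exact Fin.ext_iff.1 (h3.2.symm.trans h.2)
      · rintro rfl
        exact h3
    rw [Finset.sum_congr rfl fun j hj => by rw [if_congr (h2 j hj) rfl rfl]]
    split_ifs with h
    · subst h
      simp only [mul_one, sum_wordWeight hi']
    · simp
  rw [Finset.sum_congr rfl h1, Finset.sum_ite_eq']
  split_ifs
  · field_simp
  · simp

theorem prob_dist_word {i : Fin C.labels} (hi : (i : ℕ) ∈ C.goodSet) {j : ℕ} (hj : j < C.size i) :
    prob C.dist {C.word i j} =
      (C.labelWeight (C.rank i) : ℝ) / C.den * (C.wordWeight i j / C.den) := by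
  classical
  have hT : (C.den : ℝ) ≠ 0 := by exact_mod_cast C.den_pos.ne'
  rw [prob_singleton, toReal_dist, sum_drawWord hC fun w => if w = C.word i j then 1 else 0]
  have h0 : C.word i j ∈ C.toInstance.labelClass i := mem_labelClass_iff.2 ⟨j, hj, rfl⟩
  rw [Finset.sum_eq_single (i : ℕ), Finset.sum_eq_single j]
  · simp
    field_simp
  · intro j' hj' hne
    rw [if_neg fun h => hne (word_injOn hj' (Finset.mem_coe.2 (Finset.mem_range.2 hj)) h), mul_zero]
  · intro h
    exact absurd (Finset.mem_range.2 hj) h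
  · intro i' hi' hne
    rw [Finset.sum_eq_zero, mul_zero]
    intro j' hj'
    rw [if_neg, mul_zero]
    intro h
    have h3 : C.word i' j' ∈ C.toInstance.labelClass ⟨i', (mem_goodSet.1 hi').1⟩ :=
      mem_labelClass_iff.2 ⟨j', Finset.mem_range.1 hj', rfl⟩
    rw [show C.word i' j' = C.word i j from h] at h3
    exact hne (Fin.ext_iff.1 (h3.2.symm.trans h0.2))
  · intro h
    exact absurd hi h

/-- The greedy distribution is improvising if the criterion holds. -/
theorem isImprovising_dist : C.toInstance.IsImprovising C.dist := by
  classical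
  have hT : (0 : ℝ) < C.den := by exact_mod_cast C.den_pos
  obtain ⟨σ, h1, h2, -, h4⟩ := C.exists_label_order
  obtain ⟨g1, g2⟩ := criterion_gap hC
  have hlw : ∑ i ∈ C.goodSet, (C.labelWeight (C.rank i) : ℝ) = C.den := by
    rw [← h4, Finset.sum_congr rfl (g := fun j => (C.labelWeight j : ℝ)) fun j hj => by
      rw [(h1 j (Finset.mem_range.1 hj)).2], ← Nat.cast_sum]
    exact congrArg _ (sum_greedy_full g1 g2)
  constructor
  · rw [prob_dist, sum_drawWord hC fun w => if w ∈ C.toInstance.impr then 1 else 0]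
    rw [Finset.sum_congr rfl (g := fun i => (C.labelWeight (C.rank i) : ℝ) * C.den),
      ← Finset.sum_mul, hlw, div_self (by positivity)]
    intro i hi
    rw [← sum_wordWeight hi]
    congr 1
    refine Finset.sum_congr rfl fun j hj => ?_
    have : C.word i j ∈ C.toInstance.labelClass ⟨i, (mem_goodSet.1 hi).1⟩ :=
      mem_labelClass_iff.2 ⟨j, Finset.mem_range.1 hj, rfl⟩
    rw [if_pos this.1, mul_one]
  · rw [tsum_dist, sum_drawWord hC fun w => (C.toInstance.K w : ℝ)]
    have h5 : ∑ i ∈ C.goodSet, (C.labelWeight (C.rank i) : ℝ) *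
        ∑ j ∈ Finset.range (C.size i), (C.wordWeight i j : ℝ) * (C.toInstance.K (C.word i j) : ℝ) =
        C.totalCost := by
      rw [totalCost_eq]
      refine Finset.sum_congr rfl fun i _ => ?_
      rw [labelCost_eq]
      push_cast
      congr 1
      refine Finset.sum_congr rfl fun j hj => ?_
      rw [wordCost_eq_acc (Finset.mem_range.1 hj)]
      simp [toInstance]
    have h6 : (C.params.c : ℝ) = C.params.c.num / C.params.c.den := by
      exact_mod_cast (Rat.num_div_den C.params.c).symm
    have h7 : (0 : ℝ) < C.params.c.den := by exact_mod_cast C.params.c.den_pos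
    have h8 : (C.params.c.den : ℝ) * C.totalCost ≤ C.params.c.num * (C.den * C.den) := by
      exact_mod_cast hC.2.2
    change _ ≤ ((C.params.c : ℚ) : ℝ)
    rw [h5, h6, div_le_div_iff₀ (by positivity) h7]
    linarith
  · intro i
    rw [prob_dist_labelClass hC]
    change ((C.params.lam : ℚ) : ℝ) ≤ _ ∧ _ ≤ ((C.params.rho : ℚ) : ℝ)
    split_ifs with h
    · rw [le_div_iff₀ hT, div_le_iff₀ hT, ← cast_lamN, ← cast_rhoN]
      have a1 := le_greedy (a := C.lamN) (d := C.rhoN - C.lamN) (N := C.numGood) (T := C.den)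
        (C.rank i)
      have a2 := greedy_le (a := C.lamN) (d := C.rhoN - C.lamN) (N := C.numGood) (T := C.den)
        (C.rank i)
      rw [Nat.add_sub_cancel' lamN_le_rhoN] at a2
      exact ⟨by exact_mod_cast a1, by exact_mod_cast a2⟩
    · -- a label that is not good forces the lower bound to vanish
      have h0 : C.lamN = 0 := by
        refine hC.1.resolve_right fun hn => h ?_
        have : C.goodSet = Finset.range C.labels :=
          Finset.eq_of_subset_of_card_le (fun i hi => Finset.mem_range.2 (mem_goodSet.1 hi).1)
            (by rw [Finset.card_range, ← numGood_eq, hn])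
        rw [this]
        exact Finset.mem_range.2 i.2
      have h9 : (C.params.lam : ℝ) = 0 := by
        have := cast_lamN (C := C)
        rw [h0, Nat.cast_zero] at this
        rcases mul_eq_zero.1 this.symm with h | h
        · exact h
        · exact absurd h hT.ne'
      refine ⟨h9.le, ?_⟩
      exact_mod_cast C.params.lam_nonneg.trans C.params.lam_le_rho
  · intro i hi y hy
    rw [prob_dist_labelClass hC] at hi ⊢
    split_ifs at hi ⊢ with h
    · obtain ⟨j, hj, rfl⟩ := mem_labelClass_iff.1 hy
      rw [prob_dist_word hC h hj, mul_div_cancel_left₀ _ hi.ne']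
      change ((C.params.alpha i : ℚ) : ℝ) ≤ _ ∧ _ ≤ ((C.params.beta i : ℚ) : ℝ)
      rw [le_div_iff₀ hT, div_le_iff₀ hT, ← cast_alphaN, ← cast_betaN]
      have a1 := le_greedy (a := C.alphaN i) (d := C.betaN i - C.alphaN i) (N := C.size i)
        (T := C.den) j
      have a2 := greedy_le (a := C.alphaN i) (d := C.betaN i - C.alphaN i) (N := C.size i)
        (T := C.den) j
      rw [Nat.add_sub_cancel' (alphaN_le_betaN i)] at a2
      exact ⟨by exact_mod_cast a1, by exact_mod_cast a2⟩
    · exact absurd hi (lt_irrefl 0)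

end Criterion

/-- The criterion decides feasibility. -/
theorem feasible_iff : C.toInstance.Feasible ↔ C.Criterion :=
  ⟨fun ⟨_, hD⟩ => criterion_of_improvising hD, fun hC => ⟨C.dist, isImprovising_dist hC⟩⟩

end AccInstance

/-! ### The improvisation scheme -/

theorem Val.word_injective {a : ℕ} : Function.Injective (Val.word (a := a)) := by
  intro w w' h
  rw [Val.word_eq, Val.word_eq] at h
  induction w generalizing w' with
  | nil => cases w' <;> simp_all [Val.list]
  | cons x w ih =>
    cases w' with
    | nil => simp [Val.list] at h
    | cons y w' =>
      simp only [Val.list, List.map_cons, Val.pair.injEq, Val.num.injEq, Nat.cast_inj,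
        Fin.val_inj] at h
      rw [h.1, ih h.2]

namespace AccInstance

/-- Every instance is available from its own text. -/
theorem Poly.self : Poly pseudoSize encode fun C => C :=
  ⟨.refl ((PolyBdd.self _).mono fun _ => Nat.le_add_right _ _), .self _⟩

/-- The text of an instance is turned into a random word, in polynomial expected time. -/
theorem exists_sampler : ∃ (p : Prog) (t : AccInstance → ℕ), PolyBdd pseudoSize t ∧
    ∀ C : AccInstance, (∀ F, p.mean C.encode F = ((C.den * C.den : ℕ) : ℝ≥0∞)⁻¹ *
      ∑ r ∈ Finset.range (C.den * C.den), F (C.drawVal r)) ∧ p.time C.encode ≤ t C := by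
  have hD : PolyNat pseudoSize encode fun C => C.den * C.den := Poly.self.den.mul Poly.self.den
  have hpos : ∀ C : AccInstance, 0 < C.den * C.den := fun C => Nat.mul_pos C.den_pos C.den_pos
  obtain ⟨u, t₁, ht₁, hu⟩ := exists_uniform Poly.self.size_env hD hpos
  let M : AccInstance × ℕ → ℕ := fun p => p.1.pseudoSize + p.2.size
  let e : AccInstance × ℕ → Val := fun p => .pair p.1.encode (.num p.2)
  have h0 : PolyTime M e e := .refl (((PolyBdd.self M).add (.const 2)).mono fun p => by
    simp only [e, M, Val.size, pseudoSize, Int.natAbs_natCast]; omega)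
  have hC : Poly M e fun p => p.1 :=
    ⟨h0.fst, (PolyBdd.self M).mono fun _ => Nat.le_add_right _ _⟩
  obtain ⟨d, t₂, ⟨P, hP⟩, hd⟩ := (hC.drawVal (r := fun p => p.2) (PolyTime.snd h0)).exists_prog
  have hsz : PolyBdd pseudoSize fun C => C.pseudoSize + (C.den * C.den).size :=
    (PolyBdd.self _).add ((PolyTime.size_out hD).mono fun C => by
      simp only [Val.size, Int.natAbs_natCast]; omega)
  refine ⟨.comp u d, fun C => 1 + t₁ C + P.eval (C.pseudoSize + (C.den * C.den).size),
    ((PolyBdd.const 1).add ht₁).add (PolyBdd.trans (h := fun C : AccInstance =>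
      P.eval (C.pseudoSize + (C.den * C.den).size)) ⟨P, fun _ => le_rfl⟩ hsz),
    fun C => ⟨fun F => ?_, ?_⟩⟩
  · rw [mean_comp, (hu C).1]
    simp only [show ∀ v : ℕ, d.mean (.pair C.encode (.num v)) F = F (C.drawVal v) from
      fun v => (hd (C, v)).1 F]
  · refine (time_comp_le _ _ _).trans ?_
    rw [(hu C).1]
    rw [Nat.cast_add, Nat.cast_add, Nat.cast_one]
    refine add_le_add (add_le_add le_rfl (hu C).2) ?_
    refine inv_mul_sum_le (hpos C) fun v hv => (hd (C, v)).2.trans (Nat.cast_le.2 ((hP _).trans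
      (eval_mono_nat P ?_)))
    exact Nat.add_le_add_left (Nat.size_le_size hv.le) _

/-- A program that draws `C.drawVal r` for a uniformly random position `r` is an improviser. -/
theorem isImproviser_of_mean {C : AccInstance} (hC : C.Criterion) {G : Prog} {T : ℕ}
    (hmean : ∀ F, G.mean (.num 0) F = ((C.den * C.den : ℕ) : ℝ≥0∞)⁻¹ *
      ∑ r ∈ Finset.range (C.den * C.den), F (C.drawVal r)) (htime : G.time (.num 0) ≤ T) :
    C.toInstance.IsImproviser G ∧ G.expTime (.num 0) ≤ T := by
  classical
  have hhalt : G.haltProb (.num 0) = 1 := by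
    have h0 : ((C.den * C.den : ℕ) : ℝ≥0∞) ≠ 0 := by
      exact_mod_cast (Nat.mul_pos C.den_pos C.den_pos).ne'
    rw [haltProb_eq]
    refine (hmean fun _ => 1).trans ?_
    rw [Finset.sum_const, Finset.card_range, nsmul_eq_mul, mul_one,
      ENNReal.inv_mul_cancel h0 (by finiteness)]
  have hexp : G.expTime (.num 0) ≤ T := by rw [expTime_eq hhalt]; exact htime
  refine ⟨⟨hexp.trans_lt (ENNReal.natCast_lt_top T), C.dist, isImprovising_dist hC, fun w => ?_⟩,
    hexp⟩
  rw [outProb_eq, dist_apply]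
  refine (hmean fun z => if z = .word w then 1 else 0).trans ?_
  congr 1
  refine Finset.sum_congr rfl fun r hr => ?_
  rw [drawVal_eq hC (Finset.mem_range.1 hr)]
  simp only [Val.word_injective.eq_iff]

end AccInstance

end LQCI

theorem theorem4 :
    ∃ (S : LQCI.Prog) (p q : Polynomial ℕ), ∀ (C : LQCI.AccInstance) (coins : ℕ → Bool),
      ∃ (k : ℕ) (y : LQCI.Val) (t : ℕ),
        LQCI.Eval S C.encode ((List.range k).map coins) y t ∧
        t ≤ p.eval C.pseudoSize ∧
        ((C.toInstance.Feasible ∧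
            ∃ G : LQCI.Prog, y = .pair (.num 1) G.encode ∧
              C.toInstance.IsImproviser G ∧
              G.expTime (.num 0) ≤ ((q.eval C.pseudoSize : ℕ) : ENNReal)) ∨
          (¬ C.toInstance.Feasible ∧ y = .num 0)) := by
  classical
  open LQCI LQCI.AccInstance in
  obtain ⟨p, t, ht, hp⟩ := exists_sampler
  let G : AccInstance → Prog := fun C => .comp (.const C.encode) p
  have henc : PolyBdd pseudoSize fun C => C.encode.size := Poly.self.size_env
  -- the text of `G C` is a fixed template (`4` stands for `comp`, `1` for `const`) around the
  -- text of the instance, which is at hand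
  have hG : PolyTime pseudoSize encode fun C => .pair (.num 1) (G C).encode :=
    (PolyTime.const henc (.num 1)).pair ((PolyTime.const henc (.num 4)).pair
      (((PolyTime.const henc (.num 1)).pair Poly.self.text).pair (.const henc p.encode)))
  obtain ⟨S, P, hS⟩ := Poly.self.criterion.ite hG (.const henc (.num 0))
  obtain ⟨Q, hQ⟩ := ((PolyBdd.const 1).add ((PolyBdd.const 2).add henc)).add ht
  refine ⟨S, P, Q, fun C coins => ?_⟩
  obtain ⟨s, hs, h⟩ := hS C
  -- the scheme itself flips no coins
  refine ⟨0, _, s, h, hs, ?_⟩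
  by_cases hC : C.Criterion
  · refine .inl ⟨feasible_iff.2 hC, G C, if_pos hC, ?_⟩
    refine (isImproviser_of_mean hC (T := Q.eval C.pseudoSize) (fun F => ?_) ?_)
    · rw [mean_comp, mean_det (.const C.encode (.num 0)), (hp C).1]
    · refine le_trans ?_ (Nat.cast_le.2 (hQ C))
      refine (time_comp_le _ _ _).trans ?_
      rw [mean_det (.const C.encode (.num 0)), time_det (.const C.encode (.num 0))]
      simp only [Val.size, Int.natAbs_zero, Nat.size_zero]
      push_cast
      refine add_le_add (le_of_eq ?_) (hp C).2
      ring
  · exact .inr ⟨fun h => hC (feasible_iff.1 h), if_neg hC⟩
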